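/- Let $\mathbf{R}$ be the first-order theory in the language $\{\mathbf 0,\mathbf S,+,\cdot\}$, with $x\le y$ abbreviating $\exists z\,(z+x=y)$ and $\overline n=\mathbf S^n\mathbf 0$, whose axioms are, for all $m,n\in\mathbb N$: (Ax1) $\overline m+\overline n=\overline{m+n}$; (Ax2) $\overline m\cdot\overline n=\overline{m\cdot n}$; (Ax3) $\overline m\ne\overline n$ if $m\neq n$; (Ax4) $\forall x\,(x\le\overline n\to x=\overline 0\vee\dots\vee x=\overline n)$; (Ax5) $\forall x\,(x\le\overline n\vee\overline n\le x)$. For a theory $T$ let $T_P$ and $T_R$ be the sets of Gödel numbers of sentences provable, respectively refutable, in $T$. $T$ is RE (decidable) if $T_P$ is recursively enumerable (recursive). Let $W_i$ be the RE set with index $i$. An extension of a theory $T$ is a theory $S$, possibly in a larger (countable, Gödel-numbered) language, that proves every theorem of $T$. **Theorem.** $\mathbf R$ is a consistent RE theory, and the following hold. (A) Let $A,B\subseteq\mathbb N$ be disjoint RE sets. Then there are $\Sigma^0_1$-formulas $\sigma(x)=\exists y\,\varphi_0(x,y)$ and $\sigma'(x)=\exists y\,\varphi_1(x,y)$, with $\varphi_0,\varphi_1$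 bounded ($\Delta^0_0$), that define $A$ and $B$ respectively in the standard model $\langle\mathbb N,0,S,+,\times\rangle$; and for all such formulas the witness comparison formula $$\sigma(x)<\sigma'(x)\;:=\;\exists y\,\bigl(\varphi_0(x,y)\wedge\forall z\le y\;\neg\varphi_1(x,z)\bigr)$$ separates $(A,B)$ in $\mathbf R$: if $n\in A$ then $\mathbf R\vdash\sigma(\overline n)<\sigma'(\overline n)$, and if $n\in B$ then $\mathbf R\vdash\neg(\sigma(\overline n)<\sigma'(\overline n))$. (B) $T=\mathbf R$ has all of the following twelve properties. 1. Rosser: for any disjoint RE sets $A,B$ there is a formula $\phi(x)$ with $T\vdash\phi(\overline n)$ for $n\in A$ and $T\vdash\neg\phi(\overline n)$ for $n\in B$. 2. EI: there is a recursive function $f$ such that for all $i,j$, if $T_P\subseteq W_i$, $T_R\subseteq W_j$ and $W_i\cap W_j=\emptyset$, then $f(i,j)\notin W_i\cup W_j$. 3. RI: there is no recursive $X$ with $T_P\subseteq X$ and $X\cap T_R=\emptyset$. 4. TP: $T$ is undecidable, and $T_P\le_T S_P$ for every consistent RE extension $S$ of $T$. 5. EHU: for every consistent RE extension $S$ of $T$,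 every sub-theory of $S$ over the language of $S$ is undecidable. 6. EU: every consistent RE extension of $T$ over the language of $T$ is undecidable. 7. Creative: $T_P$ is RE, and there is a recursive function $f$ such that for all $i$, if $W_i\subseteq\mathbb N\setminus T_P$ then $f(i)\in(\mathbb N\setminus T_P)\setminus W_i$. 8. $\mathbf 0'$: $T_P$ has Turing degree $\mathbf 0'$. 9. REW: for every RE set $A$ there is a formula $\phi(x)$ with $n\in A\Leftrightarrow T\vdash\phi(\overline n)$ for all $n$. 10. RFD: for every $k$ and every total recursive $f:\mathbb N^k\to\mathbb N$ there is a formula $\phi(x_1,\dots,x_k,y)$ with $T\vdash\forall y\,[\phi(\overline{a_1},\dots,\overline{a_k},y)\leftrightarrow y=\overline{f(a_1,\dots,a_k)}]$ for all $a_1,\dots,a_k\in\mathbb N$. 11. RSS: for every recursive set $A$ there is a formula $\phi(x)$ with $T\vdash\phi(\overline n)$ for $n\in A$ and $T\vdash\neg\phi(\overline n)$ for $n\notin A$. 12. RSW: for every recursive set $A$ there is a formula $\phi(x)$ with $n\in A\Leftrightarrow T\vdash\phi(\overline n)$ for all $n$. -/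

import Mathlib

/-! First-order provability, Gödel numbering, metamathematical properties of theories, and the
theory R.  Formulas are Mathlib's formulas; `L.BoundedFormula Empty n` is the type of
`L`-formulas whose free variables are among `x_0, …, x_{n-1}`, and
`L.Sentence = L.BoundedFormula Empty 0`. -/

namespace MetaR

open FirstOrder FirstOrder.Language

section Logic

variable {L : FirstOrder.Language.{0, 0}}

/-- The variable `x_i` as a term. -/
abbrev bvar {n : ℕ} (i : Fin n) : L.Term (Empty ⊕ Fin n) := Term.var (Sum.inr i)

/-- Simultaneous substitution of the terms `σ i` for the variables `x_i` in a term. -/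
def tsubst {m n : ℕ} (σ : Fin m → L.Term (Empty ⊕ Fin n)) (t : L.Term (Empty ⊕ Fin m)) :
    L.Term (Empty ⊕ Fin n) :=
  t.subst (Sum.elim (fun e => e.elim) σ)

/-- A term in the variables `x_0, …, x_{n-1}`, regarded as a term in `x_0, …, x_n`. -/
def tlift {n : ℕ} (t : L.Term (Empty ⊕ Fin n)) : L.Term (Empty ⊕ Fin (n + 1)) :=
  tsubst (fun i => bvar i.castSucc) t

/-- Simultaneous (capture-free) substitution of the terms `σ i` for the free variables `x_i` in a
formula.  In `all φ` the quantified variable is the last variable of `φ`, and it is kept. -/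
def fsubst : ∀ {m n : ℕ}, (Fin m → L.Term (Empty ⊕ Fin n)) →
    L.BoundedFormula Empty m → L.BoundedFormula Empty n
  | _, _, _, .falsum => .falsum
  | _, _, σ, .equal t s => .equal (tsubst σ t) (tsubst σ s)
  | _, _, σ, .rel R ts => .rel R fun i => tsubst σ (ts i)
  | _, _, σ, .imp φ ψ => .imp (fsubst σ φ) (fsubst σ ψ)
  | _, n, σ, .all φ => .all (fsubst (Fin.snoc (fun i => tlift (σ i)) (bvar (Fin.last n))) φ)

/-- A formula in the variables `x_0, …, x_{n-1}`, regarded as a formula in `x_0, …, x_n`. -/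
def flift {n : ℕ} (φ : L.BoundedFormula Empty n) : L.BoundedFormula Empty (n + 1) :=
  fsubst (fun i => bvar i.castSucc) φ

/-- `φ[t]`: the term `t` is substituted for the last variable of `φ`. -/
def inst {n : ℕ} (φ : L.BoundedFormula Empty (n + 1)) (t : L.Term (Empty ⊕ Fin n)) :
    L.BoundedFormula Empty n :=
  fsubst (Fin.snoc (fun i => bvar i) t) φ

/-- Provability from the axioms `T` in a Hilbert calculus for classical first-order logic with
equality.  `Provable T φ` for `φ` in the variables `x_0, …, x_{n-1}` says that `φ` is derivable
with these free variables. As usual, domains are nonempty (rule `nonempty`). -/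
inductive Provable (T : L.Theory) : ∀ {n : ℕ}, L.BoundedFormula Empty n → Prop
  | ax {n : ℕ} {φ : L.Sentence} (h : φ ∈ T) :
      Provable T (fsubst (n := n) (fun i => i.elim0) φ)
  | imp_intro {n : ℕ} (φ ψ : L.BoundedFormula Empty n) : Provable T (φ.imp (ψ.imp φ))
  | imp_distrib {n : ℕ} (φ ψ χ : L.BoundedFormula Empty n) :
      Provable T ((φ.imp (ψ.imp χ)).imp ((φ.imp ψ).imp (φ.imp χ)))
  | dne {n : ℕ} (φ : L.BoundedFormula Empty n) : Provable T (φ.not.not.imp φ)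
  | all_elim {n : ℕ} (φ : L.BoundedFormula Empty (n + 1)) (t : L.Term (Empty ⊕ Fin n)) :
      Provable T (φ.all.imp (inst φ t))
  | all_imp {n : ℕ} (φ : L.BoundedFormula Empty n) (ψ : L.BoundedFormula Empty (n + 1)) :
      Provable T (((flift φ).imp ψ).all.imp (φ.imp ψ.all))
  | eq_refl {n : ℕ} (t : L.Term (Empty ⊕ Fin n)) : Provable T (.equal t t)
  | eq_subst {n : ℕ} (φ : L.BoundedFormula Empty (n + 1)) (s t : L.Term (Empty ⊕ Fin n)) :
      Provable T (BoundedFormula.imp (.equal s t) ((inst φ s).imp (inst φ t)))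
  | nonempty {n : ℕ} :
      Provable T (BoundedFormula.ex (.equal (bvar (Fin.last n)) (bvar (Fin.last n))))
  | mp {n : ℕ} {φ ψ : L.BoundedFormula Empty n} :
      Provable T (φ.imp ψ) → Provable T φ → Provable T ψ
  | gen {n : ℕ} {φ : L.BoundedFormula Empty (n + 1)} : Provable T φ → Provable T φ.all

/-- A theory is consistent if it does not prove `⊥`. -/
def Consistent (T : L.Theory) : Prop := ¬Provable T (n := 0) BoundedFormula.falsum

/-- `S` (in the language of `T`) proves every theorem of `T`; that is, `T` is a sub-theory of `S`
and `S` is an extension of `T` over the same language. -/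
def SubTheory (T S : L.Theory) : Prop := ∀ φ : L.Sentence, Provable T φ → Provable S φ

/-- `S`, in the language `L'`, extends `T`, in the language `L`, where `L` is regarded as a part
of `L'` via the injective map `ι` of symbols. -/
def Extends {L' : FirstOrder.Language.{0, 0}} (ι : L →ᴸ L') (T : L.Theory) (S : L'.Theory) : Prop :=
  ι.Injective ∧ ∀ φ : L.Sentence, Provable T φ → Provable S (ι.onSentence φ)

/-- Gödel numbers of terms. -/
def termCode [∀ k, Encodable (L.Functions k)] {n : ℕ} : L.Term (Empty ⊕ Fin n) → ℕ
  | .var (.inl e) => e.elim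
  | .var (.inr i) => Nat.pair 0 i
  | .func (l := k) f ts =>
      Nat.pair 1 (Nat.pair k
        (Nat.pair (Encodable.encode f) (Encodable.encode (List.ofFn fun i => termCode (ts i)))))

/-- Gödel numbers of formulas. -/
def code [∀ k, Encodable (L.Functions k)] [∀ k, Encodable (L.Relations k)] :
    ∀ {n : ℕ}, L.BoundedFormula Empty n → ℕ
  | _, .falsum => Nat.pair 0 0
  | _, .equal t s => Nat.pair 1 (Nat.pair (termCode t) (termCode s))
  | _, .rel (l := k) R ts =>
      Nat.pair 2 (Nat.pair k
        (Nat.pair (Encodable.encode R) (Encodable.encode (List.ofFn fun i => termCode (ts i)))))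
  | _, .imp φ ψ => Nat.pair 3 (Nat.pair (code φ) (code ψ))
  | _, .all φ => Nat.pair 4 (code φ)

end Logic

section Computability

/-- Recursively enumerable sets of natural numbers. -/
def IsRE (A : Set ℕ) : Prop := REPred fun n => n ∈ A

/-- Recursive sets of natural numbers. -/
def IsRecursive (A : Set ℕ) : Prop := ComputablePred fun n => n ∈ A

/-- The RE set `W_i` with index `i`: the domain of the `i`-th partial recursive function. -/
def W (i : ℕ) : Set ℕ := {x | ((Denumerable.ofNat Nat.Partrec.Code i).eval x).Dom}

open Classical in
/-- The characteristic function of a set. -/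
noncomputable def charFn (A : Set ℕ) : ℕ →. ℕ := fun n => Part.some (if n ∈ A then 1 else 0)

/-- Turing reducibility of sets. -/
def SetTuringReducible (A B : Set ℕ) : Prop := TuringReducible (charFn A) (charFn B)

/-- The diagonal halting set, whose Turing degree is `0′`. -/
def haltingSet : Set ℕ := {e | e ∈ W e}

/-- Effectively inseparable pairs. -/
def EIPair (A B : Set ℕ) : Prop :=
  ∃ f : ℕ → ℕ → ℕ, Computable₂ f ∧
    ∀ i j, A ⊆ W i → B ⊆ W j → W i ∩ W j = ∅ → f i j ∉ W i ∪ W j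

/-- Recursively inseparable pairs. -/
def RIPair (A B : Set ℕ) : Prop := ¬∃ X : Set ℕ, IsRecursive X ∧ A ⊆ X ∧ X ∩ B = ∅

/-- Productive sets. -/
def IsProductive (A : Set ℕ) : Prop :=
  ∃ f : ℕ → ℕ, Computable f ∧ ∀ i, W i ⊆ A → f i ∈ A \ W i

/-- Creative sets. -/
def IsCreative (A : Set ℕ) : Prop := IsRE A ∧ IsProductive Aᶜ

end Computability

section Theories

variable {L : FirstOrder.Language.{0, 0}} [∀ k, Encodable (L.Functions k)] [∀ k, Encodable (L.Relations k)]

/-- The set `T_P` of Gödel numbers of sentences provable in `T`. -/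
def provableCodes (T : L.Theory) : Set ℕ := {k | ∃ φ : L.Sentence, Provable T φ ∧ code φ = k}

/-- The set `T_R` of Gödel numbers of sentences refutable in `T`. -/
def refutableCodes (T : L.Theory) : Set ℕ :=
  {k | ∃ φ : L.Sentence, Provable T (BoundedFormula.not φ) ∧ code φ = k}

/-- RE theories: the set of theorems is RE. -/
def IsRETheory (T : L.Theory) : Prop := IsRE (provableCodes T)

/-- Decidable theories: the set of theorems is recursive. -/
def IsDecidableTheory (T : L.Theory) : Prop := IsRecursive (provableCodes T)

/-- `EI`: effectively inseparable theories. -/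
def EI (T : L.Theory) : Prop := EIPair (provableCodes T) (refutableCodes T)

/-- `RI`: recursively inseparable theories. -/
def RI (T : L.Theory) : Prop := RIPair (provableCodes T) (refutableCodes T)

/-- `TP`: Turing persistent theories. The extension may be over a larger language. -/
def TP (T : L.Theory) : Prop :=
  ¬IsDecidableTheory T ∧
    ∀ (L' : FirstOrder.Language.{0, 0}) [∀ k, Encodable (L'.Functions k)] [∀ k, Encodable (L'.Relations k)]
      (ι : L →ᴸ L') (S : L'.Theory), Extends ι T S → Consistent S → IsRETheory S →
        SetTuringReducible (provableCodes T) (provableCodes S)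

/-- `HU`: hereditarily undecidable theories. -/
def HU (T : L.Theory) : Prop := ∀ U : L.Theory, SubTheory U T → ¬IsDecidableTheory U

/-- `EHU`: essentially hereditarily undecidable theories. The extension may be over a larger
language. -/
def EHU (T : L.Theory) : Prop :=
  ∀ (L' : FirstOrder.Language.{0, 0}) [∀ k, Encodable (L'.Functions k)] [∀ k, Encodable (L'.Relations k)]
    (ι : L →ᴸ L') (S : L'.Theory), Extends ι T S → Consistent S → IsRETheory S → HU S

/-- `EU`: essentially undecidable theories. -/
def EU (T : L.Theory) : Prop :=
  ∀ S : L.Theory, SubTheory T S → Consistent S → IsRETheory S → ¬IsDecidableTheory S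

/-- `Creative` theories. -/
def Creative (T : L.Theory) : Prop := IsCreative (provableCodes T)

/-- `0′`: theories of Turing degree `0′`. -/
def ZeroJump (T : L.Theory) : Prop :=
  SetTuringReducible (provableCodes T) haltingSet ∧
    SetTuringReducible haltingSet (provableCodes T)

end Theories

section Representability

/-- Languages with a constant symbol `0` and a unary function symbol `S`. -/
class Numerals (L : FirstOrder.Language.{0, 0}) where
  zero : L.Functions 0
  succ : L.Functions 1

variable {L : FirstOrder.Language.{0, 0}} [Numerals L]

/-- The numeral `S^a 0`. -/
def numeral {n : ℕ} : ℕ → L.Term (Empty ⊕ Fin n)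
  | 0 => Term.func Numerals.zero ![]
  | a + 1 => Term.func Numerals.succ ![numeral a]

/-- The sentence `φ(a_1, …, a_k)`, with numerals substituted for the free variables of `φ`. -/
def atNumerals {k : ℕ} (φ : L.BoundedFormula Empty k) (a : Fin k → ℕ) : L.Sentence :=
  fsubst (fun i => numeral (a i)) φ

/-- `φ(x)` separates `(A, B)` in `T`. -/
def SeparatesIn (T : L.Theory) (φ : L.BoundedFormula Empty 1) (A B : Set ℕ) : Prop :=
  (∀ n ∈ A, Provable T (atNumerals φ ![n])) ∧
    ∀ n ∈ B, Provable T (BoundedFormula.not (atNumerals φ ![n]))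

/-- `Rosser` theories: every disjoint pair of RE sets is separable in `T`. -/
def Rosser (T : L.Theory) : Prop :=
  ∀ A B : Set ℕ, IsRE A → IsRE B → A ∩ B = ∅ →
    ∃ φ : L.BoundedFormula Empty 1, SeparatesIn T φ A B

/-- Weak representability of a `k`-ary relation. -/
def WeaklyRepresentable (T : L.Theory) {k : ℕ} (P : (Fin k → ℕ) → Prop) : Prop :=
  ∃ φ : L.BoundedFormula Empty k, ∀ a, P a ↔ Provable T (atNumerals φ a)

/-- Strong representability of a `k`-ary relation. -/
def StronglyRepresentable (T : L.Theory) {k : ℕ} (P : (Fin k → ℕ) → Prop) : Prop :=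
  ∃ φ : L.BoundedFormula Empty k, ∀ a,
    (P a → Provable T (atNumerals φ a)) ∧ (¬P a → Provable T (BoundedFormula.not (atNumerals φ a)))

/-- Definability of a total `k`-ary function: `T` proves
`∀ y, φ(a_1, …, a_k, y) ↔ y = f(a_1, …, a_k)`. -/
def Definable (T : L.Theory) {k : ℕ} (f : (Fin k → ℕ) → ℕ) : Prop :=
  ∃ φ : L.BoundedFormula Empty (k + 1), ∀ a : Fin k → ℕ,
    Provable T (n := 0) (BoundedFormula.all (BoundedFormula.iff
      (fsubst (Fin.snoc (fun i => numeral (a i)) (bvar (Fin.last 0))) φ)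
      (.equal (bvar (Fin.last 0)) (numeral (f a)))))

/-- `REW`: every RE set is weakly representable. -/
def REW (T : L.Theory) : Prop :=
  ∀ A : Set ℕ, IsRE A → WeaklyRepresentable T (k := 1) fun a => a 0 ∈ A

/-- `RFD`: every total recursive function (of any number of arguments) is definable. -/
def RFD (T : L.Theory) : Prop :=
  ∀ (k : ℕ) (f : (Fin k → ℕ) → ℕ), Computable f → Definable T f

/-- `RSS`: every recursive set is strongly representable. -/
def RSS (T : L.Theory) : Prop :=
  ∀ A : Set ℕ, IsRecursive A → StronglyRepresentable T (k := 1) fun a => a 0 ∈ A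

/-- `RSW`: every recursive set is weakly representable. -/
def RSW (T : L.Theory) : Prop :=
  ∀ A : Set ℕ, IsRecursive A → WeaklyRepresentable T (k := 1) fun a => a 0 ∈ A

end Representability

section Arithmetic

/-- The function symbols `0, S, +, ·`. -/
inductive ArithFunc : ℕ → Type
  | zero : ArithFunc 0
  | succ : ArithFunc 1
  | add : ArithFunc 2
  | mul : ArithFunc 2

/-- The language `{0, S, +, ·}` of arithmetic; `≤` is an abbreviation, see `le`. -/
def arith : FirstOrder.Language.{0, 0} := ⟨ArithFunc, fun _ => Empty⟩

instance (k : ℕ) : Encodable (arith.Functions k) where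
  encode f := ArithFunc.casesOn (motive := fun _ _ => ℕ) f 0 0 0 1
  decode i := match k, i with
    | 0, 0 => some ArithFunc.zero
    | 1, 0 => some ArithFunc.succ
    | 2, 0 => some ArithFunc.add
    | 2, 1 => some ArithFunc.mul
    | _, _ => none
  encodek f := by
    change ArithFunc k at f
    cases f <;> rfl

instance (k : ℕ) : Encodable (arith.Relations k) := inferInstanceAs (Encodable Empty)

instance : Numerals arith := ⟨ArithFunc.zero, ArithFunc.succ⟩

/-- The term `s + t`. -/
def add {n : ℕ} (s t : arith.Term (Empty ⊕ Fin n)) : arith.Term (Empty ⊕ Fin n) :=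
  Term.func (L := arith) ArithFunc.add ![s, t]

/-- The term `s · t`. -/
def mul {n : ℕ} (s t : arith.Term (Empty ⊕ Fin n)) : arith.Term (Empty ⊕ Fin n) :=
  Term.func (L := arith) ArithFunc.mul ![s, t]

/-- `s ≤ t` abbreviates `∃ z, z + s = t`. -/
def le {n : ℕ} (s t : arith.Term (Empty ⊕ Fin n)) : arith.BoundedFormula Empty n :=
  BoundedFormula.ex (.equal (add (bvar (Fin.last n)) (tlift s)) (tlift t))

/-- The formula `x = 0 ∨ ⋯ ∨ x = n` in one free variable `x`. -/
def eqUpTo : ℕ → arith.BoundedFormula Empty 1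
  | 0 => .equal (bvar 0) (numeral 0)
  | n + 1 => eqUpTo n ⊔ .equal (bvar 0) (numeral (n + 1))

/-- The axioms of the theory `R`. -/
inductive RAxiom : arith.Sentence → Prop
  | ax1 (m n : ℕ) : RAxiom (.equal (add (numeral m) (numeral n)) (numeral (m + n)))
  | ax2 (m n : ℕ) : RAxiom (.equal (mul (numeral m) (numeral n)) (numeral (m * n)))
  | ax3 (m n : ℕ) : m ≠ n → RAxiom (BoundedFormula.not (.equal (numeral m) (numeral n)))
  | ax4 (n : ℕ) : RAxiom (BoundedFormula.all ((le (bvar 0) (numeral n)).imp (eqUpTo n)))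
  | ax5 (n : ℕ) : RAxiom (BoundedFormula.all (le (bvar 0) (numeral n) ⊔ le (numeral n) (bvar 0)))

/-- The theory `R`. -/
def R : arith.Theory := {φ | RAxiom φ}

/-- The standard model of arithmetic. -/
instance standardModel : arith.Structure ℕ where
  funMap f v := match f, v with
    | ArithFunc.zero, _ => 0
    | ArithFunc.succ, v => v 0 + 1
    | ArithFunc.add, v => v 0 + v 1
    | ArithFunc.mul, v => v 0 * v 1
  RelMap r _ := r.elim

/-- Bounded (`Δ⁰₀`) formulas: atomic formulas closed under negation, conjunction, disjunction and
the bounded quantifiers `∃ y ≤ x_i` and `∀ y ≤ x_i`. -/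
inductive IsBounded : ∀ {n : ℕ}, arith.BoundedFormula Empty n → Prop
  | equal {n : ℕ} (s t : arith.Term (Empty ⊕ Fin n)) : IsBounded (.equal s t)
  | le {n : ℕ} (s t : arith.Term (Empty ⊕ Fin n)) : IsBounded (le s t)
  | not {n : ℕ} {φ : arith.BoundedFormula Empty n} : IsBounded φ → IsBounded φ.not
  | and {n : ℕ} {φ ψ : arith.BoundedFormula Empty n} :
      IsBounded φ → IsBounded ψ → IsBounded (φ ⊓ ψ)
  | or {n : ℕ} {φ ψ : arith.BoundedFormula Empty n} :
      IsBounded φ → IsBounded ψ → IsBounded (φ ⊔ ψ)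
  | bex {n : ℕ} (i : Fin n) {φ : arith.BoundedFormula Empty (n + 1)} : IsBounded φ →
      IsBounded (BoundedFormula.ex (MetaR.le (bvar (Fin.last n)) (bvar i.castSucc) ⊓ φ))
  | ball {n : ℕ} (i : Fin n) {φ : arith.BoundedFormula Empty (n + 1)} : IsBounded φ →
      IsBounded (BoundedFormula.all ((MetaR.le (bvar (Fin.last n)) (bvar i.castSucc)).imp φ))

/-- The formula `σ(x)` defines the set `A` in the standard model. -/
def DefinesInN (σ : arith.BoundedFormula Empty 1) (A : Set ℕ) : Prop :=
  ∀ n : ℕ, n ∈ A ↔ σ.Realize (Empty.elim : Empty → ℕ) ![n]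

/-- For `σ(x) = ∃ y, φ₀(x, y)` and `σ′(x) = ∃ y, φ₁(x, y)`, the witness comparison formula
`σ(x) < σ′(x)`, that is, `∃ y (φ₀(x, y) ∧ ∀ z ≤ y, ¬φ₁(x, z))`. -/
def witnessLT (φ₀ φ₁ : arith.BoundedFormula Empty 2) : arith.BoundedFormula Empty 1 :=
  BoundedFormula.ex (φ₀ ⊓ BoundedFormula.all
    ((le (bvar 2) (bvar 1)).imp (BoundedFormula.not (fsubst ![bvar 0, bvar 2] φ₁))))

end Arithmetic

end MetaR

/-!
By the completeness theorem for countable languages (`Provable.of_models`, proved with a Henkin term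
model), a sentence is provable in `R` iff it holds in all models of `R`.  In such a model the
numerals form an initial segment that is isomorphic to the standard model and comparable with every
element.  Hence bounded formulas are absolute (`IsBounded.absolute`), and the witness comparison of
two disjoint `Σ`-definitions separates them: a witness in the sense of the model either lies above
a given standard witness or is itself standard (`separatesIn_witnessLT`).  Every recursively
enumerable set has such a definition, because graphs of partial recursive functions are
`Σ`-definable with the `β`-function (`sig_of_partrec`, `exists_isBounded`).  This gives the
statement on witness comparison and the representability properties Rosser, REW, RFD, RSS and RSW.

The undecidability properties have one common source, a strengthened separation
(`exists_separating`): two disjoint recursively enumerable sets are separated by sentences that are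
provable in `R` for members of the first set and refutable in *pure logic* for members of the
second.  The sentence asserts a witness `y` for the first set, smaller than any witness for the
second, for which finitely many conditions `Rho y` hold; these conditions force any structure to
compute correctly with the numerals below `y`.  Refutability in pure logic is what makes
hereditary undecidability accessible, where sub-theories need not prove anything about arithmetic.
The separation is applied to the sets of `⟨e, x⟩` at which the `e`-th program returns `0` or `1`,
and to programs that search for the first confirmation of one of two recursively enumerable
conditions, where the conditions may speak about the sentence itself, since `e` may be part of the
input (`exists_race`, `exists_race_sentences`).  Each of EI, RI, TP, EHU, Creative and `0′` is a
choice of the two conditions.  Since the sentences are translated along an embedding of languages,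
extensions in larger languages need no extra work.

Finally, `R` is a recursively enumerable theory: the set of numbers derivable from finitely many
Horn clauses is recursively enumerable (`isRE_derives`), and Gödel numbers of terms, substitutions
and proofs in `R` are generated by such clauses (`clause`, `meaning_of_holds`, `holds_prov`).
-/

namespace MetaR

open FirstOrder FirstOrder.Language

/-! ### Substitution -/

section Substitution
variable {L : FirstOrder.Language.{0, 0}}

/-- The substitution `σ` under a quantifier: the new last variable is kept. -/
def up {m n : ℕ} (σ : Fin m → L.Term (Empty ⊕ Fin n)) :
    Fin (m + 1) → L.Term (Empty ⊕ Fin (n + 1)) :=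
  Fin.snoc (fun i => tlift (σ i)) (bvar (Fin.last n))

@[simp] theorem up_castSucc {m n : ℕ} (σ : Fin m → L.Term (Empty ⊕ Fin n)) (i : Fin m) :
    up σ i.castSucc = tlift (σ i) := by simp [up]

@[simp] theorem up_last {m n : ℕ} (σ : Fin m → L.Term (Empty ⊕ Fin n)) :
    up σ (Fin.last m) = bvar (Fin.last n) := by simp [up]

@[simp] theorem tsubst_bvar {m n : ℕ} (σ : Fin m → L.Term (Empty ⊕ Fin n)) (i : Fin m) :
    tsubst σ (bvar i) = σ i := rfl

@[simp] theorem tsubst_func {m n k : ℕ} (σ : Fin m → L.Term (Empty ⊕ Fin n)) (f : L.Functions k)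
    (ts : Fin k → L.Term (Empty ⊕ Fin m)) :
    tsubst σ (Term.func f ts) = Term.func f fun i => tsubst σ (ts i) := rfl

/-- Induction on terms, without the vacuous case of variables indexed by `Empty`. -/
theorem term_cases {n : ℕ} {P : L.Term (Empty ⊕ Fin n) → Prop} (hv : ∀ i, P (bvar i))
    (hf : ∀ {k} (f : L.Functions k) ts, (∀ i, P (ts i)) → P (Term.func f ts)) : ∀ t, P t
  | .var (.inl e) => e.elim
  | .var (.inr i) => hv i
  | .func f ts => hf f ts fun i => term_cases hv hf (ts i)

theorem tsubst_tsubst {l m n : ℕ} (σ : Fin l → L.Term (Empty ⊕ Fin m))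
    (τ : Fin m → L.Term (Empty ⊕ Fin n)) (t : L.Term (Empty ⊕ Fin l)) :
    tsubst τ (tsubst σ t) = tsubst (fun i => tsubst τ (σ i)) t := by
  induction t using term_cases with
  | hv i => rfl
  | hf f ts ih => simp [ih]

theorem tsubst_id {n : ℕ} (t : L.Term (Empty ⊕ Fin n)) : tsubst (fun i => bvar i) t = t := by
  induction t using term_cases with
  | hv i => rfl
  | hf f ts ih => simp [ih]

theorem tsubst_tlift {m n : ℕ} (σ : Fin (m + 1) → L.Term (Empty ⊕ Fin n))
    (t : L.Term (Empty ⊕ Fin m)) : tsubst σ (tlift t) = tsubst (fun i => σ i.castSucc) t := by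
  simp [tlift, tsubst_tsubst]

theorem tlift_tsubst {m n : ℕ} (σ : Fin m → L.Term (Empty ⊕ Fin n))
    (t : L.Term (Empty ⊕ Fin m)) : tlift (tsubst σ t) = tsubst (fun i => tlift (σ i)) t := by
  simp [tlift, tsubst_tsubst]

theorem tsubst_up {l m n : ℕ} (σ : Fin l → L.Term (Empty ⊕ Fin m))
    (τ : Fin m → L.Term (Empty ⊕ Fin n)) :
    (fun i => tsubst (up τ) (up σ i)) = up fun i => tsubst τ (σ i) := by
  funext i
  refine Fin.lastCases ?_ (fun i => ?_) i
  · simp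
  · simp [tsubst_tlift, tlift_tsubst]

theorem up_id {n : ℕ} : (up fun i : Fin n => (bvar i : L.Term _)) = fun i => bvar i := by
  funext i
  refine Fin.lastCases ?_ (fun i => ?_) i
  · simp
  · simp [tlift]

theorem fsubst_fsubst : ∀ {l m n : ℕ} (σ : Fin l → L.Term (Empty ⊕ Fin m))
    (τ : Fin m → L.Term (Empty ⊕ Fin n)) (φ : L.BoundedFormula Empty l),
    fsubst τ (fsubst σ φ) = fsubst (fun i => tsubst τ (σ i)) φ
  | _, _, _, _, _, .falsum => rfl
  | _, _, _, _, _, .equal t s => by simp [fsubst, tsubst_tsubst]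
  | _, _, _, _, _, .rel R ts => by simp [fsubst, tsubst_tsubst]
  | _, _, _, σ, τ, .imp φ ψ => by simp [fsubst, fsubst_fsubst σ τ]
  | _, _, _, σ, τ, .all φ => by
      have := fsubst_fsubst (up σ) (up τ) φ
      rw [tsubst_up] at this
      exact congrArg BoundedFormula.all this

theorem fsubst_id : ∀ {n : ℕ} (φ : L.BoundedFormula Empty n), fsubst (fun i => bvar i) φ = φ
  | _, .falsum => rfl
  | _, .equal t s => by simp [fsubst, tsubst_id]
  | _, .rel R ts => by simp [fsubst, tsubst_id]
  | _, .imp φ ψ => by simp [fsubst, fsubst_id]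
  | _, .all φ => by
      have := fsubst_id φ
      rw [← up_id] at this
      exact congrArg BoundedFormula.all this

theorem fsubst_all {m n : ℕ} (σ : Fin m → L.Term (Empty ⊕ Fin n))
    (φ : L.BoundedFormula Empty (m + 1)) : fsubst σ φ.all = (fsubst (up σ) φ).all := rfl

theorem fsubst_imp {m n : ℕ} (σ : Fin m → L.Term (Empty ⊕ Fin n))
    (φ ψ : L.BoundedFormula Empty m) : fsubst σ (φ.imp ψ) = (fsubst σ φ).imp (fsubst σ ψ) := rfl

theorem fsubst_flift {m n : ℕ} (σ : Fin (m + 1) → L.Term (Empty ⊕ Fin n))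
    (φ : L.BoundedFormula Empty m) : fsubst σ (flift φ) = fsubst (fun i => σ i.castSucc) φ := by
  simp [flift, fsubst_fsubst]

theorem fsubst_inst {m n : ℕ} (σ : Fin m → L.Term (Empty ⊕ Fin n))
    (φ : L.BoundedFormula Empty (m + 1)) (t : L.Term (Empty ⊕ Fin m)) :
    fsubst σ (inst φ t) = inst (fsubst (up σ) φ) (tsubst σ t) := by
  rw [inst, inst, fsubst_fsubst, fsubst_fsubst]
  congr 1
  funext i
  refine Fin.lastCases ?_ (fun i => ?_) i
  · simp
  · simp [tsubst_tlift, tsubst_id]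

theorem fsubst_up_flift {m n : ℕ} (σ : Fin m → L.Term (Empty ⊕ Fin n))
    (φ : L.BoundedFormula Empty m) : fsubst (up σ) (flift φ) = flift (fsubst σ φ) := by
  rw [fsubst_flift, flift, fsubst_fsubst]
  congr 1
  funext i
  simp [tlift]

end Substitution

section Semantics
variable {L : FirstOrder.Language.{0, 0}} {M : Type} [L.Structure M]

theorem realize_tsubst {m n : ℕ} (σ : Fin m → L.Term (Empty ⊕ Fin n))
    (t : L.Term (Empty ⊕ Fin m)) (v : Empty → M) (xs : Fin n → M) :
    (tsubst σ t).realize (Sum.elim v xs) =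
      t.realize (Sum.elim v fun i => (σ i).realize (Sum.elim v xs)) := by
  induction t using term_cases with
  | hv i => rfl
  | hf f ts ih => simp [ih]

theorem realize_tlift {n : ℕ} (t : L.Term (Empty ⊕ Fin n)) (v : Empty → M) (xs : Fin (n + 1) → M) :
    (tlift t).realize (Sum.elim v xs) = t.realize (Sum.elim v fun i => xs i.castSucc) :=
  realize_tsubst _ _ _ _

theorem realize_fsubst : ∀ {m n : ℕ} (σ : Fin m → L.Term (Empty ⊕ Fin n))
    (φ : L.BoundedFormula Empty m) (v : Empty → M) (xs : Fin n → M),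
    (fsubst σ φ).Realize v xs ↔ φ.Realize v fun i => (σ i).realize (Sum.elim v xs)
  | _, _, _, .falsum, _, _ => Iff.rfl
  | _, _, _, .equal t s, _, _ => by simp [fsubst, BoundedFormula.Realize, realize_tsubst]
  | _, _, _, .rel R ts, _, _ => by simp [fsubst, BoundedFormula.Realize, realize_tsubst]
  | _, _, σ, .imp φ ψ, v, xs => by
      simp [fsubst, realize_fsubst σ]
  | _, _, σ, .all φ, v, xs => by
      rw [fsubst_all]
      simp only [BoundedFormula.realize_all]
      refine forall_congr' fun x => ?_
      rw [realize_fsubst (up σ) φ]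
      refine iff_of_eq (congrArg _ (funext fun i => ?_))
      refine Fin.lastCases ?_ (fun i => ?_) i
      · simp
      · simp [realize_tlift]

theorem realize_inst {n : ℕ} (φ : L.BoundedFormula Empty (n + 1)) (t : L.Term (Empty ⊕ Fin n))
    (v : Empty → M) (xs : Fin n → M) :
    (inst φ t).Realize v xs ↔ φ.Realize v (Fin.snoc xs (t.realize (Sum.elim v xs))) := by
  rw [inst, realize_fsubst]
  refine iff_of_eq (congrArg _ (funext fun i => ?_))
  refine Fin.lastCases ?_ (fun i => ?_) i <;> simp

theorem realize_flift {n : ℕ} (φ : L.BoundedFormula Empty n) (v : Empty → M)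
    (xs : Fin (n + 1) → M) :
    (flift φ).Realize v xs ↔ φ.Realize v fun i => xs i.castSucc := by
  rw [flift, realize_fsubst]; rfl

theorem Provable.sound {T : L.Theory} [Nonempty M] (hM : ∀ φ ∈ T, M ⊨ φ) {n : ℕ}
    {φ : L.BoundedFormula Empty n} (h : Provable T φ) (v : Empty → M) (xs : Fin n → M) :
    φ.Realize v xs := by
  induction h with
  | ax h =>
    rw [realize_fsubst]
    have := hM _ h
    rw [Sentence.Realize, Formula.Realize] at this
    convert this using 1
  | imp_intro φ ψ => simp only [BoundedFormula.realize_imp]; tauto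
  | imp_distrib φ ψ χ => simp only [BoundedFormula.realize_imp]; tauto
  | dne φ => simp
  | all_elim φ t =>
    simp only [BoundedFormula.realize_imp, BoundedFormula.realize_all, realize_inst]
    exact fun h => h _
  | all_imp φ ψ =>
    simp only [BoundedFormula.realize_imp, BoundedFormula.realize_all, realize_flift,
      Fin.snoc_castSucc]
    exact fun h h' x => h x h'
  | eq_refl t => simp [BoundedFormula.Realize]
  | eq_subst φ s t =>
    simp only [BoundedFormula.realize_imp, realize_inst]
    intro h
    rw [show s.realize (Sum.elim v xs) = t.realize (Sum.elim v xs) from h]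
    exact id
  | nonempty => simp [BoundedFormula.Realize]
  | mp _ _ ih₁ ih₂ =>
    exact (BoundedFormula.realize_imp.1 (ih₁ xs)) (ih₂ xs)
  | gen _ ih => exact fun x => ih _

end Semantics

/-! ### Provability and Henkin theories -/

section Calculus
variable {L : FirstOrder.Language.{0, 0}} {T : L.Theory}

theorem Provable.subst {m : ℕ} {φ : L.BoundedFormula Empty m} (h : Provable T φ) :
    ∀ {n : ℕ} (σ : Fin m → L.Term (Empty ⊕ Fin n)), Provable T (fsubst σ φ) := by
  induction h with
  | ax h =>
    intro n σ
    rw [fsubst_fsubst]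
    convert Provable.ax (n := n) h using 2
  | imp_intro φ ψ => exact fun σ => .imp_intro _ _
  | imp_distrib φ ψ χ => exact fun σ => .imp_distrib _ _ _
  | dne φ => exact fun σ => .dne _
  | all_elim φ t =>
    intro n σ
    rw [fsubst_imp, fsubst_inst]
    exact .all_elim _ _
  | all_imp φ ψ =>
    intro n σ
    rw [fsubst_imp, fsubst_all, fsubst_imp, fsubst_up_flift]
    exact .all_imp _ _
  | eq_refl t => exact fun σ => .eq_refl _
  | eq_subst φ s t =>
    intro n σ
    rw [fsubst_imp, fsubst_imp, fsubst_inst, fsubst_inst]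
    exact .eq_subst _ _ _
  | nonempty =>
    intro n σ
    convert Provable.nonempty (T := T) (n := n) using 1
    simp [BoundedFormula.ex, fsubst]
    rfl
  | mp _ _ ih₁ ih₂ => exact fun σ => .mp (ih₁ σ) (ih₂ σ)
  | gen _ ih => exact fun σ => .gen (ih (up σ))

namespace Provable
variable {n : ℕ} {φ ψ χ : L.BoundedFormula Empty n}

theorem weaken (h : Provable T φ) : Provable T (χ.imp φ) := .mp (.imp_intro _ _) h

theorem mp₂ (h₁ : Provable T (χ.imp (φ.imp ψ))) (h₂ : Provable T (χ.imp φ)) :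
    Provable T (χ.imp ψ) := .mp (.mp (.imp_distrib _ _ _) h₁) h₂

theorem trans (h₁ : Provable T (φ.imp ψ)) (h₂ : Provable T (ψ.imp χ)) : Provable T (φ.imp χ) :=
  mp₂ (weaken h₂) h₁

theorem refl (φ : L.BoundedFormula Empty n) : Provable T (φ.imp φ) :=
  mp₂ (.imp_intro φ (φ.imp φ)) (.imp_intro φ φ)

theorem contra (h : Provable T (φ.imp ψ)) : Provable T (ψ.not.imp φ.not) :=
  mp₂ (trans (.imp_intro _ _) (.imp_distrib _ _ _)) (weaken h)

theorem efq (φ : L.BoundedFormula Empty n) : Provable T (BoundedFormula.falsum.imp φ) :=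
  trans (.imp_intro _ φ.not) (.dne φ)

theorem not_imp_left (φ ψ : L.BoundedFormula Empty n) : Provable T ((φ.imp ψ).not.imp φ) := by
  refine trans (contra ?_) (.dne φ)
  exact mp₂ (weaken (mp (imp_distrib _ _ _) (weaken (efq ψ)))) (refl _)

theorem not_imp_right (φ ψ : L.BoundedFormula Empty n) : Provable T ((φ.imp ψ).not.imp ψ.not) :=
  contra (.imp_intro _ _)

end Provable

/-- A formula `χ` is consistent with `T` if `T` does not refute it. -/
def Con (T : L.Theory) {n : ℕ} (χ : L.BoundedFormula Empty n) : Prop := ¬Provable T χ.not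

/-- One step of the Henkin construction: a consistent formula `χ` can be strengthened, at the cost
of one more variable, so as to decide `ψ`; the new variable is a counterexample to `ψ` if `ψ` is a
refuted universal formula. -/
theorem Con.extend {n : ℕ} {χ : L.BoundedFormula Empty n} (hχ : Con T χ)
    (ψ : L.BoundedFormula Empty n) : ∃ χ' : L.BoundedFormula Empty (n + 1), Con T χ' ∧
      Provable T (χ'.imp (flift χ)) ∧ (Provable T (χ'.imp (flift ψ)) ∨
        Provable T (χ'.imp (flift ψ).not) ∧ ∀ θ, ψ = .all θ → Provable T (χ'.imp θ.not)) := by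
  -- An additional variable does not spoil consistency, because domains are nonempty.
  have lift : ∀ {χ : L.BoundedFormula Empty n}, Con T χ → Con T (flift χ) := by
    intro χ hχ h
    refine hχ ?_
    refine .mp (.contra (?_ : Provable T (χ.imp (BoundedFormula.all BoundedFormula.falsum)))) ?_
    · exact .mp (.all_imp _ _) (.gen h)
    · have h1 : Provable T (BoundedFormula.imp (BoundedFormula.all BoundedFormula.falsum)
          (BoundedFormula.all (BoundedFormula.not (L := L) (α := Empty)
            (.equal (bvar (Fin.last n)) (bvar (Fin.last n)))))) := by
        refine .mp (.all_imp _ _) (.gen ?_)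
        refine .trans ?_ (.efq _)
        have := Provable.all_elim (T := T) (n := n + 1) .falsum (bvar (Fin.last n))
        exact this
      exact .mp (.contra h1) .nonempty
  by_cases h : Provable T (χ.imp ψ)
  · exact ⟨flift χ, lift hχ, .refl _, .inl (h.subst fun i => bvar i.castSucc)⟩
  · have h₁ : Con T (χ.imp ψ).not := fun h' => h (.mp (.dne _) h')
    by_cases hψ : ∃ θ, ψ = .all θ
    · obtain ⟨θ, rfl⟩ := hψ
      -- `χ'` is `χ ∧ ¬∀ θ ∧ ¬θ(x)` for the new variable `x`.
      refine ⟨((flift (χ.imp θ.all).not).imp θ).not, fun h' => h₁ ?_,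
        .trans (.not_imp_left _ _) ((Provable.not_imp_left χ θ.all).subst fun i => bvar i.castSucc),
        .inr ⟨.trans (.not_imp_left _ _)
          ((Provable.not_imp_right χ θ.all).subst fun i => bvar i.castSucc), ?_⟩⟩
      · have := Provable.mp (.all_imp _ _) (.gen (Provable.mp (.dne _) h'))
        exact .mp₂ (Provable.not_imp_right χ θ.all) this
      · intro θ' e
        cases e
        exact .not_imp_right _ _
    · refine ⟨flift (χ.imp ψ).not, lift h₁, (Provable.not_imp_left χ ψ).subst _,
        .inr ⟨(Provable.not_imp_right χ ψ).subst _, fun θ e => absurd ⟨θ, e⟩ hψ⟩⟩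

/-- A complete Henkin theory over `T` in the variables `x_0, x_1, …`: the truth of a formula does
not depend on the context in which it is considered, and false universal formulas are refuted by a
variable. -/
structure TruthSet (T : L.Theory) where
  /-- The formulas taken to be true. -/
  Tr : ∀ {n : ℕ}, L.BoundedFormula Empty n → Prop
  prov : ∀ {n : ℕ} {φ : L.BoundedFormula Empty n}, Provable T φ → Tr φ
  mp : ∀ {n : ℕ} {φ ψ : L.BoundedFormula Empty n}, Tr (φ.imp ψ) → Tr φ → Tr ψ
  not_falsum : ∀ {n : ℕ}, ¬Tr (n := n) .falsum
  em : ∀ {n : ℕ} (φ : L.BoundedFormula Empty n), Tr φ ∨ Tr φ.not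
  lift : ∀ {n : ℕ} {φ : L.BoundedFormula Empty n}, Tr φ → Tr (flift φ)
  wit : ∀ {n : ℕ} {θ : L.BoundedFormula Empty (n + 1)}, ¬Tr θ.all →
    ∃ (j : ℕ) (h : n ≤ j), ¬Tr (fsubst (up fun i : Fin n => bvar (Fin.castLE h i)) θ)

/-- A formula in the variables `x_0, …, x_{n-1}`, regarded as a formula in `x_0, …, x_{m-1}`. -/
def liftTo {n m : ℕ} (h : n ≤ m) (φ : L.BoundedFormula Empty n) : L.BoundedFormula Empty m :=
  fsubst (fun i => bvar (Fin.castLE h i)) φ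

theorem liftTo_self {n : ℕ} (φ : L.BoundedFormula Empty n) : liftTo le_rfl φ = φ := fsubst_id φ

theorem flift_liftTo {n m : ℕ} (h : n ≤ m) (φ : L.BoundedFormula Empty n) :
    flift (liftTo h φ) = liftTo (h.trans m.le_succ) φ := fsubst_fsubst _ _ _

theorem liftTo_flift {n m : ℕ} (h : n + 1 ≤ m) (φ : L.BoundedFormula Empty n) :
    liftTo h (flift φ) = liftTo (n.le_succ.trans h) φ := fsubst_fsubst _ _ _

/-- Henkin's construction. A chain of consistent formulas `χ 0, χ 1, …`, where `χ k` has `k` free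
variables, decides every formula and contains a counterexample to every refuted universal formula;
the formulas implied by some `χ k` are taken to be true. -/
theorem exists_truthSet [Countable (Σ n, L.BoundedFormula Empty n)] {χ₀ : L.Sentence}
    (h₀ : Con T χ₀) : ∃ S : TruthSet T, S.Tr (n := 0) χ₀ := by
  classical
  obtain ⟨e, he⟩ := exists_surjective_nat (Σ n, L.BoundedFormula Empty n)
  -- Every formula is the target of infinitely many stages, hence of one with enough variables.
  let target : ∀ k, L.BoundedFormula Empty k := fun k =>
    if h : (e k.unpair.1).1 ≤ k then liftTo h (e k.unpair.1).2 else .falsum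
  choose! next hnext using fun (n : ℕ) (χ : L.BoundedFormula Empty n) (h : Con T χ) =>
    h.extend (target n)
  let χ : ∀ k, L.BoundedFormula Empty k := fun k =>
    Nat.rec (motive := fun k => L.BoundedFormula Empty k) χ₀ (fun n χ => next n χ) k
  have hcon : ∀ k, Con T (χ k) := by
    intro k
    induction k with
    | zero => exact h₀
    | succ k ih => exact (hnext k _ ih).1
  have hstep : ∀ k {φ : L.BoundedFormula Empty k}, Provable T ((χ k).imp φ) →
      Provable T ((χ (k + 1)).imp (flift φ)) := fun k φ h =>
    .trans (hnext k _ (hcon k)).2.1 (h.subst fun i => bvar i.castSucc)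
  have hmono : ∀ {n m : ℕ} (h : n ≤ m) {φ : L.BoundedFormula Empty n},
      Provable T ((χ n).imp φ) → Provable T ((χ m).imp (liftTo h φ)) := by
    intro n m h φ hφ
    induction m, h using Nat.le_induction with
    | base => rwa [liftTo_self]
    | succ m h ih => rw [← flift_liftTo h]; exact hstep m ih
  have hmono' : ∀ {n k m : ℕ} (h : n ≤ k) (h' : k ≤ m) {φ : L.BoundedFormula Empty n},
      Provable T ((χ k).imp (liftTo h φ)) → Provable T ((χ m).imp (liftTo (h.trans h') φ)) := by
    intro n k m h h' φ hφ
    have := hmono h' hφ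
    rwa [show liftTo h' (liftTo h φ) = liftTo (h.trans h') φ from fsubst_fsubst _ _ _] at this
  have hex : ∀ {n : ℕ} (φ : L.BoundedFormula Empty n),
      ∃ (k : ℕ) (h : n ≤ k), target k = liftTo h φ := by
    intro n φ
    obtain ⟨i, hi⟩ := he ⟨n, φ⟩
    have h1 : (Nat.pair i n).unpair.1 = i := by simp
    refine ⟨Nat.pair i n, Nat.right_le_pair i n, ?_⟩
    have key : ∀ p : Σ n, L.BoundedFormula Empty n, p = ⟨n, φ⟩ →
        (if h : p.1 ≤ Nat.pair i n then liftTo h p.2 else .falsum) =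
          liftTo (Nat.right_le_pair i n) φ := by
      rintro _ rfl
      simp [Nat.right_le_pair]
    exact key _ (by rw [h1, hi])
  let Tr : ∀ {n : ℕ}, L.BoundedFormula Empty n → Prop := fun {n} φ =>
    ∃ (k : ℕ) (h : n ≤ k), Provable T ((χ k).imp (liftTo h φ))
  have hem : ∀ {n : ℕ} (φ : L.BoundedFormula Empty n), Tr φ ∨ Tr φ.not := by
    intro n φ
    obtain ⟨k, h, hk⟩ := hex φ
    have := (hnext k _ (hcon k)).2.2
    rw [hk, flift_liftTo] at this
    rcases this with h' | h'
    · exact .inl ⟨k + 1, _, h'⟩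
    · exact .inr ⟨k + 1, _, h'.1⟩
  have hmp : ∀ {n : ℕ} {φ ψ : L.BoundedFormula Empty n}, Tr (φ.imp ψ) → Tr φ → Tr ψ := by
    rintro n φ ψ ⟨k, h, hk⟩ ⟨k', h', hk'⟩
    exact ⟨max k k', _, .mp₂ (hmono' h (le_max_left _ _) hk) (hmono' h' (le_max_right _ _) hk')⟩
  have hfal : ∀ {n : ℕ}, ¬Tr (n := n) .falsum := fun ⟨k, h, hk⟩ => hcon k hk
  refine ⟨⟨Tr, fun {n} φ h => ⟨n, le_rfl, .weaken (h.subst _)⟩, hmp, hfal, hem, ?_, ?_⟩, ?_⟩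
  · rintro n φ ⟨k, h, hk⟩
    refine ⟨k + 1, by omega, ?_⟩
    rw [liftTo_flift, ← flift_liftTo h]
    exact hstep k hk
  · intro n θ hθ
    obtain ⟨k, h, hk⟩ := hex θ.all
    refine ⟨k, h, fun ⟨k', h', hk'⟩ => ?_⟩
    have := (hnext k _ (hcon k)).2.2
    rw [hk] at this
    rcases this with h1 | h1
    · rw [flift_liftTo] at h1
      exact hθ ⟨k + 1, _, h1⟩
    · have h2 := h1.2 _ rfl
      have h3 : Tr (n := k + 1) _ := ⟨k', h', hk'⟩
      refine hfal (hmp (φ := _) ⟨k + 1, le_rfl, ?_⟩ h3)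
      rw [liftTo_self]
      exact h2
  · exact ⟨0, le_rfl, by rw [liftTo_self]; exact .refl _⟩

end Calculus

/-! ### The term model and the completeness theorem -/

section HenkinModel
variable {L : FirstOrder.Language.{0, 0}} {T : L.Theory}

/-- A term in the variables `x_0, …, x_{n-1}` as a term in the variables `x_0, x_1, …`. -/
def emb {n : ℕ} (t : L.Term (Empty ⊕ Fin n)) : L.Term ℕ :=
  t.subst (Sum.elim (fun e => e.elim) fun i => .var i)

theorem emb_injective {n : ℕ} : Function.Injective (emb : L.Term (Empty ⊕ Fin n) → L.Term ℕ) := by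
  intro t
  induction t using term_cases with
  | hv i =>
    intro s h
    induction s using term_cases with
    | hv j => simp [emb] at h; simp [Fin.ext_iff, h]
    | hf g ss => simp [emb] at h
  | hf f ts ih =>
    intro s h
    induction s using term_cases with
    | hv j => simp [emb] at h
    | hf g ss =>
      simp only [emb, Term.subst, Term.func.injEq] at h
      obtain ⟨rfl, h1, h2⟩ := h
      obtain rfl := eq_of_heq h1
      congr 1
      funext i
      exact ih i (congrFun (eq_of_heq h2) i)

/-- Substitution commutes with forgetting the number of variables. -/
theorem emb_tsubst {m n : ℕ} (τ : Fin m → L.Term (Empty ⊕ Fin n)) (t : L.Term (Empty ⊕ Fin m)) :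
    emb (tsubst τ t) = t.subst (Sum.elim (fun e => e.elim) fun i => emb (τ i)) := by
  induction t using term_cases with
  | hv i => rfl
  | hf f ts ih => simpa [emb, funext_iff] using ih

theorem emb_lift {m n : ℕ} (h : m ≤ n) (t : L.Term (Empty ⊕ Fin m)) :
    emb (tsubst (fun i => bvar (Fin.castLE h i)) t) = emb t := by
  rw [emb_tsubst]; rfl

theorem exists_emb (t : L.Term ℕ) : ∃ N₀, ∀ N ≥ N₀, ∃ s : L.Term (Empty ⊕ Fin N), emb s = t := by
  induction t with
  | var i => exact ⟨i + 1, fun N h => ⟨bvar ⟨i, h⟩, rfl⟩⟩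
  | func f ts ih =>
    choose N₀ h using ih
    refine ⟨Finset.univ.sup N₀, fun N hN => ?_⟩
    choose s hs using fun i => h i N ((Finset.le_sup (Finset.mem_univ i)).trans hN)
    exact ⟨.func f s, by simpa [emb, funext_iff] using hs⟩

theorem exists_emb_fun {k : ℕ} (σ : Fin k → L.Term ℕ) :
    ∃ N₀, ∀ N ≥ N₀, ∃ τ : Fin k → L.Term (Empty ⊕ Fin N), (fun i => emb (τ i)) = σ := by
  choose N₀ h using fun i => exists_emb (σ i)
  refine ⟨Finset.univ.sup N₀, fun N hN => ?_⟩
  choose s hs using fun i => h i N ((Finset.le_sup (Finset.mem_univ i)).trans hN)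
  exact ⟨s, funext hs⟩

namespace TruthSet
variable (S : TruthSet T)

theorem tr_not {n : ℕ} (φ : L.BoundedFormula Empty n) : S.Tr φ.not ↔ ¬S.Tr φ :=
  ⟨fun h h' => S.not_falsum (S.mp h h'), fun h => (S.em φ).resolve_left h⟩

theorem tr_imp {n : ℕ} (φ ψ : L.BoundedFormula Empty n) :
    S.Tr (φ.imp ψ) ↔ (S.Tr φ → S.Tr ψ) := by
  refine ⟨S.mp, fun h => by_contra fun h' => ?_⟩
  have := (S.tr_not _).2 h'
  have h1 := S.mp (S.prov (.not_imp_left φ ψ)) this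
  exact (S.tr_not _).1 (S.mp (S.prov (.not_imp_right φ ψ)) this) (h h1)

theorem tr_flift {n : ℕ} (φ : L.BoundedFormula Empty n) : S.Tr (flift φ) ↔ S.Tr φ := by
  refine ⟨fun h => by_contra fun h' => ?_, S.lift⟩
  exact (S.tr_not _).1 (S.lift ((S.tr_not _).2 h')) h

theorem tr_liftTo {n m : ℕ} (h : n ≤ m) (φ : L.BoundedFormula Empty n) :
    S.Tr (liftTo h φ) ↔ S.Tr φ := by
  induction m, h using Nat.le_induction with
  | base => rw [liftTo_self]
  | succ m h ih => rw [← flift_liftTo h, tr_flift, ih]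

/-- Truth of a formula when terms in the variables `x_0, x_1, …` are substituted for its free
variables. -/
def Sat {k : ℕ} (φ : L.BoundedFormula Empty k) (σ : Fin k → L.Term ℕ) : Prop :=
  ∃ (N : ℕ) (τ : Fin k → L.Term (Empty ⊕ Fin N)), (fun i => emb (τ i)) = σ ∧ S.Tr (fsubst τ φ)

theorem tr_fsubst_congr {k N N' : ℕ} (φ : L.BoundedFormula Empty k)
    {τ : Fin k → L.Term (Empty ⊕ Fin N)} {τ' : Fin k → L.Term (Empty ⊕ Fin N')}
    (h : (fun i => emb (τ i)) = fun i => emb (τ' i)) :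
    S.Tr (fsubst τ φ) ↔ S.Tr (fsubst τ' φ) := by
  wlog hN : N ≤ N' generalizing N N'
  · exact (this h.symm (le_of_not_ge hN)).symm
  rw [← S.tr_liftTo hN, liftTo, fsubst_fsubst]
  convert Iff.rfl using 3
  funext i
  apply emb_injective
  rw [emb_lift]
  exact (congrFun h i).symm

theorem sat_emb {k N : ℕ} (φ : L.BoundedFormula Empty k) (τ : Fin k → L.Term (Empty ⊕ Fin N)) :
    S.Sat φ (fun i => emb (τ i)) ↔ S.Tr (fsubst τ φ) :=
  ⟨fun ⟨_, _, h, h'⟩ => (S.tr_fsubst_congr φ h).1 h', fun h => ⟨N, τ, rfl, h⟩⟩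

/-- Provably equal terms may be exchanged in true formulas. -/
theorem tr_equal_congr {k N : ℕ} {τ τ' : Fin k → L.Term (Empty ⊕ Fin N)}
    (h : ∀ i, S.Tr (.equal (τ i) (τ' i))) (φ : L.BoundedFormula Empty k)
    (hφ : S.Tr (fsubst τ φ)) : S.Tr (fsubst τ' φ) := by
  -- The substituted terms are exchanged one at a time.
  have key : ∀ j ≤ k, S.Tr (fsubst (fun i : Fin k => if (i : ℕ) < j then τ' i else τ i) φ) := by
    intro j hj
    induction j with
    | zero => simpa using hφ
    | succ j ih =>
      have ih := ih (by omega)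
      let j' : Fin k := ⟨j, hj⟩
      let ψ : L.BoundedFormula Empty (N + 1) := fsubst (fun i : Fin k =>
        if i = j' then bvar (Fin.last N) else if (i : ℕ) < j then tlift (τ' i) else tlift (τ i)) φ
      have hψ : ∀ t, inst ψ t = fsubst (fun i : Fin k => if i = j' then t else
          if (i : ℕ) < j then τ' i else τ i) φ := by
        intro t
        simp only [ψ, inst, fsubst_fsubst]
        congr 1
        funext i
        split_ifs <;> simp [tsubst_tlift, tsubst_id]
      have h1 := S.mp (S.prov (.eq_subst ψ (τ j') (τ' j'))) (h j')
      rw [hψ, hψ] at h1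
      have h2 := S.mp h1 (by
        convert ih using 3 with i
        split_ifs with h3 h4
        · subst h3; simp [j'] at h4
        · subst h3; rfl
        · rfl
        · rfl)
      convert h2 using 3 with i
      by_cases h3 : i = j'
      · subst h3; simp [j']
      · have : (i : ℕ) ≠ j := fun h => h3 (Fin.ext h)
        simp only [h3, if_false]
        congr 1
        apply propext
        omega
  simpa using key k le_rfl

/-- Provable equality of terms. -/
def TermEq (s t : L.Term ℕ) : Prop := S.Sat (.equal (bvar 0) (bvar 1)) ![s, t]

theorem termEq_emb {N : ℕ} (s t : L.Term (Empty ⊕ Fin N)) :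
    S.TermEq (emb s) (emb t) ↔ S.Tr (.equal s t) := by
  have := S.sat_emb (.equal (bvar 0) (bvar 1)) ![s, t]
  rw [TermEq]
  convert this using 2
  · funext i
    fin_cases i <;> rfl
  · rfl

theorem sat_congr {k : ℕ} {σ σ' : Fin k → L.Term ℕ} (h : ∀ i, S.TermEq (σ i) (σ' i))
    (φ : L.BoundedFormula Empty k) (hφ : S.Sat φ σ) : S.Sat φ σ' := by
  obtain ⟨N, hN⟩ := exists_emb_fun σ
  obtain ⟨N', hN'⟩ := exists_emb_fun σ'
  obtain ⟨τ, rfl⟩ := hN _ (le_max_left N N')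
  obtain ⟨τ', rfl⟩ := hN' _ (le_max_right N N')
  simp only [termEq_emb] at h
  rw [sat_emb] at hφ ⊢
  exact S.tr_equal_congr h φ hφ

theorem termEq_refl (s : L.Term ℕ) : S.TermEq s s := by
  obtain ⟨N, hN⟩ := exists_emb s
  obtain ⟨s, rfl⟩ := hN N le_rfl
  exact (S.termEq_emb _ _).2 (S.prov (.eq_refl s))

theorem termEq_symm {s t : L.Term ℕ} (h : S.TermEq s t) : S.TermEq t s :=
  S.sat_congr (σ := ![s, s]) (fun i => by
    fin_cases i
    exacts [h, S.termEq_refl s]) _ (S.termEq_refl s)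

theorem termEq_trans {s t u : L.Term ℕ} (h : S.TermEq s t) (h' : S.TermEq t u) : S.TermEq s u :=
  S.sat_congr (σ := ![s, t]) (fun i => by
    fin_cases i
    exacts [S.termEq_refl s, h']) _ h

/-- Provable equality is a congruence. -/
theorem termEq_func {k : ℕ} (f : L.Functions k) {ts ss : Fin k → L.Term ℕ}
    (h : ∀ i, S.TermEq (ts i) (ss i)) : S.TermEq (.func f ts) (.func f ss) := by
  obtain ⟨N, hN⟩ := exists_emb_fun ts
  obtain ⟨N', hN'⟩ := exists_emb_fun ss
  obtain ⟨τ, rfl⟩ := hN _ (le_max_left N N')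
  obtain ⟨τ', rfl⟩ := hN' _ (le_max_right N N')
  simp only [termEq_emb] at h
  -- In the formula `f x = f y` the terms `τ, τ` are replaced by `τ, τ'`.
  have := S.tr_equal_congr (τ := Fin.append τ τ) (τ' := Fin.append τ τ') (fun i => by
      refine Fin.addCases (fun i => ?_) (fun i => ?_) i
      · rw [Fin.append_left, Fin.append_left]; exact S.prov (.eq_refl _)
      · rw [Fin.append_right, Fin.append_right]; exact h i)
    (.equal (.func f fun i => bvar (Fin.castAdd k i)) (.func f fun i => bvar (Fin.natAdd k i)))
    (by
      simp only [fsubst, tsubst_func, tsubst_bvar, Fin.append_left, Fin.append_right]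
      exact S.prov (.eq_refl _))
  simp only [fsubst, tsubst_func, tsubst_bvar, Fin.append_left, Fin.append_right] at this
  exact (S.termEq_emb (.func f τ) (.func f τ')).2 this

/-- Provable equality as an equivalence relation. -/
def termSetoid : Setoid (L.Term ℕ) := ⟨S.TermEq, S.termEq_refl, S.termEq_symm, S.termEq_trans⟩

/-- The term model of a complete Henkin theory. -/
def Model : Type := Quotient S.termSetoid

/-- The element of the term model given by a term. -/
def cls (t : L.Term ℕ) : S.Model := Quotient.mk S.termSetoid t

theorem cls_eq {s t : L.Term ℕ} : S.cls s = S.cls t ↔ S.TermEq s t :=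
  Quotient.eq (r := S.termSetoid)

/-- A term representing an element of the term model. -/
noncomputable def rep (x : S.Model) : L.Term ℕ := Quotient.out x

theorem cls_rep (x : S.Model) : S.cls (S.rep x) = x := Quotient.out_eq x

/-- Functions and relations are evaluated at chosen representatives; by `termEq_func` and `sat_congr`
the choice does not matter. -/
noncomputable instance : L.Structure S.Model where
  funMap f xs := S.cls (.func f fun i => S.rep (xs i))
  RelMap R xs := S.Sat (.rel R fun i => bvar i) fun i => S.rep (xs i)

instance : Nonempty S.Model := ⟨S.cls (.var 0)⟩

theorem realize_term {k : ℕ} (t : L.Term (Empty ⊕ Fin k)) (v : Empty → S.Model)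
    (σ : Fin k → L.Term ℕ) : t.realize (Sum.elim v fun i => S.cls (σ i)) =
      S.cls (t.subst (Sum.elim (fun e => e.elim) σ)) := by
  induction t using term_cases with
  | hv i => rfl
  | hf f ts ih =>
    simp only [Term.realize_func, ih]
    refine S.cls_eq.2 (S.termEq_func f fun i => ?_)
    exact S.cls_eq.1 (S.cls_rep _)

/-- The truth lemma for the term model. -/
theorem realize_iff_sat : ∀ {k : ℕ} (φ : L.BoundedFormula Empty k) (v : Empty → S.Model)
    (σ : Fin k → L.Term ℕ), φ.Realize v (fun i => S.cls (σ i)) ↔ S.Sat φ σ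
  | k, .falsum, v, σ => by
    refine ⟨False.elim, fun ⟨N, τ, _, h⟩ => S.not_falsum h⟩
  | k, .equal t s, v, σ => by
    obtain ⟨N, hN⟩ := exists_emb_fun σ
    obtain ⟨τ, rfl⟩ := hN N le_rfl
    simp only [BoundedFormula.Realize, realize_term, cls_eq, sat_emb, ← emb_tsubst, termEq_emb]
    rfl
  | k, .rel R ts, v, σ => by
    obtain ⟨N, hN⟩ := exists_emb_fun σ
    obtain ⟨τ, rfl⟩ := hN N le_rfl
    simp only [BoundedFormula.Realize, realize_term, ← emb_tsubst, sat_emb]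
    change S.Sat _ _ ↔ _
    refine Iff.trans ⟨S.sat_congr (fun i => S.cls_eq.1 (S.cls_rep _)) _,
      S.sat_congr (fun i => S.cls_eq.1 (S.cls_rep _).symm) _⟩
      (S.sat_emb (.rel R fun i => bvar i) fun i => tsubst τ (ts i))
  | k, .imp φ ψ, v, σ => by
    have h₁ := realize_iff_sat φ v σ
    have h₂ := realize_iff_sat ψ v σ
    rw [BoundedFormula.realize_imp, h₁, h₂]
    obtain ⟨N, hN⟩ := exists_emb_fun σ
    obtain ⟨τ, rfl⟩ := hN N le_rfl
    simp only [sat_emb, fsubst_imp, tr_imp]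
  | k, .all φ, v, σ => by
    have ih : ∀ t, φ.Realize v (Fin.snoc (fun i => S.cls (σ i)) (S.cls t)) ↔
        S.Sat φ (Fin.snoc σ t) := by
      intro t
      rw [← realize_iff_sat φ v]
      refine iff_of_eq (congrArg _ (funext fun i => ?_))
      refine Fin.lastCases ?_ (fun i => ?_) i <;> simp
    rw [BoundedFormula.realize_all]
    have : (∀ x : S.Model, φ.Realize v (Fin.snoc (fun i => S.cls (σ i)) x)) ↔
        ∀ t, S.Sat φ (Fin.snoc σ t) :=
      ⟨fun h t => (ih t).1 (h _), fun h x => by rw [← S.cls_rep x]; exact (ih _).2 (h _)⟩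
    rw [this]
    obtain ⟨N, hN⟩ := exists_emb_fun σ
    constructor
    · obtain ⟨τ, rfl⟩ := hN N le_rfl
      intro h
      rw [sat_emb]
      by_contra h'
      -- The witness of the refuted universal formula is a variable, to which `h` applies.
      obtain ⟨j, hj, hw⟩ := S.wit h'
      rw [fsubst_fsubst] at hw
      refine hw ((S.sat_emb _ _).1 ?_)
      convert h (.var j) using 1
      funext i
      refine Fin.lastCases ?_ (fun i => ?_) i
      · simp [emb]
      · rw [Fin.snoc_castSucc, Fin.snoc_castSucc, ← emb_lift hj (τ i), tsubst_tlift]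
        have := emb_lift (Nat.le_succ j) (tsubst (fun i => bvar (Fin.castLE hj i)) (τ i))
        rw [tsubst_tsubst] at this
        rw [← this]
        congr 2
        funext i
        simp [tlift]
    · intro h t
      obtain ⟨N', hN'⟩ := exists_emb t
      obtain ⟨τ, rfl⟩ := hN _ (le_max_left N N')
      obtain ⟨t, rfl⟩ := hN' _ (le_max_right N N')
      rw [sat_emb] at h
      have h1 := S.mp (S.prov (.all_elim _ t)) h
      rw [inst, fsubst_fsubst, ← sat_emb] at h1
      convert h1 using 1
      funext i
      refine Fin.lastCases ?_ (fun i => ?_) i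
      · simp
      · simp only [Fin.snoc_castSucc, tsubst_tlift]
        rw [tsubst_id]

end TruthSet

/-- Gödel's completeness theorem for countable languages. -/
theorem Provable.of_models [Countable (Σ k, L.Functions k)] [Countable (Σ k, L.Relations k)]
    {φ : L.Sentence}
    (h : ∀ (M : Type) [L.Structure M] [Nonempty M], (∀ ψ ∈ T, M ⊨ ψ) → M ⊨ φ) :
    Provable T (n := 0) φ := by
  have : Countable L.Symbols := inferInstanceAs (Countable (_ ⊕ _))
  have : Countable (Σ n, L.BoundedFormula Empty n) := by
    rw [← Cardinal.mk_le_aleph0_iff]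
    refine BoundedFormula.card_le.trans ?_
    simp only [Cardinal.mk_eq_zero, Cardinal.lift_id, zero_add, max_le_iff, le_refl,
      true_and]
    exact Cardinal.mk_le_aleph0
  by_contra hφ
  obtain ⟨S, hS⟩ := exists_truthSet (T := T) (χ₀ := BoundedFormula.not φ)
    fun h' => hφ (.mp (.dne _) h')
  have key : ∀ ψ : L.Sentence, S.Model ⊨ ψ ↔ S.Tr (n := 0) ψ := by
    intro ψ
    have h1 := S.realize_iff_sat ψ default fun i => i.elim0
    have h2 := S.sat_emb (N := 0) ψ fun i => i.elim0
    rw [show (fun i : Fin 0 => emb (i.elim0 : L.Term (Empty ⊕ Fin 0))) = fun i => i.elim0 from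
      funext fun i => i.elim0, show fsubst (fun i : Fin 0 => i.elim0) ψ = ψ by
        convert fsubst_id ψ] at h2
    rw [← h2, ← h1, Sentence.Realize, Formula.Realize]
    exact iff_of_eq (congrArg _ (funext fun i => i.elim0))
  refine (S.tr_not φ).1 hS ((key φ).1 (h S.Model fun ψ hψ => (key ψ).2 (S.prov ?_)))
  convert Provable.ax (n := 0) hψ
  symm
  convert fsubst_id ψ

end HenkinModel

/-! ### Models of `R` and witness comparison -/

section ArithStructures

section Ops
variable {M : Type} [arith.Structure M]

/-- The zero element of a structure for the language of arithmetic. -/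
def zr (M : Type) [arith.Structure M] : M := Structure.funMap (L := arith) ArithFunc.zero ![]

/-- Successor in a structure for the language of arithmetic. -/
def sc (x : M) : M := Structure.funMap (L := arith) ArithFunc.succ ![x]

/-- Addition in a structure for the language of arithmetic. -/
def ad (x y : M) : M := Structure.funMap (L := arith) ArithFunc.add ![x, y]

/-- Multiplication in a structure for the language of arithmetic. -/
def ml (x y : M) : M := Structure.funMap (L := arith) ArithFunc.mul ![x, y]

/-- The defined relation `x ≤ y`, that is, `∃ z, z + x = y`. -/
def LE' (x y : M) : Prop := ∃ z, ad z x = y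

/-- The value of the numeral `S^n 0`. -/
def num (M : Type) [arith.Structure M] : ℕ → M
  | 0 => zr M
  | n + 1 => sc (num M n)

/-- The term `S t`. -/
def suc {n : ℕ} (t : arith.Term (Empty ⊕ Fin n)) : arith.Term (Empty ⊕ Fin n) :=
  Term.func (L := arith) ArithFunc.succ ![t]

variable {n : ℕ} (w : Empty ⊕ Fin n → M)

@[simp] theorem realize_suc (t : arith.Term (Empty ⊕ Fin n)) :
    (suc t).realize w = sc (t.realize w) := by
  refine congrArg (Structure.funMap (L := arith) _) (funext fun i => ?_)
  fin_cases i; rfl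

@[simp] theorem realize_numeral (a : ℕ) : (numeral a : arith.Term (Empty ⊕ Fin n)).realize w =
    num M a := by
  induction a with
  | zero =>
    simp only [numeral, Term.realize_func, num, zr]
    congr 1
    funext i
    exact i.elim0
  | succ a ih =>
    rw [num, ← ih, ← realize_suc]
    rfl

@[simp] theorem realize_add (s t : arith.Term (Empty ⊕ Fin n)) :
    (add s t).realize w = ad (s.realize w) (t.realize w) := by
  refine congrArg (Structure.funMap (L := arith) _) (funext fun i => ?_)
  fin_cases i <;> rfl

@[simp] theorem realize_mul (s t : arith.Term (Empty ⊕ Fin n)) :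
    (mul s t).realize w = ml (s.realize w) (t.realize w) := by
  refine congrArg (Structure.funMap (L := arith) _) (funext fun i => ?_)
  fin_cases i <;> rfl

@[simp] theorem realize_equal (s t : arith.Term (Empty ⊕ Fin n)) (v : Empty → M) (xs : Fin n → M) :
    (BoundedFormula.equal s t).Realize v xs ↔
      s.realize (Sum.elim v xs) = t.realize (Sum.elim v xs) := Iff.rfl

theorem realize_bvar (i : Fin n) (v : Empty → M) (xs : Fin n → M) :
    (bvar i : arith.Term _).realize (Sum.elim v xs) = xs i := rfl

@[simp] theorem realize_le (s t : arith.Term (Empty ⊕ Fin n)) (v : Empty → M) (xs : Fin n → M) :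
    (le s t).Realize v xs ↔ LE' (s.realize (Sum.elim v xs)) (t.realize (Sum.elim v xs)) := by
  simp [le, realize_tlift, LE']

end Ops

section Standard

@[simp] theorem zr_nat : zr ℕ = 0 := rfl
@[simp] theorem sc_nat (x : ℕ) : sc x = x + 1 := rfl
@[simp] theorem ad_nat (x y : ℕ) : ad x y = x + y := rfl
@[simp] theorem ml_nat (x y : ℕ) : ml x y = x * y := rfl
@[simp] theorem num_nat (n : ℕ) : num ℕ n = n := by
  induction n with
  | zero => rfl
  | succ n ih => simp [num, ih]

@[simp] theorem LE'_nat (x y : ℕ) : LE' x y ↔ x ≤ y :=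
  ⟨fun ⟨z, h⟩ => by simp at h; omega, fun h => ⟨y - x, by simp; omega⟩⟩

end Standard

/-- The models of `R`: the axioms, with `x ≤ n̄` already evaluated. -/
structure RModel (M : Type) [arith.Structure M] : Prop where
  add : ∀ m n, ad (num M m) (num M n) = num M (m + n)
  mul : ∀ m n, ml (num M m) (num M n) = num M (m * n)
  inj : ∀ {m n}, num M m = num M n ↔ m = n
  le : ∀ {n x}, LE' x (num M n) ↔ ∃ j ≤ n, x = num M j
  total : ∀ n x, LE' x (num M n) ∨ LE' (num M n) x

variable {M : Type} [arith.Structure M]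

theorem realize_eqUpTo (n : ℕ) (v : Empty → M) (xs : Fin 1 → M) :
    (eqUpTo n).Realize v xs ↔ ∃ j ≤ n, xs 0 = num M j := by
  induction n with
  | zero => simp [eqUpTo]
  | succ n ih =>
    simp only [eqUpTo, BoundedFormula.realize_sup, ih, realize_equal, realize_numeral, realize_bvar]
    constructor
    · rintro (⟨j, h, e⟩ | e)
      · exact ⟨j, by omega, e⟩
      · exact ⟨n + 1, le_rfl, e⟩
    · rintro ⟨j, h, e⟩
      rcases Nat.lt_or_ge n j with h' | h'
      · obtain rfl : j = n + 1 := by omega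
        exact .inr e
      · exact .inl ⟨j, h', e⟩

theorem rModel_iff : RModel M ↔ ∀ φ ∈ R, M ⊨ φ := by
  constructor
  · rintro h φ (⟨m, n⟩ | ⟨m, n⟩ | ⟨m, n, hmn⟩ | ⟨n⟩ | ⟨n⟩)
    · simp [Sentence.Realize, Formula.Realize, h.add]
    · simp [Sentence.Realize, Formula.Realize, h.mul]
    · simpa [Sentence.Realize, Formula.Realize, h.inj]
    · simp only [Sentence.Realize, Formula.Realize, BoundedFormula.realize_all,
        BoundedFormula.realize_imp, realize_le, realize_numeral, realize_eqUpTo]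
      exact fun x hx => h.le.1 hx
    · simp only [Sentence.Realize, Formula.Realize, BoundedFormula.realize_all,
        BoundedFormula.realize_sup, realize_le, realize_numeral]
      exact fun x => h.total n _
  · intro h
    have h1 : ∀ m n, ad (num M m) (num M n) = num M (m + n) := fun m n => by
      simpa [Sentence.Realize, Formula.Realize] using h _ (RAxiom.ax1 m n)
    refine ⟨h1, fun m n => ?_, fun {m n} => ⟨fun e => ?_, fun e => e ▸ rfl⟩,
      fun {n x} => ⟨fun hx => ?_, ?_⟩, fun n x => ?_⟩
    · simpa [Sentence.Realize, Formula.Realize] using h _ (RAxiom.ax2 m n)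
    · by_contra hmn
      have := h _ (RAxiom.ax3 m n hmn)
      simp [Sentence.Realize, Formula.Realize] at this
      exact this e
    · have := h _ (RAxiom.ax4 n)
      simp only [Sentence.Realize, Formula.Realize, BoundedFormula.realize_all,
        BoundedFormula.realize_imp, realize_le, realize_numeral, realize_eqUpTo] at this
      exact this x hx
    · rintro ⟨j, hj, rfl⟩
      exact ⟨num M (n - j), by rw [h1]; congr 1; omega⟩
    · have := h _ (RAxiom.ax5 n)
      simp only [Sentence.Realize, Formula.Realize, BoundedFormula.realize_all,
        BoundedFormula.realize_sup, realize_le, realize_numeral] at this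
      exact this x

theorem rModel_nat : RModel ℕ :=
  ⟨by simp, by simp, by simp, by simp, fun n x => by simpa using le_total x n⟩

instance : Countable (Σ k, arith.Functions k) := inferInstance
instance : Countable (Σ k, arith.Relations k) := inferInstance

/-- By the completeness theorem, provability in `R` is truth in all models of `R`. -/
theorem provable_R_of_models {φ : arith.Sentence}
    (h : ∀ (M : Type) [arith.Structure M], RModel M → φ.Realize M) :
    Provable R (n := 0) φ :=
  .of_models fun M _ _ hM => h M (rModel_iff.2 hM)

theorem Provable.realize_nat {φ : arith.Sentence} (h : Provable R (n := 0) φ)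
    (v : Empty → ℕ) (xs : Fin 0 → ℕ) : BoundedFormula.Realize φ v xs :=
  h.sound (rModel_iff.1 rModel_nat) v xs

theorem consistent_R : Consistent R := fun h => h.realize_nat default default

theorem realize_atNumerals {k : ℕ} (φ : arith.BoundedFormula Empty k) (a : Fin k → ℕ)
    (v : Empty → M) (xs : Fin 0 → M) :
    BoundedFormula.Realize (atNumerals φ a) v xs ↔ φ.Realize v fun i => num M (a i) := by
  simp [atNumerals, realize_fsubst]

theorem realize_atNumerals_one (φ : arith.BoundedFormula Empty 1) (n : ℕ)
    (v : Empty → M) (xs : Fin 0 → M) :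
    BoundedFormula.Realize (atNumerals φ ![n]) v xs ↔ φ.Realize v ![num M n] := by
  rw [realize_atNumerals]
  convert Iff.rfl using 2
  funext i; fin_cases i; rfl

theorem snoc_num {n : ℕ} (a : Fin n → ℕ) (j : ℕ) :
    (Fin.snoc (fun i => num M (a i)) (num M j) : Fin (n + 1) → M) =
      fun i => num M ((Fin.snoc a j : Fin (n + 1) → ℕ) i) := by
  funext i
  refine Fin.lastCases ?_ (fun i => ?_) i <;> simp

/-- Terms at numerals have the value that they have in the standard model. -/
theorem RModel.realize_term (hM : RModel M) {n : ℕ} (t : arith.Term (Empty ⊕ Fin n))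
    (v : Empty → M) (v' : Empty → ℕ) (a : Fin n → ℕ) :
    t.realize (Sum.elim v fun i => num M (a i)) = num M (t.realize (Sum.elim v' a)) := by
  induction t using term_cases with
  | hv i => rfl
  | @hf k f ts ih =>
    simp only [Term.realize_func, ih]
    change ArithFunc k at f
    cases f with
    | zero => exact congrArg _ (funext fun i => i.elim0)
    | succ => exact congrArg _ (funext fun i => by fin_cases i; rfl)
    | add => exact .trans (congrArg _ (funext fun i => by fin_cases i <;> rfl)) (hM.add _ _)
    | mul => exact .trans (congrArg _ (funext fun i => by fin_cases i <;> rfl)) (hM.mul _ _)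

/-- Bounded formulas are absolute between the standard model and any model of `R`. -/
theorem IsBounded.absolute (hM : RModel M) {n : ℕ} {φ : arith.BoundedFormula Empty n}
    (hφ : IsBounded φ) (v : Empty → M) (v' : Empty → ℕ) (a : Fin n → ℕ) :
    φ.Realize v (fun i => num M (a i)) ↔ φ.Realize v' a := by
  induction hφ with
  | equal s t => simp only [realize_equal, hM.realize_term _ v v', hM.inj]
  | le s t =>
    simp only [realize_le, hM.realize_term _ v v', LE'_nat, hM.le, hM.inj]
    exact ⟨fun ⟨j, h, e⟩ => e ▸ h, fun h => ⟨_, h, rfl⟩⟩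
  | not _ ih => simp only [BoundedFormula.realize_not, ih]
  | and _ _ ih₁ ih₂ => simp only [BoundedFormula.realize_inf, ih₁, ih₂]
  | or _ _ ih₁ ih₂ => simp only [BoundedFormula.realize_sup, ih₁, ih₂]
  | bex i _ ih =>
    simp only [BoundedFormula.realize_ex, BoundedFormula.realize_inf, realize_le, realize_bvar,
      Fin.snoc_last, Fin.snoc_castSucc, hM.le, LE'_nat]
    constructor
    · rintro ⟨_, ⟨j, hj, rfl⟩, h⟩
      rw [snoc_num, ih] at h
      exact ⟨j, hj, h⟩
    · rintro ⟨j, hj, h⟩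
      refine ⟨_, ⟨j, hj, rfl⟩, ?_⟩
      rwa [snoc_num, ih]
  | ball i _ ih =>
    simp only [BoundedFormula.realize_all, BoundedFormula.realize_imp, realize_le, realize_bvar,
      Fin.snoc_last, Fin.snoc_castSucc, hM.le, LE'_nat]
    constructor
    · intro h j hj
      have := h _ ⟨j, hj, rfl⟩
      rwa [snoc_num, ih] at this
    · rintro h _ ⟨j, hj, rfl⟩
      rw [snoc_num, ih]
      exact h j hj

theorem IsBounded.absolute_two (hM : RModel M) {φ : arith.BoundedFormula Empty 2}
    (hφ : IsBounded φ) (v : Empty → M) (v' : Empty → ℕ) (a b : ℕ) :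
    φ.Realize v ![num M a, num M b] ↔ φ.Realize v' ![a, b] := by
  rw [← hφ.absolute hM v v']
  convert Iff.rfl using 2
  funext i; fin_cases i <;> rfl

theorem definesInN_ex {φ : arith.BoundedFormula Empty 2} {A : Set ℕ} :
    DefinesInN φ.ex A ↔ ∀ n, n ∈ A ↔ ∃ y, φ.Realize (default : Empty → ℕ) ![n, y] := by
  refine forall_congr' fun n => ?_
  rw [Subsingleton.elim (default : Empty → ℕ) Empty.elim]
  simp only [BoundedFormula.realize_ex]
  refine iff_of_eq (congrArg _ (congrArg _ (funext fun y => ?_)))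
  congr 1
  funext i; fin_cases i <;> rfl

/-- The meaning of the witness comparison formula in an arbitrary structure. -/
theorem realize_witnessLT (φ₀ φ₁ : arith.BoundedFormula Empty 2) (v : Empty → M) (x : M) :
    (witnessLT φ₀ φ₁).Realize v ![x] ↔ ∃ y, φ₀.Realize v ![x, y] ∧
      ∀ z, LE' z y → ¬φ₁.Realize v ![x, z] := by
  simp only [witnessLT, BoundedFormula.realize_ex, BoundedFormula.realize_inf,
    BoundedFormula.realize_all, BoundedFormula.realize_imp, realize_le, BoundedFormula.realize_not,
    realize_fsubst]
  refine exists_congr fun y => and_congr (iff_of_eq (congrArg _ ?_))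
    (forall_congr' fun z => imp_congr Iff.rfl (not_congr (iff_of_eq (congrArg _ ?_))))
  · funext i; fin_cases i <;> rfl
  · funext i; fin_cases i <;> rfl

/-- Witness comparison of the bounded matrices defining two disjoint sets separates them in `R`. -/
theorem separatesIn_witnessLT {A B : Set ℕ} (hAB : A ∩ B = ∅) {φ₀ φ₁ : arith.BoundedFormula Empty 2}
    (h₀ : IsBounded φ₀) (h₁ : IsBounded φ₁) (hA : DefinesInN φ₀.ex A) (hB : DefinesInN φ₁.ex B) :
    SeparatesIn R (witnessLT φ₀ φ₁) A B := by
  rw [definesInN_ex] at hA hB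
  have hdis : ∀ n, n ∈ A → n ∉ B := fun n h h' => (Set.ext_iff.1 hAB n).1 ⟨h, h'⟩
  refine ⟨fun n hn => provable_R_of_models fun M _ hM => ?_,
    fun n hn => provable_R_of_models fun M _ hM => ?_⟩
  · rw [Sentence.Realize, Formula.Realize, realize_atNumerals_one, realize_witnessLT]
    obtain ⟨y, hy⟩ := (hA n).1 hn
    refine ⟨num M y, (h₀.absolute_two hM _ default _ _).2 hy, fun z hz h => ?_⟩
    obtain ⟨j, -, rfl⟩ := hM.le.1 hz
    exact hdis n hn ((hB n).2 ⟨j, (h₁.absolute_two hM _ default _ _).1 h⟩)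
  · rw [Sentence.Realize, Formula.Realize, BoundedFormula.realize_not, realize_atNumerals_one,
      realize_witnessLT]
    rintro ⟨y, hy, h⟩
    obtain ⟨z, hz⟩ := (hB n).1 hn
    -- The element `y` is comparable with the standard witness `z` for `B`: below `z` it is a
    -- numeral, hence a witness for `A`, and above `z` the second clause of the comparison fails.
    rcases hM.total z y with hyz | hzy
    · obtain ⟨j, -, rfl⟩ := hM.le.1 hyz
      exact hdis n ((hA n).2 ⟨j, (h₀.absolute_two hM _ default _ _).1 hy⟩) hn
    · exact h _ hzy ((h₁.absolute_two hM _ default _ _).2 hz)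

end ArithStructures

/-! ### Definability by `Σ`-formulas -/

section Sigma

/-- Positive `Σ`-formulas in `n` variables whose atoms are the graphs of successor, addition and
multiplication.  A quantified variable is the new first variable.  The constructor `rn`
renames variables. -/
inductive SF : ℕ → Type
  | succ {n : ℕ} (i j : Fin n) : SF n
  | add {n : ℕ} (i j k : Fin n) : SF n
  | mul {n : ℕ} (i j k : Fin n) : SF n
  | and {n : ℕ} (s t : SF n) : SF n
  | or {n : ℕ} (s t : SF n) : SF n
  | ex {n : ℕ} (s : SF (n + 1)) : SF n
  | ball {n : ℕ} (i : Fin n) (s : SF (n + 1)) : SF n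
  | rn {m n : ℕ} (f : Fin m → Fin n) (s : SF m) : SF n

namespace SF

/-- Truth in the standard model. -/
def Real : ∀ {n : ℕ}, SF n → (Fin n → ℕ) → Prop
  | _, succ i j, a => a i + 1 = a j
  | _, add i j k, a => a i + a j = a k
  | _, mul i j k, a => a i * a j = a k
  | _, and s t, a => s.Real a ∧ t.Real a
  | _, or s t, a => s.Real a ∨ t.Real a
  | _, ex s, a => ∃ x, s.Real (Fin.cons x a)
  | _, ball i s, a => ∀ x ≤ a i, s.Real (Fin.cons x a)
  | _, rn f s, a => s.Real (a ∘ f)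

/-- Truth in the standard model with existential quantifiers bounded by `p`. -/
def RealB (p : ℕ) : ∀ {n : ℕ}, SF n → (Fin n → ℕ) → Prop
  | _, succ i j, a => a i + 1 = a j
  | _, add i j k, a => a i + a j = a k
  | _, mul i j k, a => a i * a j = a k
  | _, and s t, a => s.RealB p a ∧ t.RealB p a
  | _, or s t, a => s.RealB p a ∨ t.RealB p a
  | _, ex s, a => ∃ x ≤ p, s.RealB p (Fin.cons x a)
  | _, ball i s, a => ∀ x ≤ a i, s.RealB p (Fin.cons x a)
  | _, rn f s, a => s.RealB p (a ∘ f)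

theorem RealB.mono {p q : ℕ} (h : p ≤ q) : ∀ {n : ℕ} {s : SF n} {a : Fin n → ℕ},
    s.RealB p a → s.RealB q a
  | _, succ _ _, _, ha => ha
  | _, add _ _ _, _, ha => ha
  | _, mul _ _ _, _, ha => ha
  | _, and _ _, _, ha => ⟨ha.1.mono h, ha.2.mono h⟩
  | _, or _ _, _, ha => Or.imp (fun ha => RealB.mono h ha) (fun ha => RealB.mono h ha) ha
  | _, ex _, _, ha => Exists.imp (fun _ ha => ⟨ha.1.trans h, RealB.mono h ha.2⟩) ha
  | _, ball _ _, _, ha => fun x hx => (ha x hx).mono h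
  | _, rn _ s, _, ha => RealB.mono (s := s) h ha

/-- A `Σ`-formula is true iff it is true with all existential quantifiers bounded by some number
(`Σ`-collection). -/
theorem real_iff : ∀ {n : ℕ} {s : SF n} {a : Fin n → ℕ}, s.Real a ↔ ∃ p, s.RealB p a
  | _, succ _ _, _ => by simp [Real, RealB]
  | _, add _ _ _, _ => by simp [Real, RealB]
  | _, mul _ _ _, _ => by simp [Real, RealB]
  | _, and s t, a => by
    simp only [Real, RealB, real_iff]
    exact ⟨fun ⟨⟨p, hp⟩, q, hq⟩ => ⟨max p q, hp.mono (le_max_left _ _), hq.mono (le_max_right _ _)⟩,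
      fun ⟨p, h, h'⟩ => ⟨⟨p, h⟩, p, h'⟩⟩
  | _, or s t, a => by
    simp only [Real, RealB, real_iff, exists_or]
  | _, ex s, a => by
    simp only [Real, RealB, real_iff]
    exact ⟨fun ⟨x, p, h⟩ => ⟨max x p, x, le_max_left _ _, h.mono (le_max_right _ _)⟩,
      fun ⟨p, x, _, h⟩ => ⟨x, p, h⟩⟩
  | _, ball i s, a => by
    simp only [Real, RealB, real_iff]
    refine ⟨fun h => ?_, fun ⟨p, h⟩ x hx => ⟨p, h x hx⟩⟩
    choose! p hp using h
    exact ⟨(Finset.range (a i + 1)).sup p, fun x hx => (hp x hx).mono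
      (Finset.le_sup (f := p) (Finset.mem_range.2 (Nat.lt_succ_of_le hx)))⟩
  | _, rn f s, a => by
    simp only [Real, RealB, real_iff]

/-- The bounded formula of arithmetic expressing truth with existential quantifiers bounded by the
variable `y`; the variables are renamed by `v`. -/
def trans : ∀ {n : ℕ}, SF n → ∀ {m : ℕ}, (Fin n → Fin m) → Fin m → arith.BoundedFormula Empty m
  | _, succ i j, _, v, _ => .equal (suc (bvar (v i))) (bvar (v j))
  | _, add i j k, _, v, _ => .equal (MetaR.add (bvar (v i)) (bvar (v j))) (bvar (v k))
  | _, mul i j k, _, v, _ => .equal (MetaR.mul (bvar (v i)) (bvar (v j))) (bvar (v k))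
  | _, and s t, _, v, y => s.trans v y ⊓ t.trans v y
  | _, or s t, _, v, y => s.trans v y ⊔ t.trans v y
  | _, ex s, m, v, y => BoundedFormula.ex (le (bvar (Fin.last m)) (bvar y.castSucc) ⊓
      s.trans (Fin.cons (Fin.last m) fun i => (v i).castSucc) y.castSucc)
  | _, ball i s, m, v, y => BoundedFormula.all ((le (bvar (Fin.last m)) (bvar (v i).castSucc)).imp
      (s.trans (Fin.cons (Fin.last m) fun i => (v i).castSucc) y.castSucc))
  | _, rn f s, _, v, y => s.trans (v ∘ f) y

theorem isBounded_trans : ∀ {n : ℕ} (s : SF n) {m : ℕ} (v : Fin n → Fin m) (y : Fin m),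
    IsBounded (s.trans v y)
  | _, succ _ _, _, _, _ => .equal _ _
  | _, add _ _ _, _, _, _ => .equal _ _
  | _, mul _ _ _, _, _, _ => .equal _ _
  | _, and s t, _, _, _ => .and (isBounded_trans s _ _) (isBounded_trans t _ _)
  | _, or s t, _, _, _ => .or (isBounded_trans s _ _) (isBounded_trans t _ _)
  | _, ex s, _, _, _ => .bex _ (isBounded_trans s _ _)
  | _, ball _ s, _, _, _ => .ball _ (isBounded_trans s _ _)
  | _, rn _ s, _, _, _ => isBounded_trans s _ _

/-- The part of arithmetic needed to evaluate the translations of `Σ`-formulas at numbers up to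
`k` in the structure `M`. -/
structure Good (M : Type) [arith.Structure M] (k : ℕ) : Prop where
  le : ∀ {n x}, n ≤ k → (LE' x (num M n) ↔ ∃ j ≤ n, x = num M j)
  succ : ∀ {a b}, a ≤ k → b ≤ k → (sc (num M a) = num M b ↔ a + 1 = b)
  add : ∀ {a b c}, a ≤ k → b ≤ k → c ≤ k → (ad (num M a) (num M b) = num M c ↔ a + b = c)
  mul : ∀ {a b c}, a ≤ k → b ≤ k → c ≤ k → (ml (num M a) (num M b) = num M c ↔ a * b = c)

variable {M : Type} [arith.Structure M]

theorem _root_.MetaR.RModel.good (hM : RModel M) (k : ℕ) : Good M k :=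
  ⟨fun _ => hM.le, fun {a} _ _ _ => hM.inj (m := a + 1), fun _ _ _ => by rw [hM.add, hM.inj],
    fun _ _ _ => by rw [hM.mul, hM.inj]⟩

/-- The translation of a `Σ`-formula is evaluated correctly at numerals up to `k`, in any structure
that is correct up to `k`. -/
theorem Good.realize_trans {k : ℕ} (hM : Good M k) :
    ∀ {n : ℕ} (s : SF n) {m : ℕ} (v : Fin n → Fin m) (y : Fin m) (e : Empty → M) (xs : Fin m → M)
      {p : ℕ} {a : Fin n → ℕ}, xs y = num M p → (∀ i, xs (v i) = num M (a i)) → p ≤ k →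
      (∀ i, a i ≤ k) → ((s.trans v y).Realize e xs ↔ s.RealB p a)
  | _, .succ i j, _, v, y, e, xs, p, a, hy, hv, hp, ha => by
    simp only [trans, RealB, realize_equal, realize_suc, realize_bvar, hv, hM.succ (ha i) (ha j)]
  | _, .add i j k, _, v, y, e, xs, p, a, hy, hv, hp, ha => by
    simp only [trans, RealB, realize_equal, realize_add, realize_bvar, hv,
      hM.add (ha i) (ha j) (ha k)]
  | _, .mul i j k, _, v, y, e, xs, p, a, hy, hv, hp, ha => by
    simp only [trans, RealB, realize_equal, realize_mul, realize_bvar, hv,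
      hM.mul (ha i) (ha j) (ha k)]
  | _, .and s t, _, v, y, e, xs, p, a, hy, hv, hp, ha => by
    simp only [trans, RealB, BoundedFormula.realize_inf, hM.realize_trans _ v y e xs hy hv hp ha]
  | _, .or s t, _, v, y, e, xs, p, a, hy, hv, hp, ha => by
    simp only [trans, RealB, BoundedFormula.realize_sup, hM.realize_trans _ v y e xs hy hv hp ha]
  | _, .ex s, m, v, y, e, xs, p, a, hy, hv, hp, ha => by
    have ih : ∀ x ≤ p, (s.trans (Fin.cons (Fin.last m) fun i => (v i).castSucc)
        y.castSucc).Realize e (Fin.snoc xs (num M x)) ↔ s.RealB p (Fin.cons x a) := fun x hx =>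
      hM.realize_trans s _ _ e _ (by simpa using hy)
        (Fin.cases (by simp) fun i => by simpa using hv i) hp (Fin.cases (hx.trans hp) ha)
    simp only [trans, RealB, BoundedFormula.realize_ex, BoundedFormula.realize_inf, realize_le,
      realize_bvar, Fin.snoc_last, Fin.snoc_castSucc, hy, hM.le hp]
    constructor
    · rintro ⟨_, ⟨x, hx, rfl⟩, h⟩
      exact ⟨x, hx, (ih x hx).1 h⟩
    · rintro ⟨x, hx, h⟩
      exact ⟨_, ⟨x, hx, rfl⟩, (ih x hx).2 h⟩
  | _, .ball i s, m, v, y, e, xs, p, a, hy, hv, hp, ha => by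
    have ih : ∀ x ≤ a i, (s.trans (Fin.cons (Fin.last m) fun i => (v i).castSucc)
        y.castSucc).Realize e (Fin.snoc xs (num M x)) ↔ s.RealB p (Fin.cons x a) := fun x hx =>
      hM.realize_trans s _ _ e _ (by simpa using hy)
        (Fin.cases (by simp) fun i => by simpa using hv i) hp (Fin.cases (hx.trans (ha i)) ha)
    simp only [trans, RealB, BoundedFormula.realize_all, BoundedFormula.realize_imp, realize_le,
      realize_bvar, Fin.snoc_last, Fin.snoc_castSucc, hv, hM.le (ha i)]
    constructor
    · intro h x hx
      exact (ih x hx).1 (h _ ⟨x, hx, rfl⟩)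
    · rintro h _ ⟨x, hx, rfl⟩
      exact (ih x hx).2 (h x hx)
  | _, .rn f s, _, v, y, e, xs, p, a, hy, hv, hp, ha => by
    simp only [trans, RealB]
    exact hM.realize_trans s (v ∘ f) y e xs hy (fun i => hv (f i)) hp fun i => ha (f i)

/-- In a model of `R` the translations of `Σ`-formulas are evaluated correctly at all numerals. -/
theorem realize_trans_R (hM : RModel M) {n : ℕ} (s : SF n) {m : ℕ} (v : Fin n → Fin m) (y : Fin m)
    (e : Empty → M) (xs : Fin m → M) {p : ℕ} {a : Fin n → ℕ} (hy : xs y = num M p)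
    (hv : ∀ i, xs (v i) = num M (a i)) : (s.trans v y).Realize e xs ↔ s.RealB p a :=
  (hM.good (max p (Finset.univ.sup a))).realize_trans s v y e xs hy hv (le_max_left _ _)
    fun i => le_max_of_le_right (Finset.le_sup (Finset.mem_univ i))

end SF

/-- Relations on `ℕ` defined by `Σ`-formulas. -/
def Sig {n : ℕ} (P : (Fin n → ℕ) → Prop) : Prop := ∃ s : SF n, ∀ a, s.Real a ↔ P a

/-- Functions with a graph defined by a `Σ`-formula; the value is the first variable. -/
def SigF {n : ℕ} (f : (Fin n → ℕ) → ℕ) : Prop :=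
  Sig fun b : Fin (n + 1) → ℕ => b 0 = f (Fin.tail b)

namespace Sig
variable {n : ℕ} {P Q : (Fin n → ℕ) → Prop}

theorem of_iff (h : Sig P) (hPQ : ∀ a, Q a ↔ P a) : Sig Q :=
  h.imp fun _ hs a => (hs a).trans (hPQ a).symm

theorem and : Sig P → Sig Q → Sig fun a => P a ∧ Q a :=
  fun ⟨s, hs⟩ ⟨t, ht⟩ => ⟨.and s t, fun a => and_congr (hs a) (ht a)⟩

theorem or : Sig P → Sig Q → Sig fun a => P a ∨ Q a :=
  fun ⟨s, hs⟩ ⟨t, ht⟩ => ⟨.or s t, fun a => or_congr (hs a) (ht a)⟩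

theorem ex {P : (Fin (n + 1) → ℕ) → Prop} : Sig P → Sig fun a => ∃ x, P (Fin.cons x a) :=
  fun ⟨s, hs⟩ => ⟨.ex s, fun _ => exists_congr fun _ => hs _⟩

theorem ball {P : (Fin (n + 1) → ℕ) → Prop} (i : Fin n) :
    Sig P → Sig fun a => ∀ x ≤ a i, P (Fin.cons x a) :=
  fun ⟨s, hs⟩ => ⟨.ball i s, fun _ => forall_congr' fun _ => imp_congr Iff.rfl (hs _)⟩

theorem rn {m : ℕ} (f : Fin n → Fin m) : Sig P → Sig fun a : Fin m → ℕ => P (a ∘ f) :=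
  fun ⟨s, hs⟩ => ⟨.rn f s, fun _ => hs _⟩

/-- A function with `Σ`-definable graph may be substituted into a `Σ`-definable relation. -/
theorem bind {f : (Fin n → ℕ) → ℕ} {P : (Fin (n + 1) → ℕ) → Prop} (hf : SigF f) (hP : Sig P) :
    Sig fun a => P (Fin.cons (f a) a) :=
  (hf.and hP).ex.of_iff fun a => by simp

end Sig

namespace SigF
variable {n : ℕ} {f g h : (Fin n → ℕ) → ℕ}

theorem rn {m : ℕ} (hf : SigF f) (e : Fin n → Fin m) : SigF fun a : Fin m → ℕ => f (a ∘ e) :=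
  (Sig.rn (Fin.cons 0 fun i => (e i).succ) hf).of_iff fun _ => Iff.rfl

theorem rel₂ {P : ℕ → ℕ → Prop} (hP : Sig fun a : Fin 2 → ℕ => P (a 0) (a 1)) (hf : SigF f)
    (hg : SigF g) : Sig fun a => P (f a) (g a) := by
  have h1 : Sig fun b : Fin (n + 1) → ℕ => P (b 0) (g (Fin.tail b)) :=
    .bind (P := fun c : Fin (n + 2) → ℕ => P (c 1) (c 0)) (hg.rn Fin.succ) (hP.rn ![1, 0])
  exact .bind (P := fun b : Fin (n + 1) → ℕ => P (b 0) (g (Fin.tail b))) hf h1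

theorem rel₃ {P : ℕ → ℕ → ℕ → Prop} (hP : Sig fun a : Fin 3 → ℕ => P (a 0) (a 1) (a 2))
    (hf : SigF f) (hg : SigF g) (hh : SigF h) : Sig fun a => P (f a) (g a) (h a) := by
  have h1 : Sig fun b : Fin (n + 1) → ℕ => P (b 0) (g (Fin.tail b)) (h (Fin.tail b)) := by
    have h2 : Sig fun c : Fin (n + 2) → ℕ => P (c 1) (c 0) (h (Fin.tail (Fin.tail c))) :=
      .bind (P := fun c : Fin (n + 3) → ℕ => P (c 2) (c 1) (c 0))
        (hh.rn fun i => i.succ.succ) (hP.rn ![2, 1, 0])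
    exact .bind (P := fun c : Fin (n + 2) → ℕ => P (c 1) (c 0) (h (Fin.tail (Fin.tail c))))
      (hg.rn Fin.succ) h2
  exact .bind (P := fun b : Fin (n + 1) → ℕ => P (b 0) (g (Fin.tail b)) (h (Fin.tail b))) hf h1

end SigF

theorem sig_eq {n : ℕ} (i j : Fin n) : Sig fun a : Fin n → ℕ => a i = a j := by
  -- `x = y` holds iff `x + z = y` for some `z` with `z + z = z`.
  have : Sig fun b : Fin (n + 1) → ℕ => b 0 + b 0 = b 0 ∧ b i.succ + b 0 = b j.succ :=
    .and ⟨.add 0 0 0, fun _ => Iff.rfl⟩ ⟨.add i.succ 0 j.succ, fun _ => Iff.rfl⟩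
  exact this.ex.of_iff fun a => by simp

namespace SigF
variable {n : ℕ} {f g h : (Fin n → ℕ) → ℕ}

theorem var (i : Fin n) : SigF fun a : Fin n → ℕ => a i := sig_eq 0 i.succ

theorem eq (hf : SigF f) (hg : SigF g) : Sig fun a => f a = g a := hf.rel₂ (sig_eq 0 1) hg

theorem comp₁ {k : ℕ → ℕ} (hk : Sig fun a : Fin 2 → ℕ => a 0 = k (a 1)) (hf : SigF f) :
    SigF fun a => k (f a) :=
  rel₂ (P := fun x y => x = k y) hk (var 0) (hf.rn Fin.succ)

theorem comp₂ {k : ℕ → ℕ → ℕ} (hk : Sig fun a : Fin 3 → ℕ => a 0 = k (a 1) (a 2)) (hf : SigF f)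
    (hg : SigF g) : SigF fun a => k (f a) (g a) :=
  rel₃ (P := fun x y z => x = k y z) hk (var 0) (hf.rn Fin.succ) (hg.rn Fin.succ)

theorem add (hf : SigF f) (hg : SigF g) : SigF fun a => f a + g a :=
  comp₂ ⟨.add 1 2 0, fun _ => eq_comm⟩ hf hg

theorem mul (hf : SigF f) (hg : SigF g) : SigF fun a => f a * g a :=
  comp₂ ⟨.mul 1 2 0, fun _ => eq_comm⟩ hf hg

theorem succ (hf : SigF f) : SigF fun a => f a + 1 :=
  comp₁ (k := fun x => x + 1) ⟨.succ 1 0, fun _ => eq_comm⟩ hf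

theorem const (c : ℕ) : SigF fun _ : Fin n → ℕ => c := by
  induction c with
  | zero => exact ⟨.add 0 0 0, fun b => by simp [SF.Real]⟩
  | succ c ih => exact ih.succ

theorem le (hf : SigF f) (hg : SigF g) : Sig fun a => f a ≤ g a := by
  refine rel₂ (P := fun x y => x ≤ y) ?_ hf hg
  have : Sig fun b : Fin 3 → ℕ => b 0 + b 1 = b 2 := ((var 0).add (var 1)).eq (var 2)
  exact this.ex.of_iff fun a => ⟨fun h => ⟨a 1 - a 0, Nat.sub_add_cancel h⟩,
    fun ⟨x, (hx : x + a 0 = a 1)⟩ => hx ▸ Nat.le_add_left (a 0) x⟩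

theorem lt (hf : SigF f) (hg : SigF g) : Sig fun a => f a < g a := hf.succ.le hg

theorem pair (hf : SigF f) (hg : SigF g) : SigF fun a => Nat.pair (f a) (g a) := by
  refine comp₂ (k := Nat.pair) ?_ hf hg
  refine (((lt (var 1) (var 2)).and ((var 0).eq (((var 2).mul (var 2)).add (var 1)))).or
    ((le (var 2) (var 1)).and ((var 0).eq ((((var 1).mul (var 1)).add (var 1)).add (var 2))))).of_iff
    fun a => ?_
  rw [Nat.pair]
  split_ifs <;> omega

theorem left (hf : SigF f) : SigF fun a => (f a).unpair.1 := by
  refine comp₁ (k := fun x => x.unpair.1) ?_ hf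
  have : Sig fun b : Fin 3 → ℕ => Nat.pair (b 1) (b 0) = b 2 := ((var 1).pair (var 0)).eq (var 2)
  refine this.ex.of_iff fun a => ?_
  change _ ↔ ∃ x, Nat.pair (a 0) x = a 1
  constructor
  · intro h; exact ⟨(a 1).unpair.2, by rw [h, Nat.pair_unpair]⟩
  · rintro ⟨x, h⟩; simp [← h]

theorem right (hf : SigF f) : SigF fun a => (f a).unpair.2 := by
  refine comp₁ (k := fun x => x.unpair.2) ?_ hf
  have : Sig fun b : Fin 3 → ℕ => Nat.pair (b 0) (b 1) = b 2 := ((var 0).pair (var 1)).eq (var 2)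
  refine this.ex.of_iff fun a => ?_
  change _ ↔ ∃ x, Nat.pair x (a 0) = a 1
  constructor
  · intro h; exact ⟨(a 1).unpair.1, by rw [h, Nat.pair_unpair]⟩
  · rintro ⟨x, h⟩; simp [← h]

theorem mod_succ (hf : SigF f) (hg : SigF g) : SigF fun a => f a % (g a + 1) := by
  refine comp₂ (k := fun x y => x % (y + 1)) ?_ hf hg
  have : Sig fun b : Fin 4 → ℕ => b 1 ≤ b 3 ∧ (b 3 + 1) * b 0 + b 1 = b 2 :=
    ((var 1).le (var 3)).and ((((var 3).succ.mul (var 0)).add (var 1)).eq (var 2))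
  refine this.ex.of_iff fun a => ?_
  change _ ↔ ∃ x, a 0 ≤ a 2 ∧ (a 2 + 1) * x + a 0 = a 1
  constructor
  · intro h
    refine ⟨a 1 / (a 2 + 1), ?_, by rw [h]; exact Nat.div_add_mod _ _⟩
    have : a 1 % (a 2 + 1) < a 2 + 1 := Nat.mod_lt _ (Nat.succ_pos _)
    change a 0 = a 1 % (a 2 + 1) at h
    omega
  · rintro ⟨x, h, h'⟩
    rw [← h', Nat.mul_add_mod, Nat.mod_eq_of_lt (by omega)]

theorem beta (hf : SigF f) (hg : SigF g) : SigF fun a => Nat.beta (f a) (g a) :=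
  mod_succ hf.left (hg.succ.mul hf.right)

end SigF

/-- The `β`-function represents every finite sequence. -/
theorem exists_beta (g : ℕ → ℕ) (n : ℕ) : ∃ w, ∀ i ≤ n, Nat.beta w i = g i := by
  refine ⟨Nat.unbeta ((List.range (n + 1)).map g), fun i hi => ?_⟩
  have := Nat.beta_unbeta_coe ((List.range (n + 1)).map g) ⟨i, by simp; omega⟩
  simpa using this

/-- The graph of a partial recursive function is defined by a `Σ`-formula.  Recursion is handled by
coding the sequence of values with Gödel's `β`-function. -/
theorem sig_of_partrec {f : ℕ →. ℕ} (hf : Nat.Partrec f) :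
    Sig fun a : Fin 2 → ℕ => a 1 ∈ f (a 0) := by
  have tot : ∀ {g : ℕ → ℕ}, SigF (fun a : Fin 2 → ℕ => g (a 0)) →
      Sig fun a : Fin 2 → ℕ => a 1 ∈ (g : ℕ →. ℕ) (a 0) := fun {g} hg =>
    ((SigF.var 1).eq hg).of_iff fun a => by simp
  induction hf with
  | zero => exact tot (g := fun _ => 0) (.const 0)
  | succ => exact tot (SigF.var 0).succ
  | left => exact tot (g := fun n => n.unpair.1) (SigF.var 0).left
  | right => exact tot (g := fun n => n.unpair.2) (SigF.var 0).right
  | @pair f g _ _ ihf ihg =>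
    have : Sig fun b : Fin 4 → ℕ => (b 0 ∈ f (b 2) ∧ b 1 ∈ g (b 2)) ∧ b 3 = Nat.pair (b 0) (b 1) :=
      ((ihf.rn ![2, 0]).and (ihg.rn ![2, 1])).and ((SigF.var 3).eq ((SigF.var 0).pair (SigF.var 1)))
    refine this.ex.ex.of_iff fun a => ?_
    change _ ↔ ∃ y x, (x ∈ f (a 0) ∧ y ∈ g (a 0)) ∧ a 1 = Nat.pair x y
    have : a 1 ∈ Nat.pair <$> f (a 0) <*> g (a 0) ↔
        ∃ x ∈ f (a 0), ∃ y ∈ g (a 0), Nat.pair x y = a 1 := by simp [Seq.seq]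
    refine this.trans ⟨?_, ?_⟩
    · rintro ⟨x, hx, y, hy, h⟩
      exact ⟨y, x, ⟨hx, hy⟩, h.symm⟩
    · rintro ⟨y, x, ⟨hx, hy⟩, h⟩
      exact ⟨x, hx, y, hy, h.symm⟩
  | @comp f g _ _ ihf ihg =>
    have : Sig fun b : Fin 3 → ℕ => b 0 ∈ g (b 1) ∧ b 2 ∈ f (b 0) :=
      (ihg.rn ![1, 0]).and (ihf.rn ![0, 2])
    refine this.ex.of_iff fun a => ?_
    exact Part.mem_bind_iff
  | @prec f g _ _ ihf ihg =>
    -- `w` codes the sequence of values: its entry at `0` is a value of `f`, the later entries are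
    -- obtained with `g`, and the result is the entry at the recursion argument.
    have h1 : Sig fun b : Fin 3 → ℕ => Nat.beta (b 0) 0 ∈ f (b 1).unpair.1 :=
      (SigF.var 1).left.rel₂ (P := fun x y => y ∈ f x) ihf ((SigF.var 0).beta (.const 0))
    have h2 : Sig fun b : Fin 3 → ℕ => b 2 = Nat.beta (b 0) (b 1).unpair.2 :=
      (SigF.var 2).eq ((SigF.var 0).beta (SigF.var 1).right)
    have h3 : Sig fun c : Fin 4 → ℕ => c 0 = (c 2).unpair.2 ∨ Nat.beta (c 1) (c 0 + 1) ∈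
        g (Nat.pair (c 2).unpair.1 (Nat.pair (c 0) (Nat.beta (c 1) (c 0)))) :=
      ((SigF.var 0).eq (SigF.var 2).right).or (SigF.rel₂ (P := fun x y => y ∈ g x) ihg
        ((SigF.var 2).left.pair ((SigF.var 0).pair ((SigF.var 1).beta (SigF.var 0))))
        ((SigF.var 1).beta (SigF.var 0).succ))
    have h4 : Sig fun b : Fin 4 → ℕ => b 0 = (b 2).unpair.2 ∧
        ∀ i ≤ b 0, i = (b 2).unpair.2 ∨ Nat.beta (b 1) (i + 1) ∈
        g (Nat.pair (b 2).unpair.1 (Nat.pair i (Nat.beta (b 1) i))) :=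
      ((SigF.var 0).eq (SigF.var 2).right).and ((h3.rn ![0, 2, 3, 4]).ball 0)
    refine ((h1.and h2).and h4.ex).ex.of_iff fun a => ?_
    change _ ↔ ∃ w, (Nat.beta w 0 ∈ f (a 0).unpair.1 ∧ a 1 = Nat.beta w (a 0).unpair.2) ∧
      ∃ z, z = (a 0).unpair.2 ∧ ∀ i ≤ z, i = (a 0).unpair.2 ∨ Nat.beta w (i + 1) ∈
        g (Nat.pair (a 0).unpair.1 (Nat.pair i (Nat.beta w i)))
    generalize a 1 = y
    simp only [Nat.unpaired, exists_eq_left]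
    generalize (a 0).unpair.1 = x
    generalize (a 0).unpair.2 = n
    constructor
    · intro h
      have key : ∀ n y, y ∈ (Nat.rec (f x) (fun m IH => IH.bind fun i =>
          g (Nat.pair x (Nat.pair m i))) n : Part ℕ) → ∃ s : ℕ → ℕ, s 0 ∈ f x ∧ y = s n ∧
          ∀ i < n, s (i + 1) ∈ g (Nat.pair x (Nat.pair i (s i))) := by
        intro n
        induction n with
        | zero => exact fun y hy => ⟨fun _ => y, hy, rfl, by simp⟩
        | succ n ih =>
          intro y hy
          obtain ⟨z, hz, hy⟩ := Part.mem_bind_iff.1 hy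
          obtain ⟨s, h0, rfl, hs⟩ := ih z hz
          refine ⟨fun i => if i ≤ n then s i else y, by simpa using h0, by simp, fun i hi => ?_⟩
          rcases Nat.lt_succ_iff_lt_or_eq.1 hi with hi' | rfl
          · simpa [show i + 1 ≤ n from hi', show i ≤ n by omega] using hs i hi'
          · simpa using hy
      obtain ⟨s, h0, hy, hs⟩ := key n y h
      obtain ⟨w, hw⟩ := exists_beta s n
      refine ⟨w, ⟨by rwa [hw 0 (Nat.zero_le _)], by rw [hw n le_rfl, hy]⟩, fun i hi => ?_⟩
      rcases hi.eq_or_lt with h | h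
      · exact .inl h
      · right
        rw [hw _ hi, hw _ h]
        exact hs i h
    · rintro ⟨w, ⟨h0, rfl⟩, hs⟩
      have : ∀ m ≤ n, Nat.beta w m ∈ (Nat.rec (f x) (fun m IH => IH.bind fun i =>
          g (Nat.pair x (Nat.pair m i))) m : Part ℕ) := by
        intro m
        induction m with
        | zero => exact fun _ => h0
        | succ m ih =>
          exact fun hm => Part.mem_bind_iff.2 ⟨_, ih (by omega), (hs m (by omega)).resolve_left
            (by omega)⟩
      exact this n le_rfl
  | @rfind f _ ih =>
    -- The value `y` is a zero of `f`, and `f` has nonzero values at all `i ≤ y` with `i ≠ y`.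
    have h1 : Sig fun b : Fin 2 → ℕ => 0 ∈ f (Nat.pair (b 0) (b 1)) :=
      ((SigF.var 0).pair (SigF.var 1)).rel₂ (P := fun x y => y ∈ f x) ih (.const 0)
    have h2 : Sig fun c : Fin 3 → ℕ => c 0 = c 2 ∨ ∃ k, k + 1 ∈ f (Nat.pair (c 1) (c 0)) := by
      have : Sig fun d : Fin 4 → ℕ => d 0 + 1 ∈ f (Nat.pair (d 2) (d 1)) :=
        ((SigF.var 2).pair (SigF.var 1)).rel₂ (P := fun x y => y ∈ f x) ih (SigF.var 0).succ
      exact ((SigF.var 0).eq (SigF.var 2)).or this.ex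
    refine (h1.and (h2.ball 1)).of_iff fun a => ?_
    change _ ↔ 0 ∈ f (Nat.pair (a 0) (a 1)) ∧ ∀ m ≤ a 1, m = a 1 ∨
      ∃ k, k + 1 ∈ f (Nat.pair (a 0) m)
    refine Nat.mem_rfind.trans ?_
    simp only [Part.map_eq_map, Part.mem_map_iff, decide_eq_true_eq, decide_eq_false_iff_not]
    constructor
    · rintro ⟨⟨x, hx, rfl⟩, h⟩
      refine ⟨hx, fun m hm => or_iff_not_imp_left.2 fun hm' => ?_⟩
      obtain ⟨k, hk, hk'⟩ := h (lt_of_le_of_ne hm hm')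
      exact ⟨k - 1, by rwa [Nat.sub_add_cancel (Nat.pos_of_ne_zero hk')]⟩
    · rintro ⟨h0, h⟩
      refine ⟨⟨0, h0, rfl⟩, fun {m} hm => ?_⟩
      obtain ⟨k, hk⟩ := (h m hm.le).resolve_left hm.ne
      exact ⟨k + 1, hk, by simp⟩

/-- Recursively enumerable sets are the domains of partial recursive functions. -/
theorem exists_partrec_dom {A : Set ℕ} (hA : IsRE A) :
    ∃ f : ℕ →. ℕ, Nat.Partrec f ∧ ∀ n, n ∈ A ↔ (f n).Dom := by
  refine ⟨_, Partrec.nat_iff.1 (hA.map (Computable.const 0).to₂), fun n => ?_⟩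
  simp [Part.assert]

/-- Recursively enumerable sets are defined by `Σ`-formulas. -/
theorem sig_of_isRE {A : Set ℕ} (hA : IsRE A) : Sig fun a : Fin 1 → ℕ => a 0 ∈ A := by
  obtain ⟨f, hf, hfA⟩ := exists_partrec_dom hA
  refine ((sig_of_partrec hf).rn ![1, 0]).ex.of_iff fun a => ?_
  rw [hfA, Part.dom_iff_mem]
  rfl

end Sigma

/-! ### Representability in `R` -/

section Representability

/-- Recursively enumerable sets are defined by a single existential quantifier in front of a bounded
formula: the quantified variable bounds all existential quantifiers of a `Σ`-formula. -/
theorem exists_isBounded {A : Set ℕ} (hA : IsRE A) :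
    ∃ φ : arith.BoundedFormula Empty 2, IsBounded φ ∧ DefinesInN φ.ex A := by
  obtain ⟨s, hs⟩ := sig_of_isRE hA
  refine ⟨s.trans ![0] 1, s.isBounded_trans _ _, definesInN_ex.2 fun n => ?_⟩
  rw [show n ∈ A ↔ _ from (hs ![n]).symm, SF.real_iff]
  refine exists_congr fun y => (SF.realize_trans_R rModel_nat s _ _ _ _ (by simp) ?_).symm
  intro i; fin_cases i; simp

theorem rosser_R : Rosser R := by
  intro A B hA hB hAB
  obtain ⟨φ₀, h₀, hA⟩ := exists_isBounded hA
  obtain ⟨φ₁, h₁, hB⟩ := exists_isBounded hB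
  exact ⟨_, separatesIn_witnessLT hAB h₀ h₁ hA hB⟩

theorem cons_eq_self (a : Fin 1 → ℕ) : ![a 0] = a := by
  funext i; fin_cases i; rfl

/-- A `Σ`-definition of the set weakly represents it: true instances are provable by absoluteness of
the bounded matrix, and provable instances are true in the standard model. -/
theorem rew_R : REW R := by
  intro A hA
  obtain ⟨φ, hφ, hA⟩ := exists_isBounded hA
  refine ⟨φ.ex, fun a => ?_⟩
  refine (hA (a 0)).trans ?_
  rw [cons_eq_self]
  constructor
  · intro h
    refine provable_R_of_models fun M _ hM => ?_
    rw [Sentence.Realize, Formula.Realize, realize_atNumerals, BoundedFormula.realize_ex]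
    obtain ⟨y, hy⟩ := BoundedFormula.realize_ex.1 h
    refine ⟨num M y, ?_⟩
    rw [snoc_num, hφ.absolute hM _ Empty.elim]
    exact hy
  · intro h
    have := h.realize_nat Empty.elim default
    rw [realize_atNumerals] at this
    simpa using this

theorem rss_R : RSS R := by
  intro A hA
  obtain ⟨φ, h₁, h₂⟩ := rosser_R A Aᶜ (ComputablePred.to_re hA) (ComputablePred.to_re hA.not)
    (Set.inter_compl_self A)
  exact ⟨φ, fun a => by
    rw [← cons_eq_self a]; exact ⟨h₁ (a 0), h₂ (a 0)⟩⟩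

theorem rsw_R : RSW R := fun A hA => rew_R A (ComputablePred.to_re hA)

/-- The number coding a tuple by iterated pairing. -/
def tupleCode : ∀ {k : ℕ}, (Fin k → ℕ) → ℕ
  | 0, _ => 0
  | _ + 1, a => Nat.pair (a 0) (tupleCode (Fin.tail a))

/-- The entries of a tuple coded by iterated pairing. -/
def tupleEntry (n : ℕ) : ℕ → ℕ
  | 0 => n.unpair.1
  | i + 1 => tupleEntry n.unpair.2 i

theorem tupleEntry_tupleCode : ∀ {k : ℕ} (a : Fin k → ℕ) (i : Fin k),
    tupleEntry (tupleCode a) i = a i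
  | _ + 1, a, i => by
    refine Fin.cases ?_ (fun i => ?_) i
    · simp [tupleEntry, tupleCode]
    · simpa [tupleEntry, tupleCode, Fin.tail] using tupleEntry_tupleCode (Fin.tail a) i

theorem sigF_tupleCode : ∀ {k : ℕ}, SigF (tupleCode : (Fin k → ℕ) → ℕ)
  | 0 => .const 0
  | _ + 1 => (SigF.var 0).pair (sigF_tupleCode.rn Fin.succ)

theorem primrec_tupleEntry : ∀ i : ℕ, Primrec fun n => tupleEntry n i
  | 0 => Primrec.fst.comp Primrec.unpair
  | i + 1 => (primrec_tupleEntry i).comp (Primrec.snd.comp Primrec.unpair)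

/-- The graph of a total recursive function of `k` arguments is defined by a `Σ`-formula. -/
theorem sigF_of_computable {k : ℕ} {f : (Fin k → ℕ) → ℕ} (hf : Computable f) : SigF f := by
  have h : Computable fun n : ℕ => f fun i => tupleEntry n i :=
    hf.comp (Primrec.fin_curry.2 (Primrec.fin_curry₁.2 fun i => primrec_tupleEntry i).swap).to_comp
  have h' := SigF.rel₂ (P := fun x y => y = f fun i => tupleEntry x i)
    ((sig_of_partrec (Partrec.nat_iff.1 h)).of_iff fun a => by simp)
    (sigF_tupleCode.rn (Fin.succ : Fin k → Fin (k + 1))) (SigF.var 0)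
  refine h'.of_iff fun a => ?_
  simp only [tupleEntry_tupleCode]
  rfl

/-- Definability of functions in `R`: `y` is a value certified below some bound `p`, and it is the
only value certified below any `p' ≤ p`.  If `p` is nonstandard, then the latter clause applies to
a standard certificate of the true value. -/
theorem rfd_R : RFD R := by
  intro k f hf
  obtain ⟨s, hs⟩ := sigF_of_computable hf
  refine ⟨BoundedFormula.ex (le (bvar (Fin.last k).castSucc) (bvar (Fin.last (k + 1))) ⊓
    (s.trans (Fin.cons (Fin.last k).castSucc fun i => i.castSucc.castSucc) (Fin.last (k + 1)) ⊓
    BoundedFormula.all ((le (bvar (Fin.last (k + 2))) (bvar (Fin.last (k + 1)).castSucc)).imp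
    (BoundedFormula.all ((le (bvar (Fin.last (k + 3))) (bvar (Fin.last (k + 2)).castSucc)).imp
    ((s.trans (Fin.cons (Fin.last (k + 3)) fun i => i.castSucc.castSucc.castSucc.castSucc)
      (Fin.last (k + 2)).castSucc).imp
      (.equal (bvar (Fin.last (k + 3))) (bvar (Fin.last k).castSucc.castSucc.castSucc)))))))),
    fun a => provable_R_of_models fun M _ hM => ?_⟩
  simp only [Sentence.Realize, Formula.Realize, BoundedFormula.realize_all,
    BoundedFormula.realize_iff, realize_fsubst]
  intro y
  have hy : (fun i => ((Fin.snoc (fun i => numeral (a i)) (bvar (Fin.last 0)) :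
      Fin (k + 1) → arith.Term (Empty ⊕ Fin 1)) i).realize
      (Sum.elim (default : Empty → M) (Fin.snoc (default : Fin 0 → M) y))) =
      Fin.snoc (fun i => num M (a i)) y := by
    funext i
    refine Fin.lastCases ?_ (fun i => ?_) i
    · simp [Fin.snoc]
    · simp
  rw [hy]
  simp only [BoundedFormula.realize_ex, BoundedFormula.realize_inf, BoundedFormula.realize_all,
    BoundedFormula.realize_imp, realize_le, realize_equal, realize_bvar, realize_numeral,
    Fin.snoc_last, Fin.snoc_castSucc]
  have hf : ∀ {y}, s.Real (Fin.cons y a) ↔ y = f a := fun {y} => hs (Fin.cons y a)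
  have h₁ : ∀ {y p : ℕ}, (s.trans (Fin.cons (Fin.last k).castSucc fun i => i.castSucc.castSucc)
      (Fin.last (k + 1))).Realize default (Fin.snoc (Fin.snoc (fun i => num M (a i)) (num M y) :
      Fin (k + 1) → M) (num M p)) ↔ s.RealB p (Fin.cons y a) := fun {y p} =>
    SF.realize_trans_R hM s _ _ _ _ (by simp) (Fin.cases (by simp) fun i => by simp)
  have h₂ : ∀ {y z : M} {y' p' : ℕ},
      (s.trans (Fin.cons (Fin.last (k + 3)) fun i => i.castSucc.castSucc.castSucc.castSucc)
      (Fin.last (k + 2)).castSucc).Realize default (Fin.snoc (Fin.snoc (Fin.snoc (Fin.snoc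
      (fun i => num M (a i)) y : Fin (k + 1) → M) z : Fin (k + 2) → M) (num M p') :
      Fin (k + 3) → M) (num M y')) ↔ s.RealB p' (Fin.cons y' a) := fun {y z y' p'} =>
    SF.realize_trans_R hM s _ _ _ _ (by simp) (Fin.cases (by simp) fun i => by simp)
  obtain ⟨p, hp⟩ := SF.real_iff.1 (hf.2 rfl)
  constructor
  · rintro ⟨q, hyq, hq, h⟩
    -- The bound `q` for `y` is standard, or else it lies above the certificate `max p (f a)`.
    rcases hM.total (max p (f a)) q with hle | hle
    · obtain ⟨q, -, rfl⟩ := hM.le.1 hle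
      obtain ⟨y, -, rfl⟩ := hM.le.1 hyq
      exact congrArg _ (hf.1 (SF.real_iff.2 ⟨q, h₁.1 hq⟩))
    · exact (h _ hle (num M (f a)) (hM.le.2 ⟨_, le_max_right _ _, rfl⟩)
        (h₂.2 (hp.mono (le_max_left _ _)))).symm
  · rintro rfl
    refine ⟨num M (max p (f a)), hM.le.2 ⟨_, le_max_right _ _, rfl⟩,
      h₁.2 (hp.mono (le_max_left _ _)), fun p' hp' y' hy' h => ?_⟩
    obtain ⟨p', -, rfl⟩ := hM.le.1 hp'
    obtain ⟨y', -, rfl⟩ := hM.le.1 hy'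
    exact congrArg _ (hf.1 (SF.real_iff.2 ⟨p', h₂.1 h⟩))

end Representability

/-! ### Separation by sentences that are provable in `R` or refutable in pure logic -/

section LocalArithmetic
variable {M : Type} [arith.Structure M]

/-- Finitely many conditions on `y` that make the elements `x ≤ y` of an arbitrary structure behave
like numbers: `y` is a numeral `k̄` or lies above any given numeral, and the order and the
graphs of the operations are correct on the numerals below `y`. -/
def Rho (y : M) : Prop :=
  LE' (zr M) y ∧ (∀ x, LE' x y → x = y ∨ LE' (sc x) y) ∧ (∀ x, LE' x y → sc x ≠ zr M) ∧
  (∀ x, LE' x y → ∀ w, LE' w y → sc x = sc w → x = w) ∧ (∀ w, LE' w (zr M) ↔ w = zr M) ∧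
  (∀ x, LE' x y → ∀ w, LE' w (sc x) ↔ LE' w x ∨ w = sc x) ∧
  (∀ x, LE' x y → ∀ d, LE' d y → (ad x (zr M) = d ↔ x = d)) ∧
  (∀ x, LE' x y → ∀ d, LE' d y → ∀ w, LE' w y →
    (ad x (sc w) = d ↔ ∃ c, LE' c d ∧ sc c = d ∧ ad x w = c)) ∧
  (∀ x, LE' x y → ∀ d, LE' d y → (ml x (zr M) = d ↔ d = zr M)) ∧
  ∀ x, LE' x y → ∀ d, LE' d y → ∀ w, LE' w y →
    (ml x (sc w) = d ↔ ∃ c, LE' c d ∧ ml x w = c ∧ ad c x = d)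

/-- In a model of `R` every numeral satisfies `Rho`. -/
theorem RModel.rho (hM : RModel M) (n : ℕ) : Rho (num M n) := by
  have hs : ∀ j, sc (num M j) = num M (j + 1) := fun _ => rfl
  have h0 : zr M = num M 0 := rfl
  refine ⟨hM.le.2 ⟨0, Nat.zero_le _, rfl⟩, ?_, ?_, ?_, ?_, ?_, ?_, ?_, ?_, ?_⟩
  · rintro _ hx
    obtain ⟨j, hj, rfl⟩ := hM.le.1 hx
    rcases hj.eq_or_lt with h | h
    · exact .inl (congrArg _ h)
    · exact .inr (hM.le.2 ⟨j + 1, h, rfl⟩)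
  · rintro _ hx
    obtain ⟨j, hj, rfl⟩ := hM.le.1 hx
    rw [hs, h0, Ne, hM.inj]
    omega
  · rintro _ hx _ hw
    obtain ⟨j, hj, rfl⟩ := hM.le.1 hx
    obtain ⟨i, hi, rfl⟩ := hM.le.1 hw
    rw [hs, hs, hM.inj, hM.inj]
    omega
  · intro w
    rw [h0, hM.le]
    simp
  · rintro _ hx w
    obtain ⟨j, hj, rfl⟩ := hM.le.1 hx
    rw [hs, hM.le, hM.le]
    constructor
    · rintro ⟨i, hi, rfl⟩
      rw [hM.inj]
      rcases hi.eq_or_lt with h | h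
      · exact .inr h
      · exact .inl ⟨i, by omega, rfl⟩
    · rintro (⟨i, hi, rfl⟩ | rfl)
      · exact ⟨i, by omega, rfl⟩
      · exact ⟨j + 1, le_rfl, rfl⟩
  · rintro _ hx _ hd
    obtain ⟨j, hj, rfl⟩ := hM.le.1 hx
    obtain ⟨d, hd, rfl⟩ := hM.le.1 hd
    rw [h0, hM.add, hM.inj, hM.inj, add_zero]
  · rintro _ hx _ hd _ hw
    obtain ⟨j, hj, rfl⟩ := hM.le.1 hx
    obtain ⟨d, hd, rfl⟩ := hM.le.1 hd
    obtain ⟨i, hi, rfl⟩ := hM.le.1 hw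
    rw [hs, hM.add, hM.add, hM.inj]
    constructor
    · rintro rfl
      exact ⟨_, hM.le.2 ⟨j + i, by omega, rfl⟩, rfl, rfl⟩
    · rintro ⟨_, _, h, rfl⟩
      rw [hs, hM.inj] at h
      omega
  · rintro _ hx _ hd
    obtain ⟨j, hj, rfl⟩ := hM.le.1 hx
    obtain ⟨d, hd, rfl⟩ := hM.le.1 hd
    rw [h0, hM.mul, hM.inj, hM.inj, mul_zero, eq_comm]
  · rintro _ hx _ hd _ hw
    obtain ⟨j, hj, rfl⟩ := hM.le.1 hx
    obtain ⟨d, hd, rfl⟩ := hM.le.1 hd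
    obtain ⟨i, hi, rfl⟩ := hM.le.1 hw
    rw [hs, hM.mul, hM.mul, hM.inj]
    constructor
    · rintro rfl
      exact ⟨_, hM.le.2 ⟨j * i, Nat.mul_le_mul_left _ (Nat.le_succ i), rfl⟩, rfl,
        by rw [hM.add, Nat.mul_succ]⟩
    · rintro ⟨_, _, rfl, h⟩
      rw [hM.add, hM.inj] at h
      rw [← h, Nat.mul_succ]

namespace Rho
variable {y : M}

/-- Either `y` is a small numeral, or it lies above all small numerals. -/
theorem dichotomy (h : Rho y) (c : ℕ) :
    (∃ k < c, y = num M k ∧ ∀ j ≤ k, LE' (num M j) y) ∨ ∀ j ≤ c, LE' (num M j) y := by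
  induction c with
  | zero => exact .inr fun j hj => by obtain rfl := Nat.le_zero.1 hj; exact h.1
  | succ c ih =>
    rcases ih with ⟨k, hk, hy⟩ | ih
    · exact .inl ⟨k, by omega, hy⟩
    · rcases h.2.1 _ (ih c le_rfl) with hc | hc
      · exact .inl ⟨c, by omega, hc.symm, ih⟩
      · refine .inr fun j hj => ?_
        rcases hj.eq_or_lt with rfl | hj
        · exact hc
        · exact ih j (by omega)

variable {N : ℕ}

/-- Distinct numerals below `y` have distinct values. -/
theorem inj (h : Rho y) (hN : ∀ j ≤ N, LE' (num M j) y) :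
    ∀ {i j : ℕ}, i ≤ N → j ≤ N → num M i = num M j → i = j
  | 0, 0, _, _, _ => rfl
  | 0, j + 1, _, hj, e => absurd e.symm (h.2.2.1 _ (hN j (by omega)))
  | i + 1, 0, hi, _, e => absurd e (h.2.2.1 _ (hN i (by omega)))
  | i + 1, j + 1, hi, hj, e => by
    rw [inj h hN (i := i) (j := j) (by omega) (by omega)
      (h.2.2.2.1 _ (hN i (by omega)) _ (hN j (by omega)) e)]

/-- If all numerals up to `N` lie below `y`, then `Rho y` makes the structure correct up to `N`. -/
theorem good (h : Rho y) (hN : ∀ j ≤ N, LE' (num M j) y) : SF.Good M N := by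
  obtain ⟨h0, h1, h2, h3, h4, h5, h6, h7, h8, h9⟩ := id h
  have hle : ∀ {n x}, n ≤ N → (LE' x (num M n) ↔ ∃ j ≤ n, x = num M j) := by
    intro n x hn
    induction n with
    | zero => simpa [num] using h4 x
    | succ n ih =>
      refine (h5 _ (hN n (by omega)) x).trans ?_
      rw [ih (by omega)]
      constructor
      · rintro (⟨j, hj, rfl⟩ | rfl)
        · exact ⟨j, by omega, rfl⟩
        · exact ⟨n + 1, le_rfl, rfl⟩
      · rintro ⟨j, hj, rfl⟩
        rcases hj.eq_or_lt with rfl | hj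
        · exact .inr rfl
        · exact .inl ⟨j, by omega, rfl⟩
  have hsucc : ∀ {a b}, a ≤ N → b ≤ N → (sc (num M a) = num M b ↔ a + 1 = b) := by
    intro a b ha hb
    refine ⟨fun e => ?_, fun e => e ▸ rfl⟩
    cases b with
    | zero => exact absurd e (h2 _ (hN a ha))
    | succ b =>
      have := h3 _ (hN a ha) _ (hN b (by omega)) e
      rw [inj h hN ha (by omega) this]
  have hadd : ∀ {a b c}, a ≤ N → b ≤ N → c ≤ N →
      (ad (num M a) (num M b) = num M c ↔ a + b = c) := by
    intro a b c ha hb hc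
    induction b generalizing c with
    | zero =>
      refine (h6 _ (hN a ha) _ (hN c hc)).trans ⟨inj h hN ha hc, ?_⟩
      rintro rfl; rfl
    | succ b ih =>
      refine (h7 _ (hN a ha) _ (hN c hc) _ (hN b (by omega))).trans ⟨?_, ?_⟩
      · rintro ⟨d, hd, e, e'⟩
        obtain ⟨j, hj, rfl⟩ := (hle hc).1 hd
        have e1 := (hsucc (by omega) hc).1 e
        have e2 := (ih (by omega) (by omega)).1 e'
        omega
      · rintro rfl
        exact ⟨num M (a + b), (hle hc).2 ⟨_, by omega, rfl⟩, rfl,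
          (ih (by omega) (by omega)).2 rfl⟩
  refine ⟨hle, hsucc, hadd, ?_⟩
  intro a b c ha hb hc
  induction b generalizing c with
  | zero =>
    refine (h8 _ (hN a ha) _ (hN c hc)).trans ⟨fun e => ?_, ?_⟩
    · exact (inj h hN hc (Nat.zero_le _) e).symm
    · rintro rfl; rfl
  | succ b ih =>
    refine (h9 _ (hN a ha) _ (hN c hc) _ (hN b (by omega))).trans ⟨?_, ?_⟩
    · rintro ⟨d, hd, e, e'⟩
      obtain ⟨j, hj, rfl⟩ := (hle hc).1 hd
      have e1 := (ih (by omega) (by omega)).1 e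
      have e2 := (hadd (by omega) (by omega) hc).1 e'
      rw [Nat.mul_succ, e1, e2]
    · rintro rfl
      rw [Nat.mul_succ] at hc ⊢
      exact ⟨num M (a * b), (hle hc).2 ⟨_, by omega, rfl⟩, (ih (by omega) (by omega)).2 rfl,
        (hadd (by omega) (by omega) hc).2 rfl⟩

end Rho

/-- The formula `∀ x ≤ y, φ` for `y` the first variable. -/
def ballY {n : ℕ} (φ : arith.BoundedFormula Empty (n + 2)) : arith.BoundedFormula Empty (n + 1) :=
  BoundedFormula.all ((le (bvar (Fin.last (n + 1))) (bvar 0)).imp φ)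

theorem realize_ballY {n : ℕ} (φ : arith.BoundedFormula Empty (n + 2)) (e : Empty → M)
    (xs : Fin (n + 1) → M) : (ballY φ).Realize e xs ↔
      ∀ x, LE' x (xs 0) → φ.Realize e (Fin.snoc xs x) := by
  simp only [ballY, BoundedFormula.realize_all, BoundedFormula.realize_imp, realize_le,
    realize_bvar, Fin.snoc_last]
  exact forall_congr' fun x => imp_congr (iff_of_eq (congrArg _
    (Fin.snoc_castSucc (α := fun _ => M) x xs 0))) Iff.rfl

/-- The formula expressing `Rho` for the first variable. -/
def rho : arith.BoundedFormula Empty 2 :=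
  le (numeral 0) (bvar 0) ⊓
  (ballY ((.equal (bvar 2) (bvar 0)) ⊔ le (suc (bvar 2)) (bvar 0)) ⊓
  (ballY (BoundedFormula.not (.equal (suc (bvar 2)) (numeral 0))) ⊓
  (ballY (ballY (BoundedFormula.imp (.equal (suc (bvar 2)) (suc (bvar 3)))
    (.equal (bvar 2) (bvar 3)))) ⊓
  (BoundedFormula.all ((le (bvar 2) (numeral 0)).iff (.equal (bvar 2) (numeral 0))) ⊓
  (ballY (BoundedFormula.all ((le (bvar 3) (suc (bvar 2))).iff
    (le (bvar 3) (bvar 2) ⊔ .equal (bvar 3) (suc (bvar 2))))) ⊓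
  (ballY (ballY (BoundedFormula.iff (.equal (add (bvar 2) (numeral 0)) (bvar 3))
    (.equal (bvar 2) (bvar 3)))) ⊓
  (ballY (ballY (ballY (BoundedFormula.iff (.equal (add (bvar 2) (suc (bvar 4))) (bvar 3))
    (BoundedFormula.ex (le (bvar 5) (bvar 3) ⊓ (.equal (suc (bvar 5)) (bvar 3) ⊓
      .equal (add (bvar 2) (bvar 4)) (bvar 5))))))) ⊓
  (ballY (ballY (BoundedFormula.iff (.equal (mul (bvar 2) (numeral 0)) (bvar 3))
    (.equal (bvar 3) (numeral 0)))) ⊓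
  ballY (ballY (ballY (BoundedFormula.iff (.equal (mul (bvar 2) (suc (bvar 4))) (bvar 3))
    (BoundedFormula.ex (le (bvar 5) (bvar 3) ⊓ (.equal (mul (bvar 2) (bvar 4)) (bvar 5) ⊓
      .equal (add (bvar 5) (bvar 2)) (bvar 3)))))))))))))))

theorem realize_rho (e : Empty → M) (y x : M) : rho.Realize e ![y, x] ↔ Rho y := by
  simp only [rho, BoundedFormula.realize_inf, realize_ballY, BoundedFormula.realize_sup,
    BoundedFormula.realize_not, BoundedFormula.realize_imp, BoundedFormula.realize_all,
    BoundedFormula.realize_iff, BoundedFormula.realize_ex, realize_le, realize_equal, realize_suc,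
    realize_add, realize_mul, realize_numeral, realize_bvar]
  exact Iff.rfl

/-- The formula `y ≠ 0 ∧ ⋯ ∧ y ≠ u - 1` for `y` the first variable. -/
def notBelow : ℕ → arith.BoundedFormula Empty 2
  | 0 => BoundedFormula.not .falsum
  | u + 1 => notBelow u ⊓ BoundedFormula.not (.equal (bvar 0) (numeral u))

theorem realize_notBelow (u : ℕ) (e : Empty → M) (xs : Fin 2 → M) :
    (notBelow u).Realize e xs ↔ ∀ i < u, xs 0 ≠ num M i := by
  induction u with
  | zero => simp [notBelow]; exact id
  | succ u ih =>
    simp only [notBelow, BoundedFormula.realize_inf, ih, BoundedFormula.realize_not, realize_equal,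
      realize_bvar, realize_numeral, Nat.forall_lt_succ_right, Ne]

/-- The sentence `∃ y x, x = ū ∧ y ≠ 0, …, u - 1 ∧ Θ(y, x)`.  The inequalities ensure that `u ≤ k` if
`y` is the numeral `k̄`, also in structures that violate the axioms of `R`. -/
def instSentence (Θ : arith.BoundedFormula Empty 2) (u : ℕ) : arith.Sentence :=
  BoundedFormula.ex (n := 0) (BoundedFormula.ex
    (.equal (bvar 1) (numeral u) ⊓ (notBelow u ⊓ Θ)))

theorem realize_instSentence (Θ : arith.BoundedFormula Empty 2) (u : ℕ) :
    (instSentence Θ u).Realize M ↔ ∃ y, (∀ i < u, y ≠ num M i) ∧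
      Θ.Realize (default : Empty → M) ![y, num M u] := by
  simp only [Sentence.Realize, Formula.Realize, instSentence, BoundedFormula.realize_ex,
    BoundedFormula.realize_inf, realize_equal, realize_bvar, realize_numeral, realize_notBelow]
  have : ∀ y x : M, Fin.snoc (Fin.snoc (default : Fin 0 → M) y : Fin 1 → M) x = ![y, x] := by
    intro y x
    funext i; fin_cases i <;> rfl
  simp only [this]
  constructor
  · rintro ⟨y, x, rfl, h⟩
    exact ⟨y, h⟩
  · rintro ⟨y, h⟩
    exact ⟨y, _, rfl, h⟩

/-- Disjoint recursively enumerable sets are separated by sentences that are provable in `R` for the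
members of the first set and refutable in pure logic for the members of the second. -/
theorem exists_separating {A B : Set ℕ} (hA : IsRE A) (hB : IsRE B) (hAB : A ∩ B = ∅) :
    ∃ Θ : arith.BoundedFormula Empty 2,
      (∀ u ∈ A, Provable R (n := 0) (instSentence Θ u)) ∧
      ∀ u ∈ B, ∀ (M : Type) [arith.Structure M], ¬(instSentence Θ u).Realize M := by
  obtain ⟨s, hs⟩ := sig_of_isRE hA
  obtain ⟨t, ht⟩ := sig_of_isRE hB
  have hdis : ∀ n, n ∈ A → n ∉ B := fun n h h' => (Set.ext_iff.1 hAB n).1 ⟨h, h'⟩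
  have hs : ∀ u, u ∈ A ↔ ∃ p, s.RealB p ![u] := fun u => (hs ![u]).symm.trans SF.real_iff
  have ht : ∀ u, u ∈ B ↔ ∃ p, t.RealB p ![u] := fun u => (ht ![u]).symm.trans SF.real_iff
  -- `Θ(y, x)` says that `y` behaves like a number and bounds a witness of `x ∈ A`, while no `z ≤ y`
  -- bounds a witness of `x ∈ B`.
  let Θ : arith.BoundedFormula Empty 2 := rho ⊓ (s.trans ![1] 0 ⊓
    ballY (BoundedFormula.not (t.trans ![1] 2)))
  have hΘ : ∀ (M : Type) [arith.Structure M] (y x : M), Θ.Realize (default : Empty → M) ![y, x] ↔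
      Rho y ∧ (s.trans ![1] 0).Realize (default : Empty → M) ![y, x] ∧
      ∀ z, LE' z y → ¬(t.trans ![1] 2).Realize (default : Empty → M) ![y, x, z] := by
    intro M _ y x
    simp only [Θ, BoundedFormula.realize_inf, realize_rho, realize_ballY,
      BoundedFormula.realize_not]
    refine and_congr Iff.rfl (and_congr Iff.rfl (forall_congr' fun z => imp_congr Iff.rfl
      (not_congr (iff_of_eq (congrArg _ ?_)))))
    funext i; fin_cases i <;> rfl
  refine ⟨Θ, fun u hu => provable_R_of_models fun M _ hM => ?_, fun u hu M _ => ?_⟩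
  · rw [realize_instSentence]
    obtain ⟨p, hp⟩ := (hs u).1 hu
    refine ⟨num M (max p u), fun i hi e => ?_, (hΘ _ _ _).2 ⟨hM.rho _, ?_, fun z hz h => ?_⟩⟩
    · have := hM.inj.1 e
      omega
    · refine (SF.realize_trans_R hM s _ _ _ _ (p := max p u) rfl ?_).2 (hp.mono (le_max_left _ _))
      intro i; fin_cases i; rfl
    · obtain ⟨j, -, rfl⟩ := hM.le.1 hz
      refine hdis u hu ((ht u).2 ⟨j, (SF.realize_trans_R hM t _ _ _ _ (p := j) rfl ?_).1 h⟩)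
      intro i; fin_cases i; rfl
  · rw [realize_instSentence]
    rintro ⟨y, hy, h⟩
    obtain ⟨hr, h₁, h₂⟩ := (hΘ _ _ _).1 h
    obtain ⟨p, hp⟩ := (ht u).1 hu
    rcases hr.dichotomy (max p u) with ⟨k, -, rfl, hk⟩ | hk
    · -- `y` is a numeral `k̄` with `u ≤ k`, and it witnesses `u ∈ A`.
      have huk : u ≤ k := not_lt.1 fun h => hy k h rfl
      refine hdis u ((hs u).2 ⟨k, ((hr.good hk).realize_trans s _ _ _ _ (p := k) rfl ?_ le_rfl
        ?_).1 h₁⟩) hu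
      · intro i; fin_cases i; rfl
      · intro i; fin_cases i; exact huk
    · -- `y` lies above a witness of `u ∈ B`.
      refine h₂ _ (hk _ le_rfl) (((hr.good hk).realize_trans t _ _ _ _ (p := max p u) rfl ?_ le_rfl
        ?_).2 (hp.mono (le_max_left _ _)))
      · intro i; fin_cases i; rfl
      · intro i; fin_cases i; exact le_max_right _ _

end LocalArithmetic

/-! ### Gödel numbers, races of computations, and undecidability -/

section Codes
variable {L : FirstOrder.Language.{0, 0}} [∀ k, Encodable (L.Functions k)]

theorem termCode_injective {n : ℕ} :
    Function.Injective (termCode : L.Term (Empty ⊕ Fin n) → ℕ) := by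
  intro t
  induction t using term_cases with
  | hv i =>
    intro s h
    induction s using term_cases with
    | hv j =>
      simp only [termCode, Nat.pair_eq_pair, true_and] at h
      rw [Fin.ext h]
    | hf g ss => simp [termCode, Nat.pair_eq_pair] at h
  | hf f ts ih =>
    intro s h
    induction s using term_cases with
    | hv j => simp [termCode, Nat.pair_eq_pair] at h
    | hf g ss =>
      simp only [termCode, Nat.pair_eq_pair, true_and] at h
      obtain ⟨rfl, h1, h2⟩ := h
      obtain rfl := Encodable.encode_injective h1
      congr 1
      funext i
      exact ih i (congrFun (List.ofFn_injective (Encodable.encode_injective h2)) i)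

/-- The code of an implication. -/
def cImp (a b : ℕ) : ℕ := Nat.pair 3 (Nat.pair a b)

/-- The code of a negation. -/
def cNot (a : ℕ) : ℕ := cImp a (Nat.pair 0 0)

/-- The code of an equation. -/
def cEq (a b : ℕ) : ℕ := Nat.pair 1 (Nat.pair a b)

theorem primrec_cImp : Primrec₂ cImp :=
  Primrec₂.natPair.comp₂ (Primrec₂.const 3) Primrec₂.natPair

theorem primrec_cNot : Primrec cNot := primrec_cImp.comp .id (.const _)

theorem primrec_cEq : Primrec₂ cEq :=
  Primrec₂.natPair.comp₂ (Primrec₂.const 1) Primrec₂.natPair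

theorem primrec_termCode_numeral (ι : arith →ᴸ L) {n : ℕ} :
    Primrec fun u => termCode (ι.onTerm (numeral u : arith.Term (Empty ⊕ Fin n))) := by
  have h : Primrec (Nat.rec (termCode (ι.onTerm (numeral 0 : arith.Term (Empty ⊕ Fin n))))
      fun _ x : ℕ => Nat.pair 1 (Nat.pair 1 (Nat.pair
        (Encodable.encode (ι.onFunction (n := 1) ArithFunc.succ)) (Encodable.encode [x])))) := by
    refine Primrec.nat_rec₁ _ ?_
    refine Primrec₂.natPair.comp₂ (.const 1) (Primrec₂.natPair.comp₂ (.const 1)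
      (Primrec₂.natPair.comp₂ (.const _) ?_))
    exact (Primrec.encode.comp (Primrec.list_cons.comp .id (.const []))).comp₂ Primrec₂.right
  refine h.of_eq fun u => ?_
  induction u with
  | zero => rfl
  | succ u ih =>
    simp only at ih ⊢
    rw [ih]
    rfl

variable [∀ k, Encodable (L.Relations k)]

theorem code_injective : ∀ {n : ℕ} {φ ψ : L.BoundedFormula Empty n}, code φ = code ψ → φ = ψ
  | _, .falsum, ψ, h => by
    cases ψ <;> simp [code, Nat.pair_eq_pair] at h ⊢
  | _, .equal t s, ψ, h => by
    cases ψ <;> simp [code, Nat.pair_eq_pair] at h ⊢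
    exact ⟨termCode_injective h.1, termCode_injective h.2⟩
  | _, .rel R ts, ψ, h => by
    cases ψ <;> simp only [code, Nat.pair_eq_pair, OfNat.ofNat_ne_zero, OfNat.ofNat_ne_one,
      Nat.reduceEqDiff, false_and, true_and] at h
    obtain ⟨rfl, h1, h2⟩ := h
    obtain rfl := Encodable.encode_injective h1
    congr 1
    funext i
    exact termCode_injective (congrFun (List.ofFn_injective (Encodable.encode_injective h2)) i)
  | _, .imp φ₁ φ₂, ψ, h => by
    cases ψ <;> simp [code, Nat.pair_eq_pair] at h ⊢
    exact ⟨code_injective h.1, code_injective h.2⟩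
  | _, .all φ, ψ, h => by
    cases ψ <;> simp [code, Nat.pair_eq_pair] at h ⊢
    exact code_injective h

theorem code_mem_provableCodes {T : L.Theory} {φ : L.Sentence} :
    code φ ∈ provableCodes T ↔ Provable T (n := 0) φ :=
  ⟨fun ⟨_, h, e⟩ => code_injective e ▸ h, fun h => ⟨φ, h, rfl⟩⟩

theorem code_mem_refutableCodes {T : L.Theory} {φ : L.Sentence} :
    code φ ∈ refutableCodes T ↔ Provable T (BoundedFormula.not φ) :=
  ⟨fun ⟨_, h, e⟩ => code_injective e ▸ h, fun h => ⟨φ, h, rfl⟩⟩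

theorem code_not {n : ℕ} (φ : L.BoundedFormula Empty n) : code φ.not = cNot (code φ) := rfl

theorem primrec_code_instSentence (ι : arith →ᴸ L) (Θ : arith.BoundedFormula Empty 2) :
    Primrec fun u => code (ι.onSentence (instSentence Θ u)) := by
  have hn : Primrec fun u => code (ι.onBoundedFormula (notBelow u)) := by
    have h : Primrec (Nat.rec (code (ι.onBoundedFormula (notBelow 0))) fun u x : ℕ =>
        cNot (cImp x (cNot (cNot (cEq (Nat.pair 0 0)
          (termCode (ι.onTerm (numeral u : arith.Term (Empty ⊕ Fin 2))))))))) := by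
      refine Primrec.nat_rec₁ _ (primrec_cNot.comp₂ (primrec_cImp.comp₂ Primrec₂.right
        (primrec_cNot.comp₂ (primrec_cNot.comp₂ (primrec_cEq.comp₂ (.const _)
        ((primrec_termCode_numeral ι).comp₂ Primrec₂.left))))))
    refine h.of_eq fun u => ?_
    induction u with
    | zero => rfl
    | succ u ih =>
      simp only at ih ⊢
      rw [ih]
      rfl
  have h : Primrec fun u => cNot (Nat.pair 4 (cNot (cNot (Nat.pair 4 (cNot
      (cNot (cImp (cEq (Nat.pair 0 1) (termCode (ι.onTerm (numeral u : arith.Term (Empty ⊕ Fin 2)))))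
        (cNot (cNot (cImp (code (ι.onBoundedFormula (notBelow u)))
          (cNot (code (ι.onBoundedFormula Θ)))))))))))))  := by
    have hall : Primrec (Nat.pair 4) := Primrec₂.natPair.comp (.const 4) .id
    have h1 := primrec_cNot.comp (primrec_cNot.comp
      (primrec_cImp.comp hn (.const (cNot (code (ι.onBoundedFormula Θ))))))
    have h2 := primrec_cNot.comp (primrec_cImp.comp
      (primrec_cEq.comp (.const (Nat.pair 0 1)) (primrec_termCode_numeral ι (n := 2))) h1)
    exact primrec_cNot.comp (hall.comp (primrec_cNot.comp (primrec_cNot.comp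
      (hall.comp (primrec_cNot.comp h2)))))
  exact h.of_eq fun u => rfl

end Codes

section Recursion
open Nat.Partrec (Code)

/-- Membership in `W` is recursively enumerable in the element and the index. -/
theorem rePred_mem_W {f g : ℕ → ℕ} (hf : Computable f) (hg : Computable g) :
    REPred fun u => f u ∈ W (g u) :=
  (Code.eval_part.comp ((Computable.ofNat Code).comp hg) hf).dom_re

theorem _root_.REPred.comp' {p : ℕ → Prop} (hp : REPred p) {f : ℕ → ℕ} (hf : Computable f) :
    REPred fun n => p (f n) := Partrec.comp hp hf

theorem computable_unpair_snd : Computable fun u : ℕ => u.unpair.2 :=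
  Computable.snd.comp Computable.unpair

/-- The recursively enumerable set of those `u = ⟨e, x⟩` at which the `e`-th partial recursive
function takes the value `k`. -/
def valSet (k : ℕ) : Set ℕ := {u | k ∈ (Denumerable.ofNat Code u.unpair.1).eval u}

theorem isRE_valSet (k : ℕ) : IsRE (valSet k) := by
  have h1 : Partrec fun u : ℕ => (Denumerable.ofNat Code u.unpair.1).eval u :=
    Code.eval_part.comp ((Computable.ofNat Code).comp (Computable.fst.comp Computable.unpair)) .id
  have h2 : Computable fun x : ℕ => if x = k then some () else none :=
    (Primrec.ite (Primrec.eq.comp .id (.const k)) (.const _) (.const _)).to_comp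
  refine (h1.bind (h2.ofOption.comp Computable.snd).to₂).dom_re.of_eq fun u => ?_
  rw [valSet, Set.mem_ofPred_eq, Part.dom_iff_mem]
  constructor
  · rintro ⟨y, hy⟩
    obtain ⟨x, hx, hy⟩ := Part.mem_bind_iff.1 hy
    by_cases h : x = k
    · exact h ▸ hx
    · simp [h] at hy
  · intro h
    exact ⟨(), Part.mem_bind_iff.2 ⟨k, h, by simp⟩⟩

theorem valSet_disjoint : valSet 0 ∩ valSet 1 = ∅ :=
  Set.eq_empty_of_forall_notMem fun _ h => absurd (Part.mem_unique h.1 h.2) zero_ne_one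

/-- For recursively enumerable `p` and `q` there is a program `e` that searches, on input
`u = ⟨e, x⟩`, for the first confirmation of `p u` or `q u`, with output `0` or `1`. -/
theorem exists_race {p q : ℕ → Prop} (hp : REPred p) (hq : REPred q) :
    ∃ e, ∀ x, p (Nat.pair e x) ∨ q (Nat.pair e x) →
      p (Nat.pair e x) ∧ Nat.pair e x ∈ valSet 0 ∨ q (Nat.pair e x) ∧ Nat.pair e x ∈ valSet 1 := by
  obtain ⟨f, hf, H⟩ := Partrec.merge' (hp.map (Computable.const 0).to₂)
    (hq.map (Computable.const 1).to₂)
  obtain ⟨c, rfl⟩ := Code.exists_code.1 (Partrec.nat_iff.1 hf)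
  refine ⟨Encodable.encode c, fun x hx => ?_⟩
  generalize hu : Nat.pair (Encodable.encode c) x = u at *
  have hc : Denumerable.ofNat Code u.unpair.1 = c := by rw [← hu]; simp
  obtain ⟨h1, h2⟩ := H u
  have hd : (c.eval u).Dom := h2.2 (by simpa [Part.assert] using hx)
  obtain ⟨y, hy⟩ := Part.dom_iff_mem.1 hd
  rcases h1 y hy with h | h
  · simp at h
    exact .inl ⟨h.1, by rw [valSet, Set.mem_ofPred_eq, hc]; rwa [← h.2] at hy⟩
  · simp at h
    exact .inr ⟨h.1, by rw [valSet, Set.mem_ofPred_eq, hc]; rwa [← h.2] at hy⟩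

theorem SetTuringReducible.of_manyOne {A B : Set ℕ} {f : ℕ → ℕ} (hf : Computable f)
    (h : ∀ n, n ∈ A ↔ f n ∈ B) : SetTuringReducible A B := by
  classical
  refine RecursiveIn.iff_nat.2 ?_
  have h1 : Nat.RecursiveIn {charFn B} (charFn B) := .oracle _ rfl
  have h2 : Nat.RecursiveIn {charFn B} (f : ℕ →. ℕ) := (Partrec.nat_iff.1 hf).recursiveIn
  refine (h1.comp h2).of_eq fun n => ?_
  refine (Part.bind_some _ _).trans ?_
  simp [charFn, h]

theorem isRE_haltingSet : IsRE haltingSet := rePred_mem_W .id .id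

/-- Every recursively enumerable set is many-one reducible to the halting set. -/
theorem setTuringReducible_haltingSet {A : Set ℕ} (hA : IsRE A) :
    SetTuringReducible A haltingSet := by
  obtain ⟨f, hf, hfA⟩ := exists_partrec_dom hA
  obtain ⟨c, rfl⟩ := Code.exists_code.1 hf
  -- A program that on any input runs `c` on `n`.
  refine .of_manyOne (f := fun n => Encodable.encode (Code.comp c (Code.const n)))
    (Primrec.encode.comp (Code.primrec₂_comp.comp (.const c) Code.primrec_const)).to_comp fun n => ?_
  rw [hfA, haltingSet, Set.mem_ofPred_eq, W, Set.mem_ofPred_eq]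
  simp only [Denumerable.ofNat_encode, Code.eval, Code.eval_const]
  exact iff_of_eq (congrArg Part.Dom (Part.bind_some _ _).symm)

end Recursion

section Undecidability
variable {L : FirstOrder.Language.{0, 0}}

theorem extends_id (T : L.Theory) : Extends (LHom.id L) T T := by
  refine ⟨⟨fun {_} _ _ h => h, fun {_} _ _ h => h⟩, fun φ h => ?_⟩
  have : (LHom.id L).onSentence φ = φ := congrFun LHom.id_onBoundedFormula φ
  rwa [this]

theorem Consistent.not_both {T : L.Theory} (hT : Consistent T) {φ : L.Sentence}
    (h : Provable T (n := 0) φ) (h' : Provable T (BoundedFormula.not φ)) : False :=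
  hT (.mp h' h)

theorem SubTheory.of_extends_id {T S : L.Theory} (h : SubTheory T S) : Extends (LHom.id L) T S :=
  ⟨(extends_id T).1, fun φ hφ => by
    have : (LHom.id L).onSentence φ = φ := congrFun LHom.id_onBoundedFormula φ
    rw [this]
    exact h φ hφ⟩

variable [∀ k, Encodable (L.Functions k)]
  [∀ k, Encodable (L.Relations k)]

/-- In an extension `S` of `R` there is a recursive sequence of sentences such that for any
recursively enumerable `p` and `q` there are infinitely many, uniformly given, `u` such that, if
`p u` or `q u` holds, then one of the following happens: `p u` holds and `S` proves the `u`-th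
sentence, or `q u` holds and pure logic refutes it. -/
theorem exists_race_sentences {ι : arith →ᴸ L} {S : L.Theory} (hS : Extends ι R S) :
    ∃ g : ℕ → L.Sentence, Computable (fun u => code (g u)) ∧
      ∀ {p q : ℕ → Prop}, REPred p → REPred q → ∃ e, ∀ x,
        p (Nat.pair e x) ∨ q (Nat.pair e x) →
        p (Nat.pair e x) ∧ Provable S (n := 0) (g (Nat.pair e x)) ∨
        q (Nat.pair e x) ∧ ∀ U : L.Theory, Provable U (BoundedFormula.not (g (Nat.pair e x))) := by
  obtain ⟨Θ, h0, h1⟩ := exists_separating (isRE_valSet 0) (isRE_valSet 1) valSet_disjoint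
  refine ⟨fun u => ι.onSentence (instSentence Θ u), (primrec_code_instSentence ι Θ).to_comp,
    fun {p q} hp hq => (exists_race hp hq).imp fun e he x hx => ?_⟩
  rcases he x hx with h | h
  · exact .inl ⟨h.1, hS.2 _ (h0 _ h.2)⟩
  · refine .inr ⟨h.1, fun U => .of_models fun M _ _ _ => ?_⟩
    let := ι.reduct M
    exact fun h' => h1 _ h.2 M ((LHom.realize_onSentence M ι _).1 h')

/-- Every recursively enumerable set is many-one reducible to the set of theorems of any consistent
recursively enumerable extension of `R`. -/
theorem setTuringReducible_provableCodes {ι : arith →ᴸ L} {S : L.Theory} (hS : Extends ι R S)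
    (hcon : Consistent S) (hre : IsRETheory S) {C : Set ℕ} (hC : IsRE C) :
    SetTuringReducible C (provableCodes S) := by
  obtain ⟨g, hg, H⟩ := exists_race_sentences hS
  -- If `x ∈ C` is confirmed first, then `S` proves the sentence; if a proof in `S` is found first,
  -- then the sentence is refutable, and `S` is inconsistent.
  obtain ⟨e, he⟩ := H (REPred.comp' hC computable_unpair_snd) (REPred.comp' hre hg)
  refine .of_manyOne (f := fun x => code (g (Nat.pair e x)))
    (hg.comp (Primrec₂.natPair.comp (.const e) .id).to_comp) fun x => ?_
  have he := he x
  simp only [Nat.unpair_pair] at he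
  constructor
  · intro hx
    rcases he (.inl hx) with h | h
    · exact code_mem_provableCodes.2 h.2
    · exact h.1
  · intro hx
    rcases he (.inr hx) with h | h
    · exact h.1
    · exact (hcon.not_both (code_mem_provableCodes.1 hx) (h.2 S)).elim

/-- For a decidable sub-theory `U` of `S`, the search for confirmations of `U` refutes the sentence
and of `U` does not refute the sentence leads to a contradiction in either case. -/
theorem ehu_R : EHU R := by
  intro L' _ _ ι S hS hcon _ U hU hdec
  obtain ⟨g, hg, H⟩ := exists_race_sentences hS
  have hX : ComputablePred fun u => cNot (code (g u)) ∈ provableCodes U :=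
    ComputablePred.computable_iff.2 (by
      obtain ⟨f, hf, h⟩ := ComputablePred.computable_iff.1 hdec
      exact ⟨fun u => f (cNot (code (g u))), hf.comp (primrec_cNot.to_comp.comp hg),
        funext fun u => congrFun h _⟩)
  obtain ⟨e, he⟩ := H hX.to_re hX.not.to_re
  rcases he 0 (em _) with ⟨h, h'⟩ | ⟨h, h'⟩
  · rw [← code_not, code_mem_provableCodes] at h
    exact hcon.not_both h' (hU _ h)
  · rw [← code_not, code_mem_provableCodes] at h
    exact h (h' U)

/-- The function is given by the race between `W j`, whose victory makes the sentence provable, and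
`W i`, whose victory makes it refutable. -/
theorem ei_R : EI R := by
  obtain ⟨g, hg, H⟩ := exists_race_sentences (extends_id R)
  have h1 : Computable fun u : ℕ => u.unpair.2.unpair.1 :=
    Computable.fst.comp (Computable.unpair.comp computable_unpair_snd)
  have h2 : Computable fun u : ℕ => u.unpair.2.unpair.2 :=
    computable_unpair_snd.comp computable_unpair_snd
  obtain ⟨e, he⟩ := H (rePred_mem_W hg h2) (rePred_mem_W hg h1)
  refine ⟨fun i j => code (g (Nat.pair e (Nat.pair i j))),
    hg.comp (Primrec₂.natPair.comp (.const e) Primrec₂.natPair).to_comp, fun i j hi hj hij hmem => ?_⟩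
  have he := he (Nat.pair i j)
  simp only [Nat.unpair_pair] at he
  have hdis : ∀ {n}, n ∈ W i → n ∉ W j := fun {n} h h' => (Set.ext_iff.1 hij n).1 ⟨h, h'⟩
  rcases he hmem.symm with h | h
  · exact hdis (hi (code_mem_provableCodes.2 h.2)) h.1
  · exact hdis h.1 (hj (code_mem_refutableCodes.2 (h.2 R)))

theorem ri_R : RI R := by
  rintro ⟨X, hX, hP, hR⟩
  obtain ⟨g, hg, H⟩ := exists_race_sentences (extends_id R)
  obtain ⟨e, he⟩ := H ((ComputablePred.to_re (ComputablePred.not hX)).comp' hg)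
    ((ComputablePred.to_re hX).comp' hg)
  rcases he 0 (em' _) with h | h
  · exact h.1 (hP (code_mem_provableCodes.2 h.2))
  · exact (Set.ext_iff.1 hR _).1 ⟨h.1, code_mem_refutableCodes.2 (h.2 R)⟩

theorem eu_R : EU R := fun S hS hcon hre =>
  ehu_R arith (LHom.id arith) S (SubTheory.of_extends_id hS) hcon hre S fun _ h => h

/-- Productivity is given by the race between `W i`, whose victory makes the sentence provable, and
the set of theorems, whose victory makes it refutable: by consistency, neither can happen. -/
theorem creative_R (hre : IsRETheory R) : Creative R := by
  refine ⟨hre, ?_⟩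
  obtain ⟨g, hg, H⟩ := exists_race_sentences (extends_id R)
  obtain ⟨e, he⟩ := H (rePred_mem_W hg computable_unpair_snd) (hre.comp' hg)
  refine ⟨fun i => code (g (Nat.pair e i)),
    hg.comp (Primrec₂.natPair.comp (.const e) .id).to_comp, fun i hi => ?_⟩
  have he := he i
  simp only [Nat.unpair_pair] at he
  have : ¬(code (g (Nat.pair e i)) ∈ W i ∨ code (g (Nat.pair e i)) ∈ provableCodes R) := by
    intro h
    rcases he h with h | h
    · exact hi h.1 (code_mem_provableCodes.2 h.2)
    · exact consistent_R.not_both (code_mem_provableCodes.1 h.1) (h.2 R)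
  rw [not_or] at this
  exact ⟨this.2, this.1⟩

theorem tp_R (hre : IsRETheory R) : TP R :=
  ⟨eu_R R (fun _ h => h) consistent_R hre, fun _ _ _ _ _ hS hcon hre' =>
    setTuringReducible_provableCodes hS hcon hre' hre⟩

theorem zeroJump_R (hre : IsRETheory R) : ZeroJump R :=
  ⟨setTuringReducible_haltingSet hre,
    setTuringReducible_provableCodes (extends_id R) consistent_R hre isRE_haltingSet⟩

end Undecidability

/-! ### Recursive enumerability of the consequences of Horn clauses -/

section Horn

/-- Patterns for natural numbers. -/
inductive Pat : Type
  | var (i : ℕ) : Pat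
  | const (c : ℕ) : Pat
  | succ (p : Pat) : Pat
  | pair (p q : Pat) : Pat

/-- The number denoted by a pattern when the variables have the values `e`. -/
def Pat.eval (e : ℕ → ℕ) : Pat → ℕ
  | .var i => e i
  | .const c => c
  | .succ p => p.eval e + 1
  | .pair p q => Nat.pair (p.eval e) (q.eval e)

/-- A Horn clause: the premises and the conclusion. -/
abbrev Clause : Type := List Pat × Pat

/-- Derivability of numbers from a set of Horn clauses. -/
inductive Derives {ι : Type} (C : ι → Clause) : ℕ → Prop
  | mk (r : ι) (e : ℕ → ℕ) (h : ∀ q ∈ (C r).1, Derives C (q.eval e)) : Derives C ((C r).2.eval e)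

/-- A bound for the variables of a pattern. -/
def Pat.bound : Pat → ℕ
  | .var i => i + 1
  | .const _ => 0
  | .succ p => p.bound
  | .pair p q => max p.bound q.bound

theorem Pat.eval_congr {e e' : ℕ → ℕ} : ∀ {p : Pat}, (∀ i < p.bound, e i = e' i) →
    p.eval e = p.eval e'
  | .var i, h => h i (Nat.lt_succ_self i)
  | .const _, _ => rfl
  | .succ p, h => by simp only [eval, eval_congr (p := p) h]
  | .pair p q, h => by
    simp only [eval, eval_congr (p := p) fun i hi => h i (lt_max_of_lt_left hi),
      eval_congr (p := q) fun i hi => h i (lt_max_of_lt_right hi)]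

theorem Pat.primrec_eval : ∀ q : Pat, Primrec fun p => q.eval (tupleEntry p)
  | .var i => primrec_tupleEntry i
  | .const c => .const c
  | .succ q => Primrec.succ.comp q.primrec_eval
  | .pair q r => Primrec₂.natPair.comp q.primrec_eval r.primrec_eval

/-- Every valuation agrees on finitely many variables with one coded by a number. -/
theorem exists_tupleEntry (e : ℕ → ℕ) (n : ℕ) : ∃ p, ∀ i < n, tupleEntry p i = e i :=
  ⟨tupleCode fun i : Fin n => e i, fun i hi => tupleEntry_tupleCode (fun i : Fin n => e i) ⟨i, hi⟩⟩

/-- The list `l` contains the instances of the given patterns, at the positions coded by `ts`. -/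
def Check (l : List (Option ℕ)) (p : ℕ) : List Pat → ℕ → Prop
  | [], _ => True
  | q :: qs, ts => l.getD ts.unpair.1 none = some (q.eval (tupleEntry p)) ∧
      Check l p qs ts.unpair.2

instance (l : List (Option ℕ)) (p : ℕ) : ∀ (qs : List Pat) (ts : ℕ), Decidable (Check l p qs ts)
  | [], _ => inferInstanceAs (Decidable True)
  | _ :: qs, _ => have := instDecidableCheck l p qs; inferInstanceAs (Decidable (_ ∧ _))

/-- The conclusion of an instance of the `s`-th clause if its premises are found in `l`. -/
def applyClause (l : List (Option ℕ)) (p ts : ℕ) : List Clause → ℕ → Option ℕ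
  | [], _ => none
  | c :: cs, s => if s = 0 then
      (if Check l p c.1 ts then some (c.2.eval (tupleEntry p)) else none)
    else applyClause l p ts cs (s - 1)

/-- The result of the derivation with code `l.length`, given the results of the derivations with
smaller codes. -/
def derivStep (cs : List Clause) (l : List (Option ℕ)) : Option ℕ :=
  let n := l.length - 1
  applyClause l n.unpair.2.unpair.1 n.unpair.2.unpair.2 cs n.unpair.1

/-- The results of the derivations with codes less than `n`. -/
def derivList (cs : List Clause) : ℕ → List (Option ℕ)
  | 0 => []
  | n + 1 => derivList cs n ++ [derivStep cs (derivList cs n)]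

theorem derivList_eq (cs : List Clause) (n : ℕ) :
    derivList cs n = (List.range n).map fun t => derivStep cs (derivList cs t) := by
  induction n with
  | zero => rfl
  | succ n ih => rw [derivList, List.range_succ, List.map_append, ← ih]; rfl

theorem primrecPred_check (qs : List Pat) :
    PrimrecPred fun x : List (Option ℕ) × ℕ × ℕ => Check x.1 x.2.1 qs x.2.2 := by
  induction qs with
  | nil => exact (Primrec.eq.comp (.const 0) (.const 0)).of_eq fun _ => by simp [Check]
  | cons q qs ih =>
    have h1 : Primrec fun x : List (Option ℕ) × ℕ × ℕ => x.2.2.unpair :=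
      Primrec.unpair.comp (Primrec.snd.comp Primrec.snd)
    have h2 : Primrec fun x : List (Option ℕ) × ℕ × ℕ => x.2.1 := Primrec.fst.comp Primrec.snd
    refine PrimrecPred.and (Primrec.eq.comp
      ((Primrec.list_getD none).comp Primrec.fst (Primrec.fst.comp h1))
      (Primrec.option_some.comp (q.primrec_eval.comp h2))) ?_
    exact ih.comp (Primrec.fst.pair (h2.pair (Primrec.snd.comp h1)))

theorem primrec_applyClause (cs : List Clause) :
    Primrec fun x : (List (Option ℕ) × ℕ × ℕ) × ℕ => applyClause x.1.1 x.1.2.1 x.1.2.2 cs x.2 := by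
  induction cs with
  | nil => exact .const none
  | cons c cs ih =>
    refine Primrec.ite (Primrec.eq.comp Primrec.snd (.const 0)) ?_
      (ih.comp (Primrec.fst.pair (Primrec.pred.comp Primrec.snd)))
    refine Primrec.ite ((primrecPred_check c.1).comp Primrec.fst) ?_ (.const none)
    exact Primrec.option_some.comp (c.2.primrec_eval.comp
      (Primrec.fst.comp (Primrec.snd.comp Primrec.fst)))

/-- The result of a derivation is computed by course-of-values recursion. -/
theorem primrec_deriv (cs : List Clause) : Primrec fun t => derivStep cs (derivList cs t) := by
  have hs : Primrec (derivStep cs) := by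
    have h1 : Primrec fun l : List (Option ℕ) => (l.length - 1).unpair :=
      Primrec.unpair.comp (Primrec.pred.comp Primrec.list_length)
    have h2 : Primrec fun l : List (Option ℕ) => (l.length - 1).unpair.2.unpair :=
      Primrec.unpair.comp (Primrec.snd.comp h1)
    exact (primrec_applyClause cs).comp ((Primrec.id.pair ((Primrec.fst.comp h2).pair
      (Primrec.snd.comp h2))).pair (Primrec.fst.comp h1))
  have := Primrec.nat_strong_rec (α := Unit) (fun _ t => derivStep cs (derivList cs t))
    (g := fun _ l => some (derivStep cs l)) (Primrec.option_some.comp (hs.comp Primrec.snd)).to₂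
    fun _ n => by rw [← derivList_eq]
  exact this.comp (.const ()) .id

theorem derivList_getD {cs : List Clause} {t i n : ℕ} :
    (derivList cs t).getD i none = some n ↔
      i < t ∧ derivStep cs (derivList cs i) = some n := by
  rw [derivList_eq cs t]
  by_cases h : i < t
  · simp [h]
  · simp [h]

/-- Derivations are coded by numbers: `⟨s, p, ts⟩` codes an application of the `s`-th clause with the
variables coded by `p`, whose premises are the results of the derivations coded by `ts`. -/
theorem exists_deriv_iff {ι : Type} [Finite ι] (C : ι → Clause) :
    ∃ cs : List Clause, ∀ n, Derives C n ↔ ∃ t, derivStep cs (derivList cs t) = some n := by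
  have := Fintype.ofFinite ι
  have hmem : ∀ c, c ∈ (Finset.univ.toList.map C) ↔ ∃ r, C r = c := fun c => by simp
  generalize Finset.univ.toList.map C = cs at hmem
  refine ⟨cs, fun n => ⟨fun h => ?_, fun ⟨t, ht⟩ => ?_⟩⟩
  · induction h with
    | mk r e h ih =>
      obtain ⟨p, hp⟩ := exists_tupleEntry e
        (max (C r).2.bound (((C r).1.map Pat.bound).foldr max 0))
      have hb : ∀ q ∈ (C r).1, q.eval (tupleEntry p) = q.eval e := by
        intro q hq
        refine Pat.eval_congr fun i hi => hp i (lt_max_of_lt_right (hi.trans_le ?_))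
        have := hq
        generalize (C r).1 = qs at this
        induction qs with
        | nil => simp at this
        | cons a qs ihq =>
          rcases List.mem_cons.1 this with rfl | h
          · exact le_max_left _ _
          · exact (ihq h).trans (le_max_right _ _)
      have hts : ∃ ts, ∀ t > ts, Check (derivList cs t) p (C r).1 ts := by
        generalize (C r).1 = qs at ih hb
        induction qs with
        | nil => exact ⟨0, fun _ _ => trivial⟩
        | cons q qs ihq =>
          obtain ⟨ts, hts⟩ := ihq (fun q hq => ih q (List.mem_cons_of_mem _ hq))
            (fun q hq => hb q (List.mem_cons_of_mem _ hq))
          obtain ⟨u, hu⟩ := ih q List.mem_cons_self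
          refine ⟨Nat.pair u ts, fun t ht => ⟨?_, ?_⟩⟩
          · rw [Nat.unpair_pair, derivList_getD, hb q List.mem_cons_self]
            exact ⟨(Nat.left_le_pair u ts).trans_lt ht, hu⟩
          · rw [Nat.unpair_pair]
            exact hts t ((Nat.right_le_pair u ts).trans_lt ht)
      obtain ⟨ts, hts⟩ := hts
      have hs : ∃ s, ∀ l, applyClause l p ts cs s =
          if Check l p (C r).1 ts then some ((C r).2.eval (tupleEntry p)) else none := by
        have := (hmem (C r)).2 ⟨r, rfl⟩
        clear hmem hts ih
        induction cs with
        | nil => simp at this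
        | cons c cs ih =>
          by_cases hc : C r = c
          · exact ⟨0, fun l => by simp [applyClause, hc]⟩
          · obtain ⟨s, hs⟩ := ih ((List.mem_cons.1 this).resolve_left hc)
            exact ⟨s + 1, fun l => by simp [applyClause, hs]⟩
      obtain ⟨s, hs⟩ := hs
      refine ⟨Nat.pair s (Nat.pair p ts) + 1, ?_⟩
      have hl : (derivList cs (Nat.pair s (Nat.pair p ts) + 1)).length - 1 =
          Nat.pair s (Nat.pair p ts) := by rw [derivList_eq]; simp
      rw [derivStep, hl]
      simp only [Nat.unpair_pair]
      rw [hs, if_pos (hts _ (Nat.lt_succ_of_le ((Nat.right_le_pair p ts).trans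
        (Nat.right_le_pair s _)))), Pat.eval_congr fun i hi => hp i (lt_max_of_lt_left hi)]
  · induction t using Nat.strong_induction_on generalizing n with
    | _ t ih =>
      rw [derivStep] at ht
      have key : ∀ (ds : List Clause) (s p ts : ℕ), (∀ c ∈ ds, ∃ r, C r = c) →
          applyClause (derivList cs t) p ts ds s = some n → Derives C n := by
        intro ds
        induction ds with
        | nil => intro s p ts _ h; simp [applyClause] at h
        | cons c ds ihd =>
          intro s p ts hd h
          rw [applyClause] at h
          split_ifs at h with h1 h2
          · obtain ⟨r, rfl⟩ := hd c List.mem_cons_self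
            rw [← Option.some_inj.1 h]
            refine .mk r _ ?_
            generalize (C r).1 = qs at h2
            clear h
            induction qs generalizing ts with
            | nil => simp
            | cons q qs ihq =>
              refine List.forall_mem_cons.2 ⟨?_, ihq _ h2.2⟩
              obtain ⟨h3, h4⟩ := derivList_getD.1 h2.1
              exact ih _ h3 _ ⟨_, h4⟩ h4
          · exact ihd _ _ _ (fun c hc => hd c (List.mem_cons_of_mem _ hc)) h
      exact key cs _ _ _ (fun c hc => (hmem c).1 hc) ht

/-- The set of numbers derivable from finitely many Horn clauses is recursively enumerable. -/
theorem isRE_derives {ι : Type} [Finite ι] (C : ι → Clause) : REPred (Derives C) := by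
  obtain ⟨cs, hcs⟩ := exists_deriv_iff C
  have h : Computable₂ fun n t : ℕ => decide (derivStep cs (derivList cs t) = some n) :=
    (Primrec.eq.comp ((primrec_deriv cs).comp Primrec.snd)
      (Primrec.option_some.comp Primrec.fst)).decide.to_comp
  refine (Partrec.rfind h.partrec₂).dom_re.of_eq fun n => ?_
  rw [hcs, Nat.rfind_dom']
  simp

end Horn

/-! ### Horn clauses for provability in `R` -/

section Calculus

/-- Types with pairing and successor operations and literals: this lets Gödel numbers and patterns
for them be written down by the same expressions. -/
class Pairing (α : Type) where
  lit : ℕ → α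
  succ : α → α
  pair : α → α → α

instance : Pairing ℕ := ⟨id, Nat.succ, Nat.pair⟩

instance : Pairing Pat := ⟨.const, .succ, .pair⟩

open Pairing

variable {α : Type} [Pairing α]

/-- The code of the variable `x_i`. -/
def encVar (i : α) : α := pair (lit 0) i

/-- The code of an application of the `k`-ary function symbol with number `f` to the list `ts`. -/
def encFun (k f ts : α) : α := pair (lit 1) (pair k (pair f ts))

/-- The code of `0`. -/
def encZero : α := encFun (lit 0) (lit 0) (lit 0)

/-- The code of `S t`. -/
def encSucc (t : α) : α := encFun (lit 1) (lit 0) (succ (pair t (lit 0)))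

/-- The code of `s + t`. -/
def encAdd (s t : α) : α := encFun (lit 2) (lit 0) (succ (pair s (succ (pair t (lit 0)))))

/-- The code of `s · t`. -/
def encMul (s t : α) : α := encFun (lit 2) (lit 1) (succ (pair s (succ (pair t (lit 0)))))

/-- The code of `⊥`. -/
def encFalsum : α := pair (lit 0) (lit 0)

/-- The code of `s = t`. -/
def encEqual (s t : α) : α := pair (lit 1) (pair s t)

/-- The code of an implication. -/
def encImp (a b : α) : α := pair (lit 3) (pair a b)

/-- The code of a universal formula. -/
def encAll (a : α) : α := pair (lit 4) a

/-- The code of a negation, which is an implication of `⊥`. -/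
def encNot (a : α) : α := encImp a encFalsum

/-- The code of an existential formula `¬∀ ¬φ`. -/
def encEx (a : α) : α := encNot (encAll (encNot a))

/-- The code of the formula `s ≤ t` in one free variable; the bound variable is `x_1`. -/
def encLe (s t : α) : α := encEx (encEqual (encAdd (encVar (lit 1)) s) t)

/-- The code of the renaming `x_i ↦ x_i` for `i < a` and `x_i ↦ x_{i + k}` for `i ≥ a`. -/
def ins (a k : α) : α := pair (lit 0) (pair a k)

/-- The code of the substitution `x_i ↦ x_i` for `i < n`, `x_n ↦ t` and
`x_{i + 1} ↦ x_i` for `i ≥ n`. -/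
def sub (n t : α) : α := pair (lit 1) (pair n t)

/-- The judgment that `a + b = c`. -/
def jAdd (a b c : α) : α := pair (lit 0) (pair a (pair b c))

/-- The judgment that `a * b = c`. -/
def jMul (a b c : α) : α := pair (lit 1) (pair a (pair b c))

/-- The judgment that `t` is the code of the numeral of `a`. -/
def jNum (a t : α) : α := pair (lit 2) (pair a t)

/-- The judgment that the substitution `p` maps `x_i` to `t`. -/
def jVar (p i t : α) : α := pair (lit 3) (pair p (pair i t))

/-- The judgment that `t` codes a term in `m` variables, which the substitution `p` maps to `t'`. -/
def jTerm (p m t t' : α) : α := pair (lit 4) (pair p (pair m (pair t t')))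

/-- The judgment that `f` codes a formula in `m` variables, which the substitution `p` maps to
`f'`. -/
def jForm (p m f f' : α) : α := pair (lit 5) (pair p (pair m (pair f f')))

/-- The judgment that `f` codes the formula `x = 0 ∨ ⋯ ∨ x = n`. -/
def jEqUpTo (n f : α) : α := pair (lit 6) (pair n f)

/-- The judgment that `f` codes an axiom of `R`. -/
def jAxiom (f : α) : α := pair (lit 7) f

/-- The judgment that `f` codes a formula in `n` variables provable in `R`. -/
def jProv (n f : α) : α := pair (lit 8) (pair n f)

/-- Names of the rules for arithmetic of numbers, numerals, substitution into terms and formulas, the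
axioms of `R`, and the calculus. -/
inductive Rule : Type
  | addZero | addSucc | mulZero | mulSucc | numZero | numSucc
  | insLt | insGe | subLt | subEq | subGt
  | termVar | termZero | termSucc | termAdd | termMul
  | formFalsum | formEqual | formImp | formAll
  | eqUpToZero | eqUpToSucc | ax1 | ax2 | ax3 | ax3' | ax4 | ax5
  | ax | impIntro | impDistrib | dne | allElim | allImp | eqRefl | eqSubst | nonempty | mp | gen
  deriving DecidableEq

-- The left inverse `Rule.ofNat` of `Rule.ctorIdx` comes with the derived decidable equality.
instance : Finite Rule :=
  .of_injective (β := Fin 39) (fun r => ⟨r.ctorIdx, by cases r <;> decide⟩) fun a b h => by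
    rw [← Rule.ofNat_ctorIdx a, ← Rule.ofNat_ctorIdx b, Fin.mk.inj h]

/-- Horn clauses for provability in `R`, with the values or variables `x i`.  A premise
`jAdd (succ i) j n` expresses `i < n`, and a premise `jForm (ins (lit 0) (lit 0)) n f f'` about the
identical substitution expresses that `f` codes a formula in `n` variables. -/
def clause (x : ℕ → α) : Rule → List α × α
  | .addZero => ([], jAdd (x 0) (lit 0) (x 0))
  | .addSucc => ([jAdd (x 0) (x 1) (x 2)], jAdd (x 0) (succ (x 1)) (succ (x 2)))
  | .mulZero => ([], jMul (x 0) (lit 0) (lit 0))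
  | .mulSucc => ([jMul (x 0) (x 1) (x 2), jAdd (x 2) (x 0) (x 3)], jMul (x 0) (succ (x 1)) (x 3))
  | .numZero => ([], jNum (lit 0) encZero)
  | .numSucc => ([jNum (x 0) (x 1)], jNum (succ (x 0)) (encSucc (x 1)))
  | .insLt => ([jAdd (succ (x 0)) (x 1) (x 2)], jVar (ins (x 2) (x 3)) (x 0) (encVar (x 0)))
  | .insGe => ([jAdd (x 0) (x 1) (x 2), jAdd (x 2) (x 3) (x 4)],
      jVar (ins (x 0) (x 3)) (x 2) (encVar (x 4)))
  | .subLt => ([jAdd (succ (x 0)) (x 1) (x 2)], jVar (sub (x 2) (x 3)) (x 0) (encVar (x 0)))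
  | .subEq => ([], jVar (sub (x 0) (x 1)) (x 0) (x 1))
  | .subGt => ([jAdd (x 0) (x 1) (x 2)], jVar (sub (x 0) (x 3)) (succ (x 2)) (encVar (x 2)))
  | .termVar => ([jVar (x 0) (x 1) (x 2), jAdd (succ (x 1)) (x 3) (x 4)],
      jTerm (x 0) (x 4) (encVar (x 1)) (x 2))
  | .termZero => ([], jTerm (x 0) (x 1) encZero encZero)
  | .termSucc => ([jTerm (x 0) (x 1) (x 2) (x 3)],
      jTerm (x 0) (x 1) (encSucc (x 2)) (encSucc (x 3)))
  | .termAdd => ([jTerm (x 0) (x 1) (x 2) (x 3), jTerm (x 0) (x 1) (x 4) (x 5)],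
      jTerm (x 0) (x 1) (encAdd (x 2) (x 4)) (encAdd (x 3) (x 5)))
  | .termMul => ([jTerm (x 0) (x 1) (x 2) (x 3), jTerm (x 0) (x 1) (x 4) (x 5)],
      jTerm (x 0) (x 1) (encMul (x 2) (x 4)) (encMul (x 3) (x 5)))
  | .formFalsum => ([], jForm (x 0) (x 1) encFalsum encFalsum)
  | .formEqual => ([jTerm (x 0) (x 1) (x 2) (x 3), jTerm (x 0) (x 1) (x 4) (x 5)],
      jForm (x 0) (x 1) (encEqual (x 2) (x 4)) (encEqual (x 3) (x 5)))
  | .formImp => ([jForm (x 0) (x 1) (x 2) (x 3), jForm (x 0) (x 1) (x 4) (x 5)],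
      jForm (x 0) (x 1) (encImp (x 2) (x 4)) (encImp (x 3) (x 5)))
  | .formAll => ([jForm (x 0) (succ (x 1)) (x 2) (x 3)],
      jForm (x 0) (x 1) (encAll (x 2)) (encAll (x 3)))
  | .eqUpToZero => ([jNum (lit 0) (x 0)], jEqUpTo (lit 0) (encEqual (encVar (lit 0)) (x 0)))
  | .eqUpToSucc => ([jEqUpTo (x 0) (x 1), jNum (succ (x 0)) (x 2)],
      jEqUpTo (succ (x 0)) (encImp (encNot (x 1)) (encEqual (encVar (lit 0)) (x 2))))
  | .ax1 => ([jNum (x 0) (x 1), jNum (x 2) (x 3), jNum (x 4) (x 5), jAdd (x 0) (x 2) (x 4)],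
      jAxiom (encEqual (encAdd (x 1) (x 3)) (x 5)))
  | .ax2 => ([jNum (x 0) (x 1), jNum (x 2) (x 3), jNum (x 4) (x 5), jMul (x 0) (x 2) (x 4)],
      jAxiom (encEqual (encMul (x 1) (x 3)) (x 5)))
  | .ax3 => ([jNum (x 0) (x 1), jNum (x 2) (x 3), jAdd (succ (x 0)) (x 4) (x 2)],
      jAxiom (encNot (encEqual (x 1) (x 3))))
  | .ax3' => ([jNum (x 0) (x 1), jNum (x 2) (x 3), jAdd (succ (x 0)) (x 4) (x 2)],
      jAxiom (encNot (encEqual (x 3) (x 1))))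
  | .ax4 => ([jNum (x 0) (x 1), jEqUpTo (x 0) (x 2)],
      jAxiom (encAll (encImp (encLe (encVar (lit 0)) (x 1)) (x 2))))
  | .ax5 => ([jNum (x 0) (x 1)],
      jAxiom (encAll (encImp (encNot (encLe (encVar (lit 0)) (x 1))) (encLe (x 1) (encVar (lit 0))))))
  | .ax => ([jAxiom (x 0), jForm (ins (lit 0) (x 1)) (lit 0) (x 0) (x 2)], jProv (x 1) (x 2))
  | .impIntro => ([jForm (ins (lit 0) (lit 0)) (x 0) (x 1) (x 2),
        jForm (ins (lit 0) (lit 0)) (x 0) (x 3) (x 4)],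
      jProv (x 0) (encImp (x 1) (encImp (x 3) (x 1))))
  | .impDistrib => ([jForm (ins (lit 0) (lit 0)) (x 0) (x 1) (x 2),
        jForm (ins (lit 0) (lit 0)) (x 0) (x 3) (x 4),
        jForm (ins (lit 0) (lit 0)) (x 0) (x 5) (x 6)],
      jProv (x 0) (encImp (encImp (x 1) (encImp (x 3) (x 5)))
        (encImp (encImp (x 1) (x 3)) (encImp (x 1) (x 5)))))
  | .dne => ([jForm (ins (lit 0) (lit 0)) (x 0) (x 1) (x 2)],
      jProv (x 0) (encImp (encNot (encNot (x 1))) (x 1)))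
  | .allElim => ([jTerm (ins (lit 0) (lit 0)) (x 0) (x 1) (x 2),
        jForm (sub (x 0) (x 1)) (succ (x 0)) (x 3) (x 4)],
      jProv (x 0) (encImp (encAll (x 3)) (x 4)))
  | .allImp => ([jForm (ins (x 0) (lit 1)) (x 0) (x 1) (x 2),
        jForm (ins (lit 0) (lit 0)) (succ (x 0)) (x 3) (x 4)],
      jProv (x 0) (encImp (encAll (encImp (x 2) (x 3))) (encImp (x 1) (encAll (x 3)))))
  | .eqRefl => ([jTerm (ins (lit 0) (lit 0)) (x 0) (x 1) (x 2)], jProv (x 0) (encEqual (x 1) (x 1)))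
  | .eqSubst => ([jTerm (ins (lit 0) (lit 0)) (x 0) (x 1) (x 2),
        jTerm (ins (lit 0) (lit 0)) (x 0) (x 3) (x 4),
        jForm (sub (x 0) (x 1)) (succ (x 0)) (x 5) (x 6),
        jForm (sub (x 0) (x 3)) (succ (x 0)) (x 5) (x 7)],
      jProv (x 0) (encImp (encEqual (x 1) (x 3)) (encImp (x 6) (x 7))))
  | .nonempty => ([], jProv (x 0) (encEx (encEqual (encVar (x 0)) (encVar (x 0)))))
  | .mp => ([jProv (x 0) (encImp (x 1) (x 2)), jProv (x 0) (x 1)], jProv (x 0) (x 2))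
  | .gen => ([jProv (succ (x 0)) (x 1)], jProv (x 0) (encAll (x 1)))

/-- Derivability of codes of judgments. -/
def Holds : ℕ → Prop := Derives (clause Pat.var)

/-- All members of the list satisfy `P`. -/
def AllTrue (P : ℕ → Prop) : List ℕ → Prop
  | [] => True
  | n :: l => P n ∧ AllTrue P l

theorem allTrue_map {P : ℕ → Prop} {e : ℕ → ℕ} {qs : List Pat} :
    AllTrue P (qs.map (Pat.eval e)) ↔ ∀ q ∈ qs, P (q.eval e) := by
  induction qs with
  | nil => simp [AllTrue]
  | cons q qs ih => rw [List.map_cons, AllTrue, ih, List.forall_mem_cons]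

/-- The numerical clauses are the instances of the clauses with patterns. -/
theorem eval_clause (e : ℕ → ℕ) (r : Rule) :
    (clause Pat.var r).1.map (Pat.eval e) = (clause e r).1 ∧
      (clause Pat.var r).2.eval e = (clause e r).2 := by
  have h1 (n : ℕ) : Pat.eval e (lit n) = lit n := rfl
  have h2 (p : Pat) : Pat.eval e (succ p) = succ (p.eval e) := rfl
  have h3 (p q : Pat) : Pat.eval e (pair p q) = pair (p.eval e) (q.eval e) := rfl
  have h4 (i : ℕ) : Pat.eval e (.var i) = e i := rfl
  cases r <;> simp only [clause, List.map_nil, List.map_cons, h1, h2, h3, h4, encVar, encFun,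
    encZero, encSucc, encAdd, encMul, encFalsum, encEqual, encImp, encAll, encNot, encEx, encLe,
    ins, sub, jAdd, jMul, jNum, jVar, jTerm, jForm, jEqUpTo, jAxiom, jProv, and_self]

theorem Holds.rule (r : Rule) (l : List ℕ) (h : AllTrue Holds (clause (fun i => l.getD i 0) r).1) :
    Holds (clause (fun i => l.getD i 0) r).2 := by
  rw [← (eval_clause _ r).1] at h
  rw [← (eval_clause _ r).2]
  exact .mk r _ (allTrue_map.1 h)

theorem Holds.sound {P : ℕ → Prop} (hP : ∀ r e, AllTrue P (clause e r).1 → P (clause e r).2)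
    {n : ℕ} (h : Holds n) : P n := by
  induction h with
  | mk r e _ ih =>
    rw [(eval_clause e r).2]
    refine hP r e ?_
    rw [← (eval_clause e r).1]
    exact allTrue_map.2 ih

theorem isRE_holds : REPred Holds := isRE_derives _

section Agree

-- Definitional unfolding has to stop at `Nat.pair`, since it would otherwise evaluate codes.
attribute [local irreducible] Nat.pair

variable {n : ℕ}

theorem termCode_bvar (i : Fin n) :
    termCode (bvar i : arith.Term (Empty ⊕ Fin n)) = encVar (i : ℕ) := rfl

theorem termCode_tlift (t : arith.Term (Empty ⊕ Fin n)) : termCode (tlift t) = termCode t := by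
  induction t using term_cases with
  | hv i => rfl
  | hf f ts ih =>
    simp only [tlift] at ih
    simp only [tlift, tsubst_func, termCode, ih]

theorem termCode_numeral {m n : ℕ} (a : ℕ) :
    termCode (numeral a : arith.Term (Empty ⊕ Fin n)) =
      termCode (numeral a : arith.Term (Empty ⊕ Fin m)) := by
  induction a with
  | zero => rfl
  | succ a ih => exact congrArg encSucc ih

theorem code_eqUpTo_zero :
    code (eqUpTo 0) = encEqual (encVar 0) (termCode (numeral 0 : arith.Term (Empty ⊕ Fin 1))) := rfl

theorem code_eqUpTo_succ (k : ℕ) : code (eqUpTo (k + 1)) = encImp (encNot (code (eqUpTo k)))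
    (encEqual (encVar 0) (termCode (numeral (k + 1) : arith.Term (Empty ⊕ Fin 1)))) := rfl

theorem code_le (s t : arith.Term (Empty ⊕ Fin 1)) :
    code (le s t) = encLe (termCode s) (termCode t) := by
  have h : termCode (add (bvar (Fin.last 1)) (tlift s)) =
      encAdd (encVar 1) (termCode (tlift s)) := rfl
  rw [le, BoundedFormula.ex, code_not, code, code_not, code, h, termCode_tlift, termCode_tlift]
  rfl

theorem exists_of_code_eq_imp {φ : arith.BoundedFormula Empty n} {a b : ℕ}
    (h : code φ = encImp a b) : ∃ ψ χ, φ = .imp ψ χ ∧ code ψ = a ∧ code χ = b := by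
  cases φ <;> simp [code, encImp, Pairing.pair, Pairing.lit, Nat.pair_eq_pair] at h
  exact ⟨_, _, rfl, h⟩

end Agree

end Calculus

/-! ### Correctness of the Horn clauses -/

-- As above, codes must not be evaluated.
attribute [local irreducible] Nat.pair

section Soundness

/-- The relation `Q i t` between indices of variables and codes of terms describes the substitution
`σ`, and goes on as a renaming that remains correct under quantifiers. -/
def Compat (Q : ℕ → ℕ → Prop) {m n : ℕ} (σ : Fin m → arith.Term (Empty ⊕ Fin n)) : Prop :=
  (∀ i : Fin m, Q i (termCode (σ i))) ∧ ∀ j, Q (m + j) (encVar (n + j))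

variable {Q : ℕ → ℕ → Prop} {m n : ℕ}

theorem Compat.up {σ : Fin m → arith.Term (Empty ⊕ Fin n)} (h : Compat Q σ) : Compat Q (up σ) := by
  refine ⟨fun i => ?_, fun j => ?_⟩
  · induction i using Fin.lastCases with
    | last => rw [up_last]; exact h.2 0
    | cast i => rw [up_castSucc, termCode_tlift]; exact h.1 i
  · rw [add_assoc, add_assoc]
    exact h.2 (1 + j)

/-- `Q` describes the renaming `x_i ↦ x_i` for `i < a` and `x_i ↦ x_{i + k}` for `i ≥ a`. -/
def IsIns (Q : ℕ → ℕ → Prop) (a k : ℕ) : Prop :=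
  (∀ i < a, Q i (encVar i)) ∧ ∀ j, Q (a + j) (encVar (a + j + k))

/-- `Q` describes the substitution of the term with code `t` for `x_n`. -/
def IsSub (Q : ℕ → ℕ → Prop) (n t : ℕ) : Prop :=
  (∀ i < n, Q i (encVar i)) ∧ Q n t ∧ ∀ j, Q (n + j + 1) (encVar (n + j))

theorem IsIns.id (h : IsIns Q 0 0) :
    Compat Q fun i : Fin n => (bvar i : arith.Term (Empty ⊕ Fin n)) := by
  have h' : ∀ i, Q i (encVar i) := fun i => by simpa using h.2 i
  exact ⟨fun i => h' i, fun j => h' _⟩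

theorem IsIns.lift (h : IsIns Q n 1) :
    Compat Q fun i : Fin n => (bvar i.castSucc : arith.Term (Empty ⊕ Fin (n + 1))) :=
  ⟨fun i => h.1 i i.2, fun j => by simpa only [add_right_comm] using h.2 j⟩

theorem IsIns.shift (h : IsIns Q 0 n) :
    Compat Q fun i : Fin 0 => (i.elim0 : arith.Term (Empty ⊕ Fin n)) :=
  ⟨fun i => i.elim0, fun j => by simpa only [zero_add, add_comm n j] using h.2 j⟩

theorem IsSub.inst {t : arith.Term (Empty ⊕ Fin n)} (h : IsSub Q n (termCode t)) :
    Compat Q (Fin.snoc (fun i => bvar i) t : Fin (n + 1) → arith.Term (Empty ⊕ Fin n)) := by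
  refine ⟨fun i => ?_, fun j => ?_⟩
  · induction i using Fin.lastCases with
    | last => rw [Fin.snoc_last]; exact h.2.1
    | cast i => rw [Fin.snoc_castSucc]; exact h.1 i i.2
  · rw [add_right_comm]
    exact h.2.2 j

/-- The code of the term that the substitution coded by `p` puts for `x_i`. -/
def substVal (p i : ℕ) : ℕ :=
  let a := p.unpair.2.unpair.1
  let b := p.unpair.2.unpair.2
  if p.unpair.1 = 0 then encVar (if i < a then i else i + b)
  else if i < a then encVar i else if i = a then b else encVar (i - 1)

theorem substVal_ins (a k i : ℕ) :
    substVal (ins a k) i = encVar (if i < a then i else i + k) := by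
  simp [substVal, ins, Pairing.pair, Pairing.lit]

theorem substVal_sub (a t i : ℕ) :
    substVal (sub a t) i = if i < a then encVar i else if i = a then t else encVar (i - 1) := by
  simp [substVal, sub, Pairing.pair, Pairing.lit]

theorem isIns_substVal (a k : ℕ) : IsIns (fun i t => t = substVal (ins a k) i) a k :=
  ⟨fun i h => by simp [substVal_ins, h], fun j => by simp [substVal_ins]⟩

theorem isSub_substVal (a t : ℕ) : IsSub (fun i u => u = substVal (sub a t) i) a t :=
  ⟨fun i h => by simp [substVal_sub, h], by simp [substVal_sub], fun j => by
    simp only [substVal_sub]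
    rw [if_neg (by omega), if_neg (by omega), Nat.add_sub_cancel]⟩

/-- The meaning of the judgment `jTerm p m t t'`. -/
def TermMeaning (p m t t' : ℕ) : Prop :=
  ∃ τ : arith.Term (Empty ⊕ Fin m), termCode τ = t ∧
    ∀ {n : ℕ} {σ : Fin m → arith.Term (Empty ⊕ Fin n)},
      Compat (fun i u => u = substVal p i) σ → termCode (tsubst σ τ) = t'

/-- The meaning of the judgment `jForm p m f f'`. -/
def FormMeaning (p m f f' : ℕ) : Prop :=
  ∃ φ : arith.BoundedFormula Empty m, code φ = f ∧
    ∀ {n : ℕ} {σ : Fin m → arith.Term (Empty ⊕ Fin n)},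
      Compat (fun i u => u = substVal p i) σ → code (fsubst σ φ) = f'

/-- The meaning of the judgment `jProv n f`. -/
def ProvMeaning (n f : ℕ) : Prop :=
  ∃ φ : arith.BoundedFormula Empty n, Provable R φ ∧ code φ = f

/-- The meaning of a judgment. -/
def Meaning (j : ℕ) : Prop :=
  let x := j.unpair.2
  match j.unpair.1 with
  | 0 => x.unpair.1 + x.unpair.2.unpair.1 = x.unpair.2.unpair.2
  | 1 => x.unpair.1 * x.unpair.2.unpair.1 = x.unpair.2.unpair.2
  | 2 => x.unpair.2 = termCode (numeral x.unpair.1 : arith.Term (Empty ⊕ Fin 0))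
  | 3 => x.unpair.2.unpair.2 = substVal x.unpair.1 x.unpair.2.unpair.1
  | 4 => TermMeaning x.unpair.1 x.unpair.2.unpair.1 x.unpair.2.unpair.2.unpair.1
      x.unpair.2.unpair.2.unpair.2
  | 5 => FormMeaning x.unpair.1 x.unpair.2.unpair.1 x.unpair.2.unpair.2.unpair.1
      x.unpair.2.unpair.2.unpair.2
  | 6 => x.unpair.2 = code (eqUpTo x.unpair.1)
  | 7 => ∃ φ, RAxiom φ ∧ code φ = x
  | _ => ProvMeaning x.unpair.1 x.unpair.2

section
variable {a b c p i t t' f f' : ℕ}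

theorem meaning_add : Meaning (jAdd a b c) ↔ a + b = c := by
  simp [Meaning, jAdd, Pairing.pair, Pairing.lit]

theorem meaning_mul : Meaning (jMul a b c) ↔ a * b = c := by
  simp [Meaning, jMul, Pairing.pair, Pairing.lit]

theorem meaning_num : Meaning (jNum a t) ↔
    t = termCode (numeral a : arith.Term (Empty ⊕ Fin 0)) := by
  simp [Meaning, jNum, Pairing.pair, Pairing.lit]

theorem meaning_var : Meaning (jVar p i t) ↔ t = substVal p i := by
  simp [Meaning, jVar, Pairing.pair, Pairing.lit]

theorem meaning_term : Meaning (jTerm p m t t') ↔ TermMeaning p m t t' := by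
  simp [Meaning, jTerm, Pairing.pair, Pairing.lit]

theorem meaning_form : Meaning (jForm p m f f') ↔ FormMeaning p m f f' := by
  simp [Meaning, jForm, Pairing.pair, Pairing.lit]

theorem meaning_eqUpTo : Meaning (jEqUpTo a f) ↔ f = code (eqUpTo a) := by
  simp [Meaning, jEqUpTo, Pairing.pair, Pairing.lit]

theorem meaning_axiom : Meaning (jAxiom f) ↔ ∃ φ, RAxiom φ ∧ code φ = f := by
  simp [Meaning, jAxiom, Pairing.pair, Pairing.lit]

theorem meaning_prov : Meaning (jProv n f) ↔ ProvMeaning n f := by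
  simp [Meaning, jProv, Pairing.pair, Pairing.lit]

end

theorem meaning_of_holds {j : ℕ} : Holds j → Meaning j := by
  refine Holds.sound fun r e h => ?_
  cases r with
  | addZero => exact meaning_add.2 rfl
  | addSucc =>
    have h : e 0 + e 1 = e 2 := meaning_add.1 h.1
    exact meaning_add.2 (congrArg Nat.succ h)
  | mulZero => exact meaning_mul.2 rfl
  | mulSucc =>
    have h1 : e 0 * e 1 = e 2 := meaning_mul.1 h.1
    have h2 : e 2 + e 0 = e 3 := meaning_add.1 h.2.1
    exact meaning_mul.2 (show e 0 * e 1 + e 0 = e 3 by rw [h1, h2])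
  | numZero => exact meaning_num.2 rfl
  | numSucc =>
    have h : e 1 = _ := meaning_num.1 h.1
    exact meaning_num.2 (congrArg encSucc h)
  | insLt =>
    have h : e 0 + 1 + e 1 = e 2 := meaning_add.1 h.1
    exact meaning_var.2 ((isIns_substVal (e 2) (e 3)).1 (e 0) (by omega))
  | insGe =>
    have h1 : e 0 + e 1 = e 2 := meaning_add.1 h.1
    have h2 : e 2 + e 3 = e 4 := meaning_add.1 h.2.1
    have h3 := (isIns_substVal (e 0) (e 3)).2 (e 1)
    rw [h1, h2] at h3
    exact meaning_var.2 h3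
  | subLt =>
    have h : e 0 + 1 + e 1 = e 2 := meaning_add.1 h.1
    exact meaning_var.2 ((isSub_substVal (e 2) (e 3)).1 (e 0) (by omega))
  | subEq => exact meaning_var.2 (isSub_substVal (e 0) (e 1)).2.1
  | subGt =>
    have h1 : e 0 + e 1 = e 2 := meaning_add.1 h.1
    have h3 := (isSub_substVal (e 0) (e 3)).2.2 (e 1)
    rw [h1] at h3
    exact meaning_var.2 h3
  | termVar =>
    have h1 : e 2 = substVal (e 0) (e 1) := meaning_var.1 h.1
    have h2 : e 1 + 1 + e 3 = e 4 := meaning_add.1 h.2.1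
    have hi : e 1 < e 4 := by omega
    exact meaning_term.2 ⟨bvar ⟨e 1, hi⟩, termCode_bvar _, fun h => (h.1 ⟨e 1, hi⟩).trans h1.symm⟩
  | termZero => exact meaning_term.2 ⟨numeral 0, rfl, fun _ => rfl⟩
  | termSucc =>
    obtain ⟨s, hs, h⟩ : TermMeaning (e 0) (e 1) (e 2) (e 3) := meaning_term.1 h.1
    exact meaning_term.2 ⟨Term.func (L := arith) ArithFunc.succ ![s], congrArg encSucc hs,
      fun hσ => congrArg encSucc (h hσ)⟩
  | termAdd =>
    obtain ⟨s, hs, h1⟩ : TermMeaning (e 0) (e 1) (e 2) (e 3) := meaning_term.1 h.1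
    obtain ⟨t, ht, h2⟩ : TermMeaning (e 0) (e 1) (e 4) (e 5) := meaning_term.1 h.2.1
    exact meaning_term.2 ⟨add s t, congrArg₂ encAdd hs ht,
      fun hσ => congrArg₂ encAdd (h1 hσ) (h2 hσ)⟩
  | termMul =>
    obtain ⟨s, hs, h1⟩ : TermMeaning (e 0) (e 1) (e 2) (e 3) := meaning_term.1 h.1
    obtain ⟨t, ht, h2⟩ : TermMeaning (e 0) (e 1) (e 4) (e 5) := meaning_term.1 h.2.1
    exact meaning_term.2 ⟨mul s t, congrArg₂ encMul hs ht,
      fun hσ => congrArg₂ encMul (h1 hσ) (h2 hσ)⟩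
  | formFalsum => exact meaning_form.2 ⟨.falsum, rfl, fun _ => rfl⟩
  | formEqual =>
    obtain ⟨s, hs, h1⟩ : TermMeaning (e 0) (e 1) (e 2) (e 3) := meaning_term.1 h.1
    obtain ⟨t, ht, h2⟩ : TermMeaning (e 0) (e 1) (e 4) (e 5) := meaning_term.1 h.2.1
    exact meaning_form.2 ⟨.equal s t, congrArg₂ encEqual hs ht,
      fun hσ => congrArg₂ encEqual (h1 hσ) (h2 hσ)⟩
  | formImp =>
    obtain ⟨φ, hφ, h1⟩ : FormMeaning (e 0) (e 1) (e 2) (e 3) := meaning_form.1 h.1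
    obtain ⟨ψ, hψ, h2⟩ : FormMeaning (e 0) (e 1) (e 4) (e 5) := meaning_form.1 h.2.1
    exact meaning_form.2 ⟨.imp φ ψ, congrArg₂ encImp hφ hψ,
      fun hσ => congrArg₂ encImp (h1 hσ) (h2 hσ)⟩
  | formAll =>
    obtain ⟨φ, hφ, h⟩ : FormMeaning (e 0) (e 1 + 1) (e 2) (e 3) := meaning_form.1 h.1
    exact meaning_form.2 ⟨.all φ, congrArg encAll hφ, fun hσ => congrArg encAll (h hσ.up)⟩
  | eqUpToZero =>
    have h : e 0 = termCode (numeral 0 : arith.Term (Empty ⊕ Fin 0)) := meaning_num.1 h.1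
    rw [termCode_numeral] at h
    refine meaning_eqUpTo.2 (Eq.trans ?_ code_eqUpTo_zero.symm)
    rw [← h]
    rfl
  | eqUpToSucc =>
    have h1 : e 1 = code (eqUpTo (e 0)) := meaning_eqUpTo.1 h.1
    have h2 : e 2 = termCode (numeral (e 0 + 1) : arith.Term (Empty ⊕ Fin 0)) :=
      meaning_num.1 h.2.1
    rw [termCode_numeral] at h2
    refine meaning_eqUpTo.2 (Eq.trans ?_ (code_eqUpTo_succ (e 0)).symm)
    rw [← h1, ← h2]
    rfl
  | ax1 =>
    have h1 : e 1 = _ := meaning_num.1 h.1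
    have h2 : e 3 = _ := meaning_num.1 h.2.1
    have h3 : e 5 = _ := meaning_num.1 h.2.2.1
    have h4 : e 0 + e 2 = e 4 := meaning_add.1 h.2.2.2.1
    refine meaning_axiom.2 ⟨_, .ax1 (e 0) (e 2), ?_⟩
    rw [h4]
    exact congrArg₂ encEqual (congrArg₂ encAdd h1.symm h2.symm) h3.symm
  | ax2 =>
    have h1 : e 1 = _ := meaning_num.1 h.1
    have h2 : e 3 = _ := meaning_num.1 h.2.1
    have h3 : e 5 = _ := meaning_num.1 h.2.2.1
    have h4 : e 0 * e 2 = e 4 := meaning_mul.1 h.2.2.2.1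
    refine meaning_axiom.2 ⟨_, .ax2 (e 0) (e 2), ?_⟩
    rw [h4]
    exact congrArg₂ encEqual (congrArg₂ encMul h1.symm h2.symm) h3.symm
  | ax3 =>
    have h1 : e 1 = _ := meaning_num.1 h.1
    have h2 : e 3 = _ := meaning_num.1 h.2.1
    have h3 : e 0 + 1 + e 4 = e 2 := meaning_add.1 h.2.2.1
    exact meaning_axiom.2 ⟨_, .ax3 (e 0) (e 2) (by omega),
      congrArg₂ (fun a b => encNot (encEqual a b)) h1.symm h2.symm⟩
  | ax3' =>
    have h1 : e 1 = _ := meaning_num.1 h.1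
    have h2 : e 3 = _ := meaning_num.1 h.2.1
    have h3 : e 0 + 1 + e 4 = e 2 := meaning_add.1 h.2.2.1
    exact meaning_axiom.2 ⟨_, .ax3 (e 2) (e 0) (by omega),
      congrArg₂ (fun a b => encNot (encEqual a b)) h2.symm h1.symm⟩
  | ax4 =>
    have h1 : e 1 = termCode (numeral (e 0) : arith.Term (Empty ⊕ Fin 0)) := meaning_num.1 h.1
    have h2 : e 2 = code (eqUpTo (e 0)) := meaning_eqUpTo.1 h.2.1
    refine meaning_axiom.2 ⟨_, .ax4 (e 0), ?_⟩
    rw [code, code, code_le, termCode_numeral (m := 0), ← h1, ← h2]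
    rfl
  | ax5 =>
    have h1 : e 1 = termCode (numeral (e 0) : arith.Term (Empty ⊕ Fin 0)) := meaning_num.1 h.1
    refine meaning_axiom.2 ⟨_, .ax5 (e 0), ?_⟩
    rw [code]
    change Nat.pair 4 (encImp (encNot (code (le _ _))) (code (le _ _))) = _
    rw [code_le, code_le, termCode_numeral (m := 0), ← h1]
    rfl
  | ax =>
    obtain ⟨φ, hφ, h1⟩ : ∃ φ, RAxiom φ ∧ code φ = e 0 := meaning_axiom.1 h.1
    obtain ⟨φ', h2, h3⟩ : FormMeaning (ins 0 (e 1)) 0 (e 0) (e 2) := meaning_form.1 h.2.1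
    obtain rfl := code_injective (h1.trans h2.symm)
    exact meaning_prov.2 ⟨_, .ax hφ, h3 (isIns_substVal _ _).shift⟩
  | impIntro =>
    obtain ⟨φ, h1, -⟩ : FormMeaning _ (e 0) (e 1) (e 2) := meaning_form.1 h.1
    obtain ⟨ψ, h2, -⟩ : FormMeaning _ (e 0) (e 3) (e 4) := meaning_form.1 h.2.1
    exact meaning_prov.2 ⟨_, .imp_intro φ ψ,
      congrArg₂ (fun a b => encImp a (encImp b a)) h1 h2⟩
  | impDistrib =>
    obtain ⟨φ, h1, -⟩ : FormMeaning _ (e 0) (e 1) (e 2) := meaning_form.1 h.1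
    obtain ⟨ψ, h2, -⟩ : FormMeaning _ (e 0) (e 3) (e 4) := meaning_form.1 h.2.1
    obtain ⟨χ, h3, -⟩ : FormMeaning _ (e 0) (e 5) (e 6) := meaning_form.1 h.2.2.1
    refine meaning_prov.2 ⟨_, .imp_distrib φ ψ χ, ?_⟩
    simp only [code, h1, h2, h3]
    rfl
  | dne =>
    obtain ⟨φ, h1, -⟩ : FormMeaning _ (e 0) (e 1) (e 2) := meaning_form.1 h.1
    exact meaning_prov.2 ⟨_, .dne φ, congrArg (fun a => encImp (encNot (encNot a)) a) h1⟩
  | allElim =>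
    obtain ⟨t, h1, -⟩ : TermMeaning _ (e 0) (e 1) (e 2) := meaning_term.1 h.1
    obtain ⟨φ, h2, h3⟩ : FormMeaning (sub (e 0) (e 1)) (e 0 + 1) (e 3) (e 4) :=
      meaning_form.1 h.2.1
    rw [← h1] at h3
    exact meaning_prov.2 ⟨_, .all_elim φ t,
      congrArg₂ (fun a b => encImp (encAll a) b) h2 (h3 (isSub_substVal _ _).inst)⟩
  | allImp =>
    obtain ⟨φ, h1, h2⟩ : FormMeaning (ins (e 0) 1) (e 0) (e 1) (e 2) := meaning_form.1 h.1
    obtain ⟨ψ, h3, -⟩ : FormMeaning _ (e 0 + 1) (e 3) (e 4) := meaning_form.1 h.2.1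
    have h2 : code (flift φ) = e 2 := h2 (isIns_substVal _ _).lift
    refine meaning_prov.2 ⟨_, .all_imp φ ψ, ?_⟩
    simp only [code, h1, h2, h3]
    rfl
  | eqRefl =>
    obtain ⟨t, h1, -⟩ : TermMeaning _ (e 0) (e 1) (e 2) := meaning_term.1 h.1
    exact meaning_prov.2 ⟨_, .eq_refl t, congrArg (fun a => encEqual a a) h1⟩
  | eqSubst =>
    obtain ⟨s, h1, -⟩ : TermMeaning _ (e 0) (e 1) (e 2) := meaning_term.1 h.1
    obtain ⟨t, h2, -⟩ : TermMeaning _ (e 0) (e 3) (e 4) := meaning_term.1 h.2.1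
    obtain ⟨φ, h3, h4⟩ : FormMeaning (sub (e 0) (e 1)) (e 0 + 1) (e 5) (e 6) :=
      meaning_form.1 h.2.2.1
    obtain ⟨φ', h5, h6⟩ : FormMeaning (sub (e 0) (e 3)) (e 0 + 1) (e 5) (e 7) :=
      meaning_form.1 h.2.2.2.1
    obtain rfl := code_injective (h3.trans h5.symm)
    rw [← h1] at h4
    rw [← h2] at h6
    have h4 : code (inst φ s) = e 6 := h4 (isSub_substVal _ _).inst
    have h6 : code (inst φ t) = e 7 := h6 (isSub_substVal _ _).inst
    refine meaning_prov.2 ⟨_, .eq_subst φ s t, ?_⟩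
    simp only [code, h1, h2, h4, h6]
    rfl
  | nonempty => exact meaning_prov.2 ⟨_, .nonempty, rfl⟩
  | mp =>
    obtain ⟨χ, h1, h2⟩ : ProvMeaning (e 0) (encImp (e 1) (e 2)) := meaning_prov.1 h.1
    obtain ⟨φ, h3, h4⟩ : ProvMeaning (e 0) (e 1) := meaning_prov.1 h.2.1
    obtain ⟨φ', ψ, rfl, h5, h6⟩ := exists_of_code_eq_imp h2
    obtain rfl := code_injective (h4.trans h5.symm)
    exact meaning_prov.2 ⟨ψ, h1.mp h3, h6⟩
  | gen =>
    obtain ⟨φ, h1, h2⟩ : ProvMeaning (e 0 + 1) (e 1) := meaning_prov.1 h.1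
    exact meaning_prov.2 ⟨_, h1.gen, congrArg encAll h2⟩

end Soundness

section Completeness

theorem holds_add (a b : ℕ) : Holds (jAdd a b (a + b)) := by
  induction b with
  | zero => exact Holds.rule .addZero [a] trivial
  | succ b ih => exact Holds.rule .addSucc [a, b, a + b] ⟨ih, trivial⟩

theorem holds_lt {a b : ℕ} (h : a < b) : Holds (jAdd (a + 1) (b - (a + 1)) b) := by
  have := holds_add (a + 1) (b - (a + 1))
  rwa [Nat.add_sub_cancel' h] at this

theorem holds_mul (a b : ℕ) : Holds (jMul a b (a * b)) := by
  induction b with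
  | zero => exact Holds.rule .mulZero [a] trivial
  | succ b ih => exact Holds.rule .mulSucc [a, b, a * b, a * b + a] ⟨ih, holds_add _ _, trivial⟩

theorem holds_num (a : ℕ) {n : ℕ} :
    Holds (jNum a (termCode (numeral a : arith.Term (Empty ⊕ Fin n)))) := by
  induction a with
  | zero => exact Holds.rule .numZero [] trivial
  | succ a ih => exact Holds.rule .numSucc [a, _] ⟨ih, trivial⟩

theorem isIns_holds (a k : ℕ) : IsIns (fun i t => Holds (jVar (ins a k) i t)) a k :=
  ⟨fun i h => Holds.rule .insLt [i, _, a, k] ⟨holds_lt h, trivial⟩,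
    fun j => Holds.rule .insGe [a, j, a + j, k, a + j + k]
      ⟨holds_add _ _, holds_add _ _, trivial⟩⟩

theorem isSub_holds (n t : ℕ) : IsSub (fun i u => Holds (jVar (sub n t) i u)) n t :=
  ⟨fun i h => Holds.rule .subLt [i, _, n, t] ⟨holds_lt h, trivial⟩, Holds.rule .subEq [n, t] trivial,
    fun j => Holds.rule .subGt [n, j, n + j, t] ⟨holds_add _ _, trivial⟩⟩

theorem holds_term {p m n : ℕ} {σ : Fin m → arith.Term (Empty ⊕ Fin n)}
    (hσ : Compat (fun i u => Holds (jVar p i u)) σ) (τ : arith.Term (Empty ⊕ Fin m)) :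
    Holds (jTerm p m (termCode τ) (termCode (tsubst σ τ))) := by
  induction τ using term_cases with
  | hv i => exact Holds.rule .termVar [p, i, _, _, m] ⟨hσ.1 i, holds_lt i.2, trivial⟩
  | @hf k f ts ih =>
    change ArithFunc k at f
    cases f with
    | zero => exact Holds.rule .termZero [p, m] trivial
    | succ => exact Holds.rule .termSucc [p, m, _, _] ⟨ih 0, trivial⟩
    | add => exact Holds.rule .termAdd [p, m, _, _, _, _] ⟨ih 0, ih 1, trivial⟩
    | mul => exact Holds.rule .termMul [p, m, _, _, _, _] ⟨ih 0, ih 1, trivial⟩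

theorem holds_form {p : ℕ} : ∀ {m n : ℕ} {σ : Fin m → arith.Term (Empty ⊕ Fin n)}
    (_ : Compat (fun i u => Holds (jVar p i u)) σ) (φ : arith.BoundedFormula Empty m),
    Holds (jForm p m (code φ) (code (fsubst σ φ)))
  | m, _, _, _, .falsum => Holds.rule .formFalsum [p, m] trivial
  | m, _, _, h, .equal s t => Holds.rule .formEqual [p, m, _, _, _, _]
      ⟨holds_term h s, holds_term h t, trivial⟩
  | _, _, _, _, .rel r _ => nomatch r
  | m, _, _, h, .imp φ ψ => Holds.rule .formImp [p, m, _, _, _, _]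
      ⟨holds_form h φ, holds_form h ψ, trivial⟩
  | m, _, _, h, .all φ => Holds.rule .formAll [p, m, _, _] ⟨holds_form h.up φ, trivial⟩

theorem holds_eqUpTo (n : ℕ) : Holds (jEqUpTo n (code (eqUpTo n))) := by
  induction n with
  | zero =>
    rw [code_eqUpTo_zero]
    exact Holds.rule .eqUpToZero [_] ⟨holds_num 0, trivial⟩
  | succ n ih =>
    rw [code_eqUpTo_succ]
    exact Holds.rule .eqUpToSucc [n, _, _] ⟨ih, holds_num (n + 1), trivial⟩

theorem holds_axiom {φ : arith.Sentence} (h : RAxiom φ) : Holds (jAxiom (code φ)) := by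
  cases h with
  | ax1 m n =>
    exact Holds.rule .ax1 [m, _, n, _, m + n, _]
      ⟨holds_num m, holds_num n, holds_num (m + n), holds_add m n, trivial⟩
  | ax2 m n =>
    exact Holds.rule .ax2 [m, _, n, _, m * n, _]
      ⟨holds_num m, holds_num n, holds_num (m * n), holds_mul m n, trivial⟩
  | ax3 m n h =>
    rcases h.lt_or_gt with h | h
    · exact Holds.rule .ax3 [m, _, n, _, _] ⟨holds_num m, holds_num n, holds_lt h, trivial⟩
    · exact Holds.rule .ax3' [n, _, m, _, _] ⟨holds_num n, holds_num m, holds_lt h, trivial⟩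
  | ax4 n =>
    rw [code, code, code_le]
    exact Holds.rule .ax4 [n, _, _] ⟨holds_num n, holds_eqUpTo n, trivial⟩
  | ax5 n =>
    change Holds (jAxiom (encAll (encImp (encNot (code (le _ _))) (code (le _ _)))))
    rw [code_le, code_le]
    exact Holds.rule .ax5 [n, _] ⟨holds_num n, trivial⟩

theorem holds_prov {n : ℕ} {φ : arith.BoundedFormula Empty n} (h : Provable R φ) :
    Holds (jProv n (code φ)) := by
  have hF {n : ℕ} := holds_form (isIns_holds 0 0).id (n := n)
  have hT {n : ℕ} := holds_term (isIns_holds 0 0).id (n := n)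
  induction h with
  | @ax n φ h =>
    exact Holds.rule .ax [_, n, _]
      ⟨holds_axiom h, holds_form (isIns_holds 0 n).shift φ, trivial⟩
  | @imp_intro n φ ψ => exact Holds.rule .impIntro [n, _, _, _, _] ⟨hF φ, hF ψ, trivial⟩
  | @imp_distrib n φ ψ χ =>
    exact Holds.rule .impDistrib [n, _, _, _, _, _, _]
      ⟨hF φ, hF ψ, hF χ, trivial⟩
  | @dne n φ => exact Holds.rule .dne [n, _, _] ⟨hF φ, trivial⟩
  | @all_elim n φ t =>
    exact Holds.rule .allElim [n, _, _, _, _]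
      ⟨hT t, holds_form (isSub_holds n _).inst φ, trivial⟩
  | @all_imp n φ ψ =>
    exact Holds.rule .allImp [n, _, _, _, _]
      ⟨holds_form (isIns_holds n 1).lift φ, hF ψ, trivial⟩
  | @eq_refl n t => exact Holds.rule .eqRefl [n, _, _] ⟨hT t, trivial⟩
  | @eq_subst n φ s t =>
    exact Holds.rule .eqSubst [n, _, _, _, _, _, _, _]
      ⟨hT s, hT t, holds_form (isSub_holds n _).inst φ, holds_form (isSub_holds n _).inst φ,
        trivial⟩
  | @nonempty n => exact Holds.rule .nonempty [n] trivial
  | @mp n φ ψ _ _ h1 h2 => exact Holds.rule .mp [n, _, _] ⟨h1, h2, trivial⟩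
  | @gen n φ _ h => exact Holds.rule .gen [n, _] ⟨h, trivial⟩

/-- The theorems of `R` are the sentences derivable from finitely many Horn clauses. -/
theorem isRETheory_R : IsRETheory R := by
  have h : REPred fun k => Holds (jProv 0 k) :=
    isRE_holds.comp (Primrec₂.natPair.comp (.const 8)
      (Primrec₂.natPair.comp (.const 0) .id)).to_comp
  exact h.of_eq fun k => ⟨fun h => meaning_prov.1 (meaning_of_holds h),
    fun ⟨_, h, e⟩ => e ▸ holds_prov h⟩

end Completeness

end MetaR

theorem mainTheorem2 :
    (MetaR.Consistent MetaR.R ∧ MetaR.IsRETheory MetaR.R) ∧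
    (∀ A B : Set ℕ, MetaR.IsRE A → MetaR.IsRE B → A ∩ B = ∅ →
      (∃ φ₀ φ₁ : MetaR.arith.BoundedFormula Empty 2,
        MetaR.IsBounded φ₀ ∧ MetaR.IsBounded φ₁ ∧
        MetaR.DefinesInN φ₀.ex A ∧ MetaR.DefinesInN φ₁.ex B) ∧
      (∀ φ₀ φ₁ : MetaR.arith.BoundedFormula Empty 2,
        MetaR.IsBounded φ₀ → MetaR.IsBounded φ₁ →
        MetaR.DefinesInN φ₀.ex A → MetaR.DefinesInN φ₁.ex B →
        MetaR.SeparatesIn MetaR.R (MetaR.witnessLT φ₀ φ₁) A B)) ∧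
    MetaR.Rosser MetaR.R ∧
    MetaR.EI MetaR.R ∧
    MetaR.RI MetaR.R ∧
    MetaR.TP MetaR.R ∧
    MetaR.EHU MetaR.R ∧
    MetaR.EU MetaR.R ∧
    MetaR.Creative MetaR.R ∧
    MetaR.ZeroJump MetaR.R ∧
    MetaR.REW MetaR.R ∧
    MetaR.RFD MetaR.R ∧
    MetaR.RSS MetaR.R ∧
    MetaR.RSW MetaR.R := by
  refine ⟨⟨MetaR.consistent_R, MetaR.isRETheory_R⟩, fun A B hA hB hAB => ⟨?_, ?_⟩,
    MetaR.rosser_R, MetaR.ei_R, MetaR.ri_R, MetaR.tp_R MetaR.isRETheory_R, MetaR.ehu_R, MetaR.eu_R,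
    MetaR.creative_R MetaR.isRETheory_R, MetaR.zeroJump_R MetaR.isRETheory_R, MetaR.rew_R,
    MetaR.rfd_R, MetaR.rss_R, MetaR.rsw_R⟩
  · obtain ⟨φ₀, h₀, hA⟩ := MetaR.exists_isBounded hA
    obtain ⟨φ₁, h₁, hB⟩ := MetaR.exists_isBounded hB
    exact ⟨φ₀, φ₁, h₀, h₁, hA, hB⟩
  · exact fun φ₀ φ₁ h₀ h₁ hA hB => MetaR.separatesIn_witnessLT hAB h₀ h₁ hA hB
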